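/- **Setting.** Let $\phi$ be ReLU or Tanh, $\sigma_b,\sigma_w\ge 0$, and $Z\sim\mathcal N(0,1)$. The pair $(\sigma_b,\sigma_w)$ is on the Edge of Chaos (EOC) if $\sigma_w^2\,\mathbb E[\phi'(\sqrt q Z)^2]=1$ for some $q>0$ that is the limit of the variance recursion $q_{l+1}=\sigma_b^2+\sigma_w^2\mathbb E[\phi(\sqrt{q_l}Z)^2]$ started at some $q_1>0$. *Fully connected networks (FFNN).* For $d\ge1$ and $x,x'\in\mathbb R^d$ let $q^1(x,x')=\sigma_b^2+\frac{\sigma_w^2}{d}x\cdot x'$ and, for $l\ge2$, $q^l(x,x')=\sigma_b^2+\sigma_w^2\mathbb E[\phi(u)\phi(v)]$ and $\dot q^l(x,x')=\sigma_w^2\mathbb E[\phi'(u)\phi'(v)]$, where $(u,v)$ is a centred Gaussian pair with variances $q^{l-1}(x,x)$, $q^{l-1}(x',x')$ and covariance $q^{l-1}(x,x')$. The infinite-width neural tangent kernel is $K^1=q^1$, $K^l=\dot q^l K^{l-1}+q^l$ for $l\ge 2$, and $AK^L=K^L/L$. Let $c^1(x,x')=q^1(x,x')/\sqrt{q^1(x,x)q^1(x',x')}$.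 For a compact set $E\subset\mathbb R^d$ of inputs and $\epsilon\in(0,1)$ let $B_\epsilon$ be the set of pairs $(x,x')\in E\times E$ with $q^1(x,x),q^1(x',x')>0$ and $c^1(x,x')\le1-\epsilon$. *Convolutional networks (CNN).* Inputs are $x=(x_{j,\alpha})$ with $n_0\ge1$ channels and $M\ge1$ positions $\alpha\in\mathbb Z/M$ (periodic boundary), so $d=n_0M$; the filter is $[-k:k]$. Let $q^1_{\alpha,\alpha'}(x,x')=\sigma_b^2+\frac{\sigma_w^2}{n_0(2k+1)}\sum_{j}\sum_{|\beta|\le k}x_{j,\alpha+\beta}x'_{j,\alpha'+\beta}$. For $l\ge2$ let $\hat q^l_{\alpha,\alpha'}(x,x')=\sigma_b^2+\sigma_w^2\mathbb E[\phi(u)\phi(v)]$ and $\dot q^l_{\alpha,\alpha'}(x,x')=\sigma_w^2\mathbb E[\phi'(u)\phi'(v)]$, with $(u,v)$ centred Gaussian with variances $q^{l-1}_{\alpha,\alpha}(x,x)$, $q^{l-1}_{\alpha',\alpha'}(x',x')$ and covariance $q^{l-1}_{\alpha,\alpha'}(x,x')$, and let $q^l_{\alpha,\alpha'}=\frac1{2k+1}\sum_{|\beta|\le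 k}\hat q^l_{\alpha+\beta,\alpha'+\beta}$. The kernel is $K^1_{\alpha,\alpha'}=q^1_{\alpha,\alpha'}$, $K^l_{\alpha,\alpha'}=\frac1{2k+1}\sum_{|\beta|\le k}\big(\dot q^l K^{l-1}+\hat q^l\big)_{\alpha+\beta,\alpha'+\beta}$ for $l\ge2$, and $AK^L=K^L/L$. *Assumption 1* on a set $X$ of inputs: for all $x,x'\in X$, $q^1_{\alpha,\alpha'}(x,x')$ does not depend on $\alpha,\alpha'$. For CNNs all suprema are over inputs in $E\cap X$ ($E$ compact), and $B_\epsilon$ is the set of pairs $(x,x')$ of such inputs with, for all $\alpha,\alpha'$, $q^1_{\alpha,\alpha}(x,x),\,q^1_{\alpha',\alpha'}(x',x')>0$ and $q^1_{\alpha,\alpha'}(x,x')\le(1-\epsilon)\sqrt{q^1_{\alpha,\alpha}(x,x)\,q^1_{\alpha',\alpha'}(x',x')}$. **Theorem (NTK on the Edge of Chaos).** Let $\phi$ be ReLU or Tanh and $(\sigma_b,\sigma_w)\in\mathrm{EOC}$. There is a constant $\lambda\in(0,1)$, depending only on $\phi,\sigma_b,\sigma_w$, and for Tanh a constant $q>0$,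 depending only on $\sigma_b,\sigma_w$, with $q^l(x,x)\to q$ as $l\to\infty$ for every FFNN input $x$, such that with $$AK^\infty(x,x')=\frac{\sigma_w^2\|x\|\,\|x'\|}{d}\big(1-(1-\lambda)\mathbf 1_{x\ne x'}\big)\ \text{(ReLU)},\qquad AK^\infty(x,x')=q\big(1-(1-\lambda)\mathbf 1_{x\ne x'}\big)\ \text{(Tanh)}$$ the following holds for FFNNs of every input dimension and every compact $E$, and for CNNs under Assumption 1 (for every $n_0,M,k,E,X$ and all $\alpha,\alpha'$, with $AK^L=AK^L_{\alpha,\alpha'}$). 1. (Diagonal.) For ReLU, $AK^L(x,x)=AK^\infty(x,x)$ exactly, for all $L\ge1$ and all inputs $x$. For Tanh, $\sup_x|AK^L(x,x)-AK^\infty(x,x)|=\mathcal O(L^{-1})$, and it is $\Theta(L^{-1})$ as soon as at least one of the inputs $x$ has first-layer variance different from $q$. 2. (Off the diagonal.) For every $\epsilon\in(0,1)$ for which $B_\epsilon$ is non-empty, $\sup_{(x,x')\in B_\epsilon}|AK^L(x,x')-AK^\infty(x,x')|=\Theta(\log(L)\,L^{-1})$. Here the suprema are over $x\in E$ (FFNN)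 or $x\in E\cap X$ (CNN) in 1, they are finite for all large $L$, and $g(L)=\Theta(m(L))$ (resp. $\mathcal O(m(L))$) means $A\,m(L)\le g(L)\le B\,m(L)$ (resp. $g(L)\le B\,m(L)$) for all large $L$, with constants $A,B>0$ independent of $L$. -/

import Mathlib

open MeasureTheory ProbabilityTheory Filter Topology

noncomputable section

namespace NTKEOC

/-- The ReLU activation. -/
def relu (u : ℝ) : ℝ := max u 0

/-- `E[ψ(u) ψ(v)]` for a centred Gaussian pair `(u, v)` with variances `a`, `b` and covariance `p`:
with `c = p / √(a b)`, the pair is realised as `u = √a Z₁`, `v = √b (c Z₁ + √(1 - c²) Z₂)` for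
independent standard normal variables `Z₁`, `Z₂`. -/
def gaussE (ψ : ℝ → ℝ) (a b p : ℝ) : ℝ :=
  ∫ z : ℝ × ℝ,
      ψ (√a * z.1) *
        ψ (√b * (p / √(a * b) * z.1 + √(1 - (p / √(a * b)) ^ 2) * z.2))
    ∂((gaussianReal 0 1).prod (gaussianReal 0 1))

/-! ### The Edge of Chaos -/

/-- One step of the variance recursion: `q ↦ σ_b² + σ_w² E[φ(√q Z)²]`. -/
def varianceMap (φ : ℝ → ℝ) (σb σw q : ℝ) : ℝ :=
  σb ^ 2 + σw ^ 2 * ∫ z, φ (√q * z) ^ 2 ∂(gaussianReal 0 1)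

/-- `χ(q) = σ_w² E[φ'(√q Z)²]`. -/
def chi (φ : ℝ → ℝ) (σw q : ℝ) : ℝ :=
  σw ^ 2 * ∫ z, deriv φ (√q * z) ^ 2 ∂(gaussianReal 0 1)

/-- `q > 0` is the limit of the variance recursion started at some positive variance. (For Tanh the
limit does not depend on the starting point; for ReLU with `(σ_b, σ_w) = (0, √2)` every positive
number is such a limit, and `χ` takes the same value at all of them.) -/
def IsLimitingVariance (φ : ℝ → ℝ) (σb σw q : ℝ) : Prop :=
  0 < q ∧ ∃ q₁ : ℝ, 0 < q₁ ∧ Tendsto (fun l : ℕ => (varianceMap φ σb σw)^[l] q₁) atTop (𝓝 q)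

/-- The Edge of Chaos: the pairs `(σ_b, σ_w)` with `σ_w² E[φ'(√q Z)²] = 1` at a limiting
variance `q`. -/
def EOC (φ : ℝ → ℝ) : Set (ℝ × ℝ) :=
  {s | 0 ≤ s.1 ∧ 0 ≤ s.2 ∧ ∃ q, IsLimitingVariance φ s.1 s.2 q ∧ chi φ s.2 q = 1}

/-! ### Fully connected networks in the infinite width limit -/

/-- Inputs of a fully connected network. -/
abbrev Vec (d : ℕ) := EuclideanSpace ℝ (Fin d)

/-- First-layer covariance `q¹(x, x') = σ_b² + (σ_w² / d) x ⬝ x'`. -/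
def ffnnCov₁ (σb σw : ℝ) {d : ℕ} (x x' : Vec d) : ℝ :=
  σb ^ 2 + σw ^ 2 / d * ∑ i, x i * x' i

/-- Covariance `qˡ(x, x')` of the pre-activations of layer `l ≥ 1` (and `0` for `l = 0`). -/
def ffnnCov (φ : ℝ → ℝ) (σb σw : ℝ) {d : ℕ} : ℕ → Vec d → Vec d → ℝ
  | 0, _, _ => 0
  | 1, x, x' => ffnnCov₁ σb σw x x'
  | l + 2, x, x' =>
      σb ^ 2 + σw ^ 2 * gaussE φ (ffnnCov φ σb σw (l + 1) x x) (ffnnCov φ σb σw (l + 1) x' x')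
        (ffnnCov φ σb σw (l + 1) x x')

/-- `q̇ˡ⁺¹(x, x') = σ_w² E[φ'(yˡ(x)) φ'(yˡ(x'))]`. -/
def ffnnDot (φ : ℝ → ℝ) (σb σw : ℝ) {d : ℕ} (l : ℕ) (x x' : Vec d) : ℝ :=
  σw ^ 2 * gaussE (deriv φ) (ffnnCov φ σb σw l x x) (ffnnCov φ σb σw l x' x')
    (ffnnCov φ σb σw l x x')

/-- The infinite-width neural tangent kernel `Kˡ(x, x')`: `K¹ = q¹` and
`Kˡ = q̇ˡ Kˡ⁻¹ + qˡ` for `l ≥ 2` (and `0` for `l = 0`). -/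
def ffnnNTK (φ : ℝ → ℝ) (σb σw : ℝ) {d : ℕ} : ℕ → Vec d → Vec d → ℝ
  | 0, _, _ => 0
  | 1, x, x' => ffnnCov₁ σb σw x x'
  | l + 2, x, x' =>
      ffnnDot φ σb σw (l + 1) x x' * ffnnNTK φ σb σw (l + 1) x x' + ffnnCov φ σb σw (l + 2) x x'

/-- The average kernel `AK^L = K^L / L`. -/
def ffnnANTK (φ : ℝ → ℝ) (σb σw : ℝ) {d : ℕ} (L : ℕ) (x x' : Vec d) : ℝ :=
  ffnnNTK φ σb σw L x x' / L

/-- First-layer correlation `c¹(x, x')`. -/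
def ffnnCorr₁ (σb σw : ℝ) {d : ℕ} (x x' : Vec d) : ℝ :=
  ffnnCov₁ σb σw x x' / √(ffnnCov₁ σb σw x x * ffnnCov₁ σb σw x' x')

/-- The pairs of inputs from `E` whose first-layer correlation is defined (both variances are
positive) and at most `1 - ε`. -/
def ffnnB (σb σw : ℝ) {d : ℕ} (E : Set (Vec d)) (ε : ℝ) : Set (Vec d × Vec d) :=
  {p | p.1 ∈ E ∧ p.2 ∈ E ∧ 0 < ffnnCov₁ σb σw p.1 p.1 ∧ 0 < ffnnCov₁ σb σw p.2 p.2 ∧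
    ffnnCorr₁ σb σw p.1 p.2 ≤ 1 - ε}

/-! ### One-dimensional convolutional networks in the infinite width limit -/

/-- Inputs of a 1D convolutional network: `n₀` channels with `M` neurons each and periodic
boundary conditions, i.e. vectors of `ℝ^(n₀ M)`. -/
abbrev Sig (n₀ M : ℕ) := EuclideanSpace ℝ (Fin n₀ × ZMod M)

/-- The average over the filter `[-k : k]` of a function of pairs of positions, along the common
translates of `(α, α')`. -/
def filterAvg (k : ℕ) {M : ℕ} (F : ZMod M → ZMod M → ℝ) (α α' : ZMod M) : ℝ :=
  1 / (2 * (k : ℝ) + 1) * ∑ β ∈ Finset.Icc (-(k : ℤ)) k, F (α + (β : ZMod M)) (α' + (β : ZMod M))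

/-- First-layer covariance
`q¹_{α,α'}(x, x') = σ_b² + σ_w² / (n₀ (2k+1)) ∑_j ∑_β x_{j,α+β} x'_{j,α'+β}`. -/
def cnnCov₁ (σb σw : ℝ) (k : ℕ) {n₀ M : ℕ} (x x' : Sig n₀ M) (α α' : ZMod M) : ℝ :=
  σb ^ 2 + σw ^ 2 / (n₀ * (2 * (k : ℝ) + 1)) *
    ∑ j, ∑ β ∈ Finset.Icc (-(k : ℤ)) k, x (j, α + (β : ZMod M)) * x' (j, α' + (β : ZMod M))

/-- Covariance `qˡ_{α,α'}(x, x')` of layer `l ≥ 1` (and `0` for `l = 0`): for `l ≥ 2` it is the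
filter average of `q̂ˡ_{α,α'}(x, x') = σ_b² + σ_w² E[φ(yˡ⁻¹_α(x)) φ(yˡ⁻¹_{α'}(x'))]`. -/
def cnnCov (φ : ℝ → ℝ) (σb σw : ℝ) (k : ℕ) {n₀ M : ℕ} :
    ℕ → Sig n₀ M → Sig n₀ M → ZMod M → ZMod M → ℝ
  | 0, _, _, _, _ => 0
  | 1, x, x', α, α' => cnnCov₁ σb σw k x x' α α'
  | l + 2, x, x', α, α' =>
      filterAvg k (fun γ γ' =>
        σb ^ 2 + σw ^ 2 * gaussE φ (cnnCov φ σb σw k (l + 1) x x γ γ)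
          (cnnCov φ σb σw k (l + 1) x' x' γ' γ') (cnnCov φ σb σw k (l + 1) x x' γ γ')) α α'

/-- `q̂ˡ⁺¹_{α,α'}(x, x') = σ_b² + σ_w² E[φ(yˡ_α(x)) φ(yˡ_{α'}(x'))]`. -/
def cnnHat (φ : ℝ → ℝ) (σb σw : ℝ) (k : ℕ) {n₀ M : ℕ} (l : ℕ) (x x' : Sig n₀ M)
    (α α' : ZMod M) : ℝ :=
  σb ^ 2 + σw ^ 2 * gaussE φ (cnnCov φ σb σw k l x x α α) (cnnCov φ σb σw k l x' x' α' α')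
    (cnnCov φ σb σw k l x x' α α')

/-- `q̇ˡ⁺¹_{α,α'}(x, x') = σ_w² E[φ'(yˡ_α(x)) φ'(yˡ_{α'}(x'))]`. -/
def cnnDot (φ : ℝ → ℝ) (σb σw : ℝ) (k : ℕ) {n₀ M : ℕ} (l : ℕ) (x x' : Sig n₀ M)
    (α α' : ZMod M) : ℝ :=
  σw ^ 2 * gaussE (deriv φ) (cnnCov φ σb σw k l x x α α) (cnnCov φ σb σw k l x' x' α' α')
    (cnnCov φ σb σw k l x x' α α')

/-- The infinite-width neural tangent kernel `Kˡ_{α,α'}(x, x')`: `K¹ = q¹`, and for `l ≥ 2` the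
filter average of `q̇ˡ Kˡ⁻¹ + q̂ˡ` (and `0` for `l = 0`). -/
def cnnNTK (φ : ℝ → ℝ) (σb σw : ℝ) (k : ℕ) {n₀ M : ℕ} :
    ℕ → Sig n₀ M → Sig n₀ M → ZMod M → ZMod M → ℝ
  | 0, _, _, _, _ => 0
  | 1, x, x', α, α' => cnnCov₁ σb σw k x x' α α'
  | l + 2, x, x', α, α' =>
      filterAvg k (fun γ γ' =>
        cnnDot φ σb σw k (l + 1) x x' γ γ' * cnnNTK φ σb σw k (l + 1) x x' γ γ' +
          cnnHat φ σb σw k (l + 1) x x' γ γ') α α'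

/-- The average kernel `AK^L_{α,α'} = K^L_{α,α'} / L`. -/
def cnnANTK (φ : ℝ → ℝ) (σb σw : ℝ) (k : ℕ) {n₀ M : ℕ} (L : ℕ) (x x' : Sig n₀ M)
    (α α' : ZMod M) : ℝ :=
  cnnNTK φ σb σw k L x x' α α' / L

/-- First-layer correlation `c¹_{α,α'}(x, x')`. -/
def cnnCorr₁ (σb σw : ℝ) (k : ℕ) {n₀ M : ℕ} (x x' : Sig n₀ M) (α α' : ZMod M) : ℝ :=
  cnnCov₁ σb σw k x x' α α' / √(cnnCov₁ σb σw k x x α α * cnnCov₁ σb σw k x' x' α' α')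

/-- The data set `X` is such that `q¹_{α,α'}(x, x')` does not depend on `α, α'`, for all inputs
`x, x'` in `X`. -/
def CNNAssumption (σb σw : ℝ) (k : ℕ) {n₀ M : ℕ} (X : Set (Sig n₀ M)) : Prop :=
  ∀ x ∈ X, ∀ x' ∈ X, ∀ α α' γ γ' : ZMod M, cnnCov₁ σb σw k x x' α α' = cnnCov₁ σb σw k x x' γ γ'

/-- The pairs of inputs from `S` all of whose first-layer correlations are defined (all variances
are positive) and at most `1 - ε`. -/
def cnnB (σb σw : ℝ) (k : ℕ) {n₀ M : ℕ} (S : Set (Sig n₀ M)) (ε : ℝ) :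
    Set (Sig n₀ M × Sig n₀ M) :=
  {p | p.1 ∈ S ∧ p.2 ∈ S ∧ ∀ α α' : ZMod M,
    0 < cnnCov₁ σb σw k p.1 p.1 α α ∧ 0 < cnnCov₁ σb σw k p.2 p.2 α' α' ∧
      cnnCorr₁ σb σw k p.1 p.2 α α' ≤ 1 - ε}

/-! ### Limits and rates -/

open Classical in
/-- The factor `1 - (1 - λ) 1_{x ≠ x'}`. -/
def offDiag {V : Type*} (lam : ℝ) (x x' : V) : ℝ :=
  1 - (1 - lam) * (if x ≠ x' then 1 else 0)

/-- The limit kernel `(σ_w² ‖x‖ ‖x'‖ / d) (1 - (1 - λ) 1_{x ≠ x'})` of ReLU networks on inputs of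
dimension `d`. -/
def reluLimit {ι : Type*} [Fintype ι] (σw lam : ℝ) (x x' : EuclideanSpace ℝ ι) : ℝ :=
  σw ^ 2 * ‖x‖ * ‖x'‖ / Fintype.card ι * offDiag lam x x'

/-- The limit kernel `q (1 - (1 - λ) 1_{x ≠ x'})` of Tanh networks. -/
def tanhLimit {V : Type*} (q lam : ℝ) (x x' : V) : ℝ := q * offDiag lam x x'

/-- `sup_{s ∈ S} g_L(s) = O(m(L))` as `L → ∞`; the supremum being finite is part of the claim. -/
def SupBigO {V : Type*} (S : Set V) (g : ℕ → V → ℝ) (m : ℕ → ℝ) : Prop :=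
  ∃ B : ℝ, 0 < B ∧ ∀ᶠ L in atTop, BddAbove (g L '' S) ∧ sSup (g L '' S) ≤ B * m L

/-- `sup_{s ∈ S} g_L(s) = Θ(m(L))` as `L → ∞`; the supremum being finite is part of the claim. -/
def SupTheta {V : Type*} (S : Set V) (g : ℕ → V → ℝ) (m : ℕ → ℝ) : Prop :=
  ∃ A : ℝ, 0 < A ∧ ∃ B : ℝ, 0 < B ∧ ∀ᶠ L in atTop,
    BddAbove (g L '' S) ∧ A * m L ≤ sSup (g L '' S) ∧ sSup (g L '' S) ≤ B * m L

end NTKEOC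

end

open NTKEOC

namespace NTKEOC

/-! ### Scalar recursions -/

/-! The covariances and the kernel of a pair of inputs depend only on its two first-layer variances
and its first-layer covariance, through the scalar recursions `covSeq` and `ntkSeq`. Under
Assumption 1 every filter average is an average of equal numbers, so CNNs obey the same recursions
as FFNNs. What remains is the asymptotics of scalar sequences, uniform over bounded variances and
initial correlations at most `1 - ε`.

Off the diagonal, the correlation `c` tends to 1 only algebraically on the Edge of Chaos. Measure
its distance to 1 by a defect `x`, equal to `√((1 - c) / 2)` for ReLU and to `1 - c` for Tanh, so
that one layer acts as `x ↦ x - a x² + b x³ + O(x⁴)`. Then `1 / x` grows by `a + (a² - b) x +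
O(n⁻²)` at layer `n`, whence `x = 1 / (a n) - ((a² - b) / a³) log n / n² + O(n⁻²)`. The factor `q̇`
is `1 - D x + O(x²)`, and the linear recursion of the normalised kernel gives `n / (μ + 1) + C log n
+ O(1)`, where `μ = D / a` and `C` is a nonzero multiple of `a² - b` (`kernel_of_defect`). So `λ = 1
/ (μ + 1)`, and the rate is exactly `log L / L` because `a² ≠ b`.

For ReLU the arc-cosine formulas (`gaussE_relu`, `gaussE_deriv_relu`) give `a = 2 / (3π)`, `b = -a²
/ 2`, `D = 2 / π`, hence `λ = 1/4`. For Tanh, differentiating Gaussian expectations in the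
correlation (`hasDerivAt_corrMean`) gives a Taylor expansion at `c = 1` with `D = 2a`, hence `λ =
1/3`; here `a² < b` is the moment inequality `tanhMoment_inequality`. The variances of Tanh networks
are not constant, but they converge geometrically and only add errors `O(n⁻⁴)`.

On the diagonal, ReLU variances are constant and `q̇ = 1` at positive variance, so each layer adds
the same amount. For Tanh, `q̇ - 1` is so small that `K^L - L q` stays bounded; it also stays away
from 0 when the first variance is not `q`, because `q̇ q^{l-1} - q^l` keeps a sign determined by the
side of `q`. That sign comes from the strict monotonicity of the Gaussian Poincaré gap
(`poincareGap_strictMonoOn`). -/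

lemma log_le_two_sqrt {x : ℝ} (hx : 1 ≤ x) : 1 + Real.log x ≤ 2 * √x := by
  have h0 : 0 < x := by linarith
  have h1 : Real.log √x ≤ √x - 1 := Real.log_le_sub_one_of_pos (Real.sqrt_pos.2 h0)
  rw [Real.log_sqrt h0.le] at h1
  linarith

lemma sq_log_le {x : ℝ} (hx : 1 ≤ x) : Real.log x ^ 2 ≤ 4 * x := by
  have h0 : 0 ≤ Real.log x := Real.log_nonneg hx
  have h1 : Real.log x ≤ 2 * √x := by linarith [log_le_two_sqrt hx]
  calc Real.log x ^ 2 ≤ (2 * √x) ^ 2 := by gcongr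
    _ = 4 * x := by rw [mul_pow, Real.sq_sqrt (by linarith)]; ring

/-- The weight is `n^(-3/2)`. Since `log n ≤ 2 √n`, this one summable sequence absorbs errors of
order `1 / n²` and of order `log n / n²` alike. -/
lemma summable_sqrt_div_sq : Summable fun l : ℕ => √((l : ℝ) + 1) / ((l : ℝ) + 1) ^ 2 := by
  have h : Summable fun n : ℕ => 1 / (n : ℝ) ^ (3 / 2 : ℝ) :=
    Real.summable_one_div_nat_rpow.2 (by norm_num)
  have h2 := (summable_nat_add_iff 1).2 h
  refine h2.congr fun l => ?_
  have hl : (0 : ℝ) < (l : ℝ) + 1 := by positivity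
  push_cast
  rw [Real.sqrt_eq_rpow, div_eq_div_iff (by positivity) (by positivity), one_mul,
    ← Real.rpow_natCast, ← Real.rpow_add hl]
  norm_num

/-- The total mass of the summable weights `√n / n²`. -/
noncomputable def weightSum : ℝ := ∑' l : ℕ, √((l : ℝ) + 1) / ((l : ℝ) + 1) ^ 2

lemma weightSum_nonneg : 0 ≤ weightSum := tsum_nonneg fun _ => by positivity

lemma sum_weight_le (n : ℕ) :
    ∑ l ∈ Finset.range n, √((l : ℝ) + 1) / ((l : ℝ) + 1) ^ 2 ≤ weightSum :=
  summable_sqrt_div_sq.sum_le_tsum _ fun _ _ => by positivity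

lemma one_div_sq_le_weight (l : ℕ) :
    1 / ((l : ℝ) + 1) ^ 2 ≤ √((l : ℝ) + 1) / ((l : ℝ) + 1) ^ 2 := by
  have : 1 ≤ √((l : ℝ) + 1) := Real.one_le_sqrt.2 (by linarith [Nat.cast_nonneg (α := ℝ) l])
  gcongr

lemma sum_one_div_sq_le (n : ℕ) :
    ∑ l ∈ Finset.range n, 1 / ((l : ℝ) + 1) ^ 2 ≤ weightSum :=
  (Finset.sum_le_sum fun l _ => one_div_sq_le_weight l).trans (sum_weight_le n)

lemma sum_one_div_le (n : ℕ) :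
    ∑ l ∈ Finset.range n, 1 / ((l : ℝ) + 1) ≤ 1 + Real.log ((n : ℝ) + 1) := by
  have h := harmonic_le_one_add_log n
  have e : ((harmonic n : ℚ) : ℝ) = ∑ l ∈ Finset.range n, 1 / ((l : ℝ) + 1) := by
    simp [harmonic]
  rw [e] at h
  rcases Nat.eq_zero_or_pos n with rfl | hn
  · simp
  · have : Real.log n ≤ Real.log ((n : ℝ) + 1) :=
      Real.log_le_log (by exact_mod_cast hn) (by linarith)
    linarith

/-- Discrete Grönwall inequality: each factor is at most `exp (α l)`, and each source term `β l` is
amplified by at most the full exponential. -/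
lemma gronwall_seq {u α β : ℕ → ℝ} (hu : 0 ≤ u 0) (hα : ∀ l, 0 ≤ α l) (hβ : ∀ l, 0 ≤ β l)
    (h : ∀ l, u (l + 1) ≤ (1 + α l) * u l + β l) (l : ℕ) :
    u l ≤ Real.exp (∑ i ∈ Finset.range l, α i) * (u 0 + ∑ i ∈ Finset.range l, β i) := by
  induction l with
  | zero => simp
  | succ l ih =>
    have hA : 0 ≤ ∑ i ∈ Finset.range l, α i := Finset.sum_nonneg fun i _ => hα i
    have hB : 0 ≤ ∑ i ∈ Finset.range l, β i := Finset.sum_nonneg fun i _ => hβ i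
    rw [Finset.sum_range_succ, Finset.sum_range_succ, Real.exp_add]
    set A := ∑ i ∈ Finset.range l, α i
    set B := ∑ i ∈ Finset.range l, β i
    have e1 : 1 + α l ≤ Real.exp (α l) := by linarith [Real.add_one_le_exp (α l)]
    have e2 : 1 ≤ Real.exp A := Real.one_le_exp hA
    have e3 : 1 ≤ Real.exp (α l) := Real.one_le_exp (hα l)
    have e4 : 1 ≤ Real.exp A * Real.exp (α l) := by nlinarith
    calc u (l + 1) ≤ (1 + α l) * u l + β l := h l
      _ ≤ (1 + α l) * (Real.exp A * (u 0 + B)) + β l := by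
        have := hα l
        gcongr
      _ ≤ Real.exp (α l) * (Real.exp A * (u 0 + B)) + (Real.exp A * Real.exp (α l)) * β l := by
        have := hβ l
        gcongr
        nlinarith
      _ = _ := by ring

lemma abs_sub_zero_le_sum {e s : ℕ → ℝ} (h : ∀ l, |e (l + 1) - e l| ≤ s l) (l : ℕ) :
    |e l| ≤ |e 0| + ∑ i ∈ Finset.range l, s i := by
  induction l with
  | zero => simp
  | succ l ih =>
    rw [Finset.sum_range_succ]
    have := abs_add_le (e l) (e (l + 1) - e l)
    rw [add_sub_cancel] at this
    linarith [h l]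

/-- Inverting `x (1 - y) ≤ x'` is useless when `y` is close to 1 or larger. If `κ ≤ 1 - y`, then `1
/ (1 - y) ≤ 1 + y / κ`; otherwise the crude bound `κ x ≤ x'` suffices because `1 / κ ≤ 1 + y / κ`.
-/
lemma inv_le_of_mul_le {x x' κ y : ℝ} (hx : 0 < x) (hx' : 0 < x') (hκ : 0 < κ) (hy : 0 ≤ y)
    (h1 : κ * x ≤ x') (h2 : x * (1 - y) ≤ x') : 1 / x' ≤ (1 + y / κ) / x := by
  rw [div_le_div_iff₀ hx' hx, one_mul]
  have hk : 0 < 1 + y / κ := by positivity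
  by_cases hyk : κ ≤ 1 - y
  · have h3 : (1 + y / κ) * (x * (1 - y)) ≤ (1 + y / κ) * x' := by gcongr
    have h4 : (1 + y / κ) * (x * (1 - y)) = x + x * (y * ((1 - y) - κ) / κ) := by
      field_simp; ring
    have h5 : 0 ≤ x * (y * ((1 - y) - κ) / κ) :=
      mul_nonneg hx.le (div_nonneg (mul_nonneg hy (by linarith)) hκ.le)
    linarith
  · have h3 : (1 + y / κ) * (κ * x) ≤ (1 + y / κ) * x' := by gcongr
    have h4 : (1 + y / κ) * (κ * x) = x + x * (κ + y - 1) := by field_simp; ring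
    have h5 : 0 ≤ x * (κ + y - 1) := mul_nonneg hx.le (by linarith)
    linarith

/-- This is `(1 + z)(1 - z) ≤ 1`; when `1 + z` is negative the left side is negative and nothing is
needed. -/
lemma le_inv_of_le_mul {x x' z : ℝ} (hx : 0 < x) (hx' : 0 < x') (h : x' ≤ x * (1 - z)) :
    (1 + z) / x ≤ 1 / x' := by
  rw [div_le_div_iff₀ hx hx', one_mul]
  by_cases hz2 : 0 ≤ 1 + z
  · calc (1 + z) * x' ≤ (1 + z) * (x * (1 - z)) := by gcongr
      _ = x - z ^ 2 * x := by ring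
      _ ≤ x := by linarith [mul_nonneg (sq_nonneg z) hx.le]
  · push Not at hz2
    linarith [mul_nonpos_of_nonpos_of_nonneg hz2.le hx'.le]

/-- In terms of `w = 1 / x` the hypotheses read `w' ≤ (1 + D / n²) w + D`, so Grönwall gives at most
linear growth of `w`. The bound by `κ` keeps `x` from collapsing in the first layers, where the
second lower bound may be void. `W` is chosen before the sequence, which provides the uniformity
over pairs of inputs. -/
lemma decay_lower_bound {κ C ε : ℝ} (hκ : 0 < κ) (hC : 0 ≤ C) (hε : 0 < ε) :
    ∃ W > 0, ∀ x : ℕ → ℝ, ε ≤ x 0 → (∀ l, κ * x l ≤ x (l + 1)) →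
      (∀ l : ℕ, x l * (1 - C / ((l : ℝ) + 1) ^ 4 - C * x l) ≤ x (l + 1)) →
      ∀ l : ℕ, 0 < x l ∧ 1 ≤ W * ((l : ℝ) + 1) * x l := by
  set D := C / κ with hD
  have hD0 : 0 ≤ D := by positivity
  set W := Real.exp (D * weightSum) * (1 / ε + D) with hW
  have hW0 : 0 < W := by positivity
  refine ⟨W, hW0, fun x h0 h1 h2 => ?_⟩
  have hx : ∀ l, 0 < x l := by
    intro l
    induction l with
    | zero => linarith
    | succ l ih => exact lt_of_lt_of_le (by positivity) (h1 l)
  have hstep : ∀ l : ℕ, 1 / x (l + 1) ≤ (1 + D * (1 / ((l : ℝ) + 1) ^ 2)) * (1 / x l) + D := by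
    intro l
    have hxl := hx l
    have hn : (1 : ℝ) ≤ (l : ℝ) + 1 := by linarith [Nat.cast_nonneg (α := ℝ) l]
    have h3 := inv_le_of_mul_le (y := C / ((l : ℝ) + 1) ^ 4 + C * x l) hxl (hx (l + 1)) hκ
      (by positivity) (h1 l) (by linarith [h2 l])
    refine h3.trans ?_
    have h4 : C / ((l : ℝ) + 1) ^ 4 ≤ C / ((l : ℝ) + 1) ^ 2 := by gcongr; norm_num
    calc (1 + (C / ((l : ℝ) + 1) ^ 4 + C * x l) / κ) / x l
        ≤ (1 + (C / ((l : ℝ) + 1) ^ 2 + C * x l) / κ) / x l := by gcongr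
      _ = _ := by rw [hD]; field_simp; ring
  refine fun l => ⟨hx l, ?_⟩
  have h := gronwall_seq (u := fun l => 1 / x l) (α := fun l => D * (1 / ((l : ℝ) + 1) ^ 2))
    (β := fun _ => D) (by have := hx 0; positivity) (fun l => by positivity) (fun _ => hD0)
    hstep l
  have h6 : 1 / x l ≤ W * ((l : ℝ) + 1) := by
    refine h.trans ?_
    rw [← Finset.mul_sum, Finset.sum_const, Finset.card_range, nsmul_eq_mul, hW, mul_assoc]
    have h1 : 1 / x 0 ≤ 1 / ε := one_div_le_one_div_of_le hε h0
    have := sum_one_div_sq_le l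
    have h5 : 1 / x 0 + l * D ≤ (1 / ε + D) * ((l : ℝ) + 1) := by
      have : 0 ≤ 1 / ε * (l : ℝ) := by positivity
      nlinarith
    have := hx 0
    gcongr
  rwa [div_le_iff₀ (hx l)] at h6

/-- Two-sided bounds of order `1 / n` for slowly decaying recursions. -/
lemma decay_linear_bounds {κ C a ε M : ℝ} (hκ : 0 < κ) (hC : 0 ≤ C) (ha : 0 < a) (hε : 0 < ε)
    (hM : 0 < M) :
    ∃ c > 0, ∃ C' > 0, ∀ x : ℕ → ℝ, ε ≤ x 0 → (∀ l, x l ≤ M) → (∀ l, κ * x l ≤ x (l + 1)) →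
      (∀ l : ℕ, x l * (1 - C / ((l : ℝ) + 1) ^ 4 - C * x l) ≤ x (l + 1)) →
      (∀ l : ℕ, x (l + 1) ≤ x l - a * x l ^ 2 + C / ((l : ℝ) + 1) ^ 4) →
      ∀ l : ℕ, c / ((l : ℝ) + 1) ≤ x l ∧ x l ≤ C' / ((l : ℝ) + 1) := by
  obtain ⟨W, hW0, hW⟩ := decay_lower_bound hκ hC hε
  set S := C * W ^ 2 * weightSum with hS
  have hS0 : 0 ≤ S := by have := weightSum_nonneg; positivity
  set θ := min (1 / 2) (1 / (8 * M * (S + 1))) with hθ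
  have hθ0 : 0 < θ := by positivity
  set c' := min (θ * a) (1 / (8 * M)) with hc'
  have hc'0 : 0 < c' := by positivity
  refine ⟨1 / W, by positivity, 1 / c', by positivity, fun x h0 hxM h1 h2 h3 => ?_⟩
  have hx : ∀ l, 0 < x l := fun l => (hW x h0 h1 h2 l).1
  have hlow' : ∀ l : ℕ, 1 ≤ W * ((l : ℝ) + 1) * x l := fun l => (hW x h0 h1 h2 l).2
  intro l
  have hn : (0 : ℝ) < (l : ℝ) + 1 := by positivity
  refine ⟨?_, ?_⟩
  · rw [div_div, div_le_iff₀ (by positivity)]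
    linarith [hlow' l]
  have hup : ∀ l : ℕ, a * l - ∑ i ∈ Finset.range l, C * W ^ 2 * (1 / ((i : ℝ) + 1) ^ 2) ≤
      1 / x l := by
    intro l
    induction l with
    | zero => have := hx 0; simp; positivity
    | succ l ih =>
      rw [Finset.sum_range_succ]
      have hxl := hx l
      have h5 := hlow' l
      have h3' := h3 l
      push_cast
      generalize hm : (l : ℝ) + 1 = m at *
      have hm0 : 0 < m := by rw [← hm]; positivity
      -- The lower bound `1 ≤ W m x` makes the additive error relative: `m⁻⁴ ≤ W² x² m⁻²`. After
      -- division by `x²` only a summable `O(m⁻²)` remains in the increment of `1 / x`.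
      have h4 : C / m ^ 4 ≤ x l * (C * W ^ 2 * (1 / m ^ 2)) * x l := by
        have h6 : 1 ≤ (W * m * x l) ^ 2 := one_le_pow₀ h5
        have h7 : x l * (C * W ^ 2 * (1 / m ^ 2)) * x l = C / m ^ 4 * (W * m * x l) ^ 2 := by
          field_simp
        rw [h7]
        exact le_mul_of_one_le_right (by positivity) h6
      generalize C * W ^ 2 * (1 / m ^ 2) = t at *
      have h9 := le_inv_of_le_mul (z := a * x l - t * x l) hxl (hx (l + 1)) (by nlinarith)
      have h10 : (1 + (a * x l - t * x l)) / x l = 1 / x l + a - t := by field_simp; ring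
      rw [h10] at h9
      have hl : (l : ℝ) = m - 1 := by linarith
      rw [hl] at ih
      linarith
  have hsum : ∑ i ∈ Finset.range l, C * W ^ 2 * (1 / ((i : ℝ) + 1) ^ 2) ≤ S := by
    rw [← Finset.mul_sum, hS]
    have := sum_one_div_sq_le l
    gcongr
  have h6 : a * l - S ≤ 1 / x l := by linarith [hup l]
  have h7 : 1 / M ≤ 1 / x l := one_div_le_one_div_of_le (hx l) (hxM l)
  have h8 : c' * ((l : ℝ) + 1) ≤ 1 / x l := by
    have t1 : θ ≤ 1 / 2 := min_le_left _ _
    have t2 : θ * S ≤ 1 / (8 * M) := by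
      calc θ * S ≤ 1 / (8 * M * (S + 1)) * (S + 1) := by
            gcongr
            · exact min_le_right _ _
            · linarith
        _ = 1 / (8 * M) := by field_simp
    have t3 : c' ≤ θ * a := min_le_left _ _
    have t4 : c' ≤ 1 / (8 * M) := min_le_right _ _
    have t5 : 1 / x l = θ * (1 / x l) + (1 - θ) * (1 / x l) := by ring
    have t6 : θ * (a * l - S) ≤ θ * (1 / x l) := by gcongr
    have t7 : (1 - θ) * (1 / M) ≤ (1 - θ) * (1 / x l) := by
      apply mul_le_mul_of_nonneg_left h7; linarith
    have t8 : 1 / 2 * (1 / M) ≤ (1 - θ) * (1 / M) := by gcongr; linarith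
    have t9 : 1 / 2 * (1 / M) = 4 * (1 / (8 * M)) := by field_simp; norm_num
    have t10 : c' * l ≤ θ * a * l := by gcongr
    have t11 : 0 < 1 / (8 * M) := by positivity
    nlinarith
  rw [le_div_iff₀ hn, le_div_iff₀ hc'0]
  rw [le_div_iff₀ (hx l)] at h8
  linarith

/-- Rates `x ≍ 1 / n` and the third-order expansion of a step give the increments of `1 / x`. -/
lemma inv_increment {a b C c c₂ : ℝ} (hC : 0 ≤ C) (hc : 0 < c) (hc₂ : 0 < c₂) :
    ∃ K ≥ 0, ∀ x : ℕ → ℝ,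
      (∀ l : ℕ, c / ((l : ℝ) + 1) ≤ x l ∧ x l ≤ c₂ / ((l : ℝ) + 1)) →
      (∀ l : ℕ, |x (l + 1) - (x l - a * x l ^ 2 + b * x l ^ 3)| ≤
        C * (x l ^ 4 + 1 / ((l : ℝ) + 1) ^ 4)) →
      ∀ l : ℕ, |1 / x (l + 1) - 1 / x l - a - (a ^ 2 - b) * x l| ≤ K / ((l : ℝ) + 1) ^ 2 := by
  set h := a ^ 2 - b with hh
  set N := |a * h - a * b| * c₂ ^ 4 + |b * h| * c₂ ^ 5 +
    C * (c₂ ^ 4 + 1) * (1 + |a| * c₂ + |h| * c₂ ^ 2) with hN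
  have hN0 : 0 ≤ N := by positivity
  refine ⟨2 * N / c ^ 2, by positivity, fun x hx hstep l => ?_⟩
  have h1 := hx l
  have h2 := (hx (l + 1)).1
  have h3 := hstep l
  push_cast at h2
  have hm1 : (1 : ℝ) ≤ (l : ℝ) + 1 := by linarith [Nat.cast_nonneg (α := ℝ) l]
  generalize (l : ℝ) + 1 = m at *
  generalize x (l + 1) = y at *
  generalize x l = z at *
  have hm : 0 < m := by linarith
  have hz : 0 < z := lt_of_lt_of_le (by positivity) h1.1
  have h2' : c / (2 * m) ≤ y := by
    refine le_trans ?_ h2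
    gcongr
    linarith
  have hy : 0 < y := lt_of_lt_of_le (by positivity) h2'
  have hzc : z ≤ c₂ := h1.2.trans (div_le_self hc₂.le hm1)
  set r := y - (z - a * z ^ 2 + b * z ^ 3) with hr
  -- With `h = a² - b`, the factor `1 + a z + h z²` inverts `1 - a z + b z²` up to order three. The
  -- numerator therefore has order four, against a denominator of order two.
  have e1 : 1 / y - 1 / z - a - h * z =
      ((a * h - a * b) * z ^ 4 - b * h * z ^ 5 - r * (1 + a * z + h * z ^ 2)) / (z * y) := by
    rw [eq_div_iff (by positivity)]
    have : (1 / y - 1 / z - a - h * z) * (z * y) = z - y * (1 + a * z + h * z ^ 2) := by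
      field_simp; ring
    rw [this, hr, hh]; ring
  have hz4 : z ^ 4 ≤ c₂ ^ 4 / m ^ 4 := by
    rw [← div_pow]; gcongr; exact h1.2
  have hz5 : z ^ 5 ≤ c₂ ^ 5 / m ^ 4 := by
    calc z ^ 5 = z ^ 4 * z := by ring
      _ ≤ c₂ ^ 4 / m ^ 4 * c₂ := by gcongr
      _ = c₂ ^ 5 / m ^ 4 := by ring
  have hrb : |r| ≤ C * (c₂ ^ 4 + 1) / m ^ 4 := by
    calc |r| ≤ C * (z ^ 4 + 1 / m ^ 4) := h3
      _ ≤ C * (c₂ ^ 4 / m ^ 4 + 1 / m ^ 4) := by gcongr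
      _ = _ := by ring
  have hfac : |1 + a * z + h * z ^ 2| ≤ 1 + |a| * c₂ + |h| * c₂ ^ 2 := by
    calc |1 + a * z + h * z ^ 2| ≤ |1 + a * z| + |h * z ^ 2| := abs_add_le _ _
      _ ≤ |1| + |a * z| + |h * z ^ 2| := by gcongr; exact abs_add_le _ _
      _ = 1 + |a| * z + |h| * z ^ 2 := by
        rw [abs_one, abs_mul, abs_mul, abs_of_pos hz, abs_of_pos (pow_pos hz 2)]
      _ ≤ _ := by gcongr
  have hnum : |(a * h - a * b) * z ^ 4 - b * h * z ^ 5 - r * (1 + a * z + h * z ^ 2)| ≤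
      N / m ^ 4 := by
    calc _ ≤ |(a * h - a * b) * z ^ 4 - b * h * z ^ 5| + |r * (1 + a * z + h * z ^ 2)| :=
          abs_sub _ _
      _ ≤ |(a * h - a * b) * z ^ 4| + |b * h * z ^ 5| + |r * (1 + a * z + h * z ^ 2)| := by
          gcongr; exact abs_sub _ _
      _ = |a * h - a * b| * z ^ 4 + |b * h| * z ^ 5 + |r| * |1 + a * z + h * z ^ 2| := by
          rw [abs_mul, abs_mul (b * h), abs_mul r, abs_of_pos (pow_pos hz 4),
            abs_of_pos (pow_pos hz 5)]
      _ ≤ |a * h - a * b| * (c₂ ^ 4 / m ^ 4) + |b * h| * (c₂ ^ 5 / m ^ 4) +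
          C * (c₂ ^ 4 + 1) / m ^ 4 * (1 + |a| * c₂ + |h| * c₂ ^ 2) := by gcongr
      _ = N / m ^ 4 := by rw [hN]; ring
  have hden : c ^ 2 / (2 * m ^ 2) ≤ z * y := by
    calc c ^ 2 / (2 * m ^ 2) = c / m * (c / (2 * m)) := by field_simp
      _ ≤ z * y := by gcongr; exact h1.1
  rw [e1, abs_div, abs_of_pos (mul_pos hz hy)]
  calc _ ≤ N / m ^ 4 / (c ^ 2 / (2 * m ^ 2)) := by gcongr
    _ = 2 * N / c ^ 2 / m ^ 2 := by field_simp

lemma log_succ_sub_log_le {m : ℝ} (hm : 0 < m) :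
    0 ≤ Real.log (m + 1) - Real.log m ∧ Real.log (m + 1) - Real.log m ≤ 1 / m ∧
      1 / m - 1 / m ^ 2 ≤ Real.log (m + 1) - Real.log m := by
  have e : Real.log (m + 1) - Real.log m = Real.log (1 + 1 / m) := by
    rw [← Real.log_div (by positivity) hm.ne']; congr 1; field_simp
  have h1 : Real.log (1 + 1 / m) ≤ 1 / m := by
    linarith [Real.log_le_sub_one_of_pos (x := 1 + 1 / m) (by positivity)]
  have h2 : 1 - (1 + 1 / m)⁻¹ ≤ Real.log (1 + 1 / m) := Real.one_sub_inv_le_log_of_pos (by positivity)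
  have h3 : 1 - (1 + 1 / m)⁻¹ = 1 / (m + 1) := by field_simp; ring
  have h4 : 0 < 1 / (m + 1) := by positivity
  have h5 : 1 / m - 1 / m ^ 2 ≤ 1 / (m + 1) := by
    have : 1 / (m + 1) - (1 / m - 1 / m ^ 2) = 1 / (m ^ 2 * (m + 1)) := by field_simp; ring
    have : 0 < 1 / (m ^ 2 * (m + 1)) := by positivity
    linarith
  rw [e]
  exact ⟨by linarith, h1, by linarith⟩

/-- Logarithmic asymptotics of `w' = w + a + h / w + O(1 / n²)`. -/
lemma growth_asymptotics {a h c K W : ℝ} (ha : 0 < a) (hc : 0 < c) (hK : 0 ≤ K) :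
    ∃ K' ≥ 0, ∀ w : ℕ → ℝ, |w 0| ≤ W → (∀ l : ℕ, c * ((l : ℝ) + 1) ≤ w l) →
      (∀ l : ℕ, |w (l + 1) - w l - a - h * (1 / w l)| ≤ K / ((l : ℝ) + 1) ^ 2) →
      ∀ l : ℕ, |w l - a * ((l : ℝ) + 1) - h / a * Real.log ((l : ℝ) + 1)| ≤ K' := by
  have hW := weightSum_nonneg
  set A := |W| + a + K * weightSum + |h| / c with hA
  have hA0 : 0 ≤ A := by positivity
  set B := |h| * (2 * A / (c * a)) + |h| / a + K with hB
  have hB0 : 0 ≤ B := by positivity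
  refine ⟨|W| + a + B * weightSum, by positivity, fun w h0 hlow hstep => ?_⟩
  have hw0 : |w 0| ≤ |W| := h0.trans (le_abs_self _)
  have hwpos : ∀ l, 0 < w l := fun l => lt_of_lt_of_le (by positivity) (hlow l)
  have hinv : ∀ l : ℕ, |h * (1 / w l)| ≤ |h| / c * (1 / ((l : ℝ) + 1)) := by
    intro l
    rw [abs_mul, abs_of_pos (one_div_pos.2 (hwpos l))]
    calc |h| * (1 / w l) ≤ |h| * (1 / (c * ((l : ℝ) + 1))) := by
          have := hlow l
          gcongr
      _ = _ := by field_simp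
  -- Bootstrap: the crude bound `h / w = O(1 / n)` already gives `w = a n + O(1 + log n)`.
  -- Reinserting this, `1 / w - 1 / (a n)` is `O(√n / n²)`, which is summable, so the second pass
  -- leaves a bounded error.
  have first : ∀ l : ℕ, |w l - a * ((l : ℝ) + 1)| ≤ A * (1 + Real.log ((l : ℝ) + 1)) := by
    intro l
    have := abs_sub_zero_le_sum (e := fun l : ℕ => w l - a * ((l : ℝ) + 1))
      (s := fun l => K * (1 / ((l : ℝ) + 1) ^ 2) + |h| / c * (1 / ((l : ℝ) + 1))) (fun l => by
        push_cast
        have e : w (l + 1) - a * ((l : ℝ) + 1 + 1) - (w l - a * ((l : ℝ) + 1)) =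
          (w (l + 1) - w l - a - h * (1 / w l)) + h * (1 / w l) := by ring
        rw [e]
        refine (abs_add_le _ _).trans ?_
        exact add_le_add ((hstep l).trans_eq (by ring)) (hinv l)) l
    rw [Finset.sum_add_distrib, ← Finset.mul_sum, ← Finset.mul_sum] at this
    have s1 := sum_one_div_sq_le l
    have s2 := sum_one_div_le l
    have h1 : |w 0 - a * (((0 : ℕ) : ℝ) + 1)| ≤ |W| + a := by
      refine (abs_sub _ _).trans ?_
      rw [Nat.cast_zero, zero_add, mul_one, abs_of_pos ha]; gcongr
    have h2 : K * ∑ i ∈ Finset.range l, 1 / ((i : ℝ) + 1) ^ 2 ≤ K * weightSum := by gcongr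
    have h3 : |h| / c * ∑ i ∈ Finset.range l, 1 / ((i : ℝ) + 1) ≤
      |h| / c * (1 + Real.log ((l : ℝ) + 1)) := by gcongr
    have h4 : 0 ≤ Real.log ((l : ℝ) + 1) :=
      Real.log_nonneg (by linarith [Nat.cast_nonneg (α := ℝ) l])
    have h5 : 0 ≤ (|W| + a + K * weightSum) * Real.log ((l : ℝ) + 1) := by positivity
    calc _ ≤ _ := this
      _ ≤ |W| + a + (K * weightSum + |h| / c * (1 + Real.log ((l : ℝ) + 1))) := by gcongr
      _ ≤ _ := by rw [hA]; linarith
  intro l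
  have := abs_sub_zero_le_sum
    (e := fun l : ℕ => w l - a * ((l : ℝ) + 1) - h / a * Real.log ((l : ℝ) + 1))
    (s := fun l => B * (√((l : ℝ) + 1) / ((l : ℝ) + 1) ^ 2)) (fun l => by
      push_cast
      have hm1 : (1 : ℝ) ≤ (l : ℝ) + 1 := by linarith [Nat.cast_nonneg (α := ℝ) l]
      have f1 := first l
      have f2 := hstep l
      have f3 := hlow l
      have f4 := hwpos l
      have f5 := one_div_sq_le_weight l
      generalize (l : ℝ) + 1 = m at *
      generalize w (l + 1) = y at *
      generalize w l = z at *
      have hm : 0 < m := by linarith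
      obtain ⟨g0, g1, g2⟩ := log_succ_sub_log_le hm
      have e : y - a * (m + 1) - h / a * Real.log (m + 1) - (z - a * m - h / a * Real.log m) =
          (y - z - a - h * (1 / z)) + h * (1 / z - 1 / (a * m)) +
            h / a * (1 / m - (Real.log (m + 1) - Real.log m)) := by
        field_simp; ring
      rw [e]
      have b1 : |h * (1 / z - 1 / (a * m))| ≤ |h| * (2 * A / (c * a)) * (√m / m ^ 2) := by
        have e2 : 1 / z - 1 / (a * m) = - (z - a * m) / (z * (a * m)) := by field_simp; ring
        rw [e2, abs_mul, abs_div, abs_neg, abs_of_pos (by positivity : 0 < z * (a * m)), mul_assoc]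
        gcongr
        calc |z - a * m| / (z * (a * m)) ≤ A * (2 * √m) / (c * m * (a * m)) := by
              gcongr
              exact f1.trans (by gcongr; exact log_le_two_sqrt hm1)
          _ = _ := by field_simp
      have b2 : |h / a * (1 / m - (Real.log (m + 1) - Real.log m))| ≤
          |h| / a * (√m / m ^ 2) := by
        rw [abs_mul, abs_div, abs_of_pos ha]
        gcongr
        rw [abs_of_nonneg (by linarith)]
        linarith
      have b3 : K / m ^ 2 ≤ K * (√m / m ^ 2) := by
        rw [← mul_one_div]; gcongr
      calc _ ≤ |y - z - a - h * (1 / z)| + |h * (1 / z - 1 / (a * m))| +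
            |h / a * (1 / m - (Real.log (m + 1) - Real.log m))| := abs_add_three _ _ _
        _ ≤ K * (√m / m ^ 2) + |h| * (2 * A / (c * a)) * (√m / m ^ 2) +
            |h| / a * (√m / m ^ 2) := by
            gcongr; exact f2.trans b3
        _ = _ := by rw [hB]; ring) l
  rw [← Finset.mul_sum] at this
  refine this.trans ?_
  have s1 := sum_weight_le l
  have h1 : |w 0 - a * (((0 : ℕ) : ℝ) + 1) - h / a * Real.log (((0 : ℕ) : ℝ) + 1)| ≤ |W| + a := by
    rw [Nat.cast_zero, zero_add, Real.log_one, mul_zero, sub_zero]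
    refine (abs_sub _ _).trans ?_
    rw [mul_one, abs_of_pos ha]; gcongr
  gcongr

/-- Multiplying `w` by the conjugate `a m - g log m` leaves `a² m²` up to `g² log² m` and a term
`O(m)`; as `log² m ≤ 4 m`, the relative error is `O(1 / m)`. -/
lemma inv_asymptotics {a g c K : ℝ} (ha : 0 < a) (hc : 0 < c) (hK : 0 ≤ K) :
    ∃ K' ≥ 0, ∀ m w : ℝ, 1 ≤ m → c * m ≤ w → |w - a * m - g * Real.log m| ≤ K →
      |1 / w - (1 / (a * m) - g / a ^ 2 * (Real.log m / m ^ 2))| ≤ K' / m ^ 2 := by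
  refine ⟨(4 * g ^ 2 + K * (a + |g|)) / (c * a ^ 2), by positivity, fun m w hm1 hw h => ?_⟩
  have hm : 0 < m := by linarith
  have hw0 : 0 < w := lt_of_lt_of_le (by positivity) hw
  set e := w - a * m - g * Real.log m with he
  have hl0 : 0 ≤ Real.log m := Real.log_nonneg hm1
  have hl1 : Real.log m ≤ m := (Real.log_le_sub_one_of_pos hm).trans (by linarith)
  have hl2 := sq_log_le hm1
  have e1 : 1 / w - (1 / (a * m) - g / a ^ 2 * (Real.log m / m ^ 2)) =
      (g ^ 2 * Real.log m ^ 2 - e * (a * m - g * Real.log m)) / (w * (a ^ 2 * m ^ 2)) := by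
    rw [eq_div_iff (by positivity)]
    have : (1 / w - (1 / (a * m) - g / a ^ 2 * (Real.log m / m ^ 2))) * (w * (a ^ 2 * m ^ 2)) =
      a ^ 2 * m ^ 2 - w * (a * m - g * Real.log m) := by field_simp
    rw [this, he]; ring
  rw [e1, abs_div, abs_of_pos (by positivity : 0 < w * (a ^ 2 * m ^ 2))]
  have hnum : |g ^ 2 * Real.log m ^ 2 - e * (a * m - g * Real.log m)| ≤
      (4 * g ^ 2 + K * (a + |g|)) * m := by
    calc _ ≤ |g ^ 2 * Real.log m ^ 2| + |e * (a * m - g * Real.log m)| := abs_sub _ _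
      _ ≤ g ^ 2 * (4 * m) + K * (a * m + |g| * m) := by
        rw [abs_of_nonneg (by positivity), abs_mul e]
        gcongr
        refine (abs_sub _ _).trans ?_
        rw [abs_mul g, abs_of_nonneg hl0, abs_of_pos (by positivity : 0 < a * m)]
        gcongr
      _ = _ := by ring
  calc _ ≤ (4 * g ^ 2 + K * (a + |g|)) * m / (c * m * (a ^ 2 * m ^ 2)) := by gcongr
    _ = _ := by field_simp

/-- A linear recursion `k' = χ k + r` with `χ = 1 - μ / n + ν log n / n² + O(1 / n²)` and
`r = 1 + O(1 / n)` grows like `n / (μ + 1)`, with a logarithmic correction. -/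
lemma kernel_asymptotics {μ ν C K₀ : ℝ} (hμ : 1 ≤ μ) (hC : 0 ≤ C) :
    ∃ K ≥ 0, ∀ χ r k : ℕ → ℝ, |k 0| ≤ K₀ → (∀ l, k (l + 1) = χ l * k l + r l) →
      (∀ l : ℕ, |χ l - (1 - μ / ((l : ℝ) + 1) +
        ν * (Real.log ((l : ℝ) + 1) / ((l : ℝ) + 1) ^ 2))| ≤ C / ((l : ℝ) + 1) ^ 2) →
      (∀ l : ℕ, |r l - 1| ≤ C / ((l : ℝ) + 1)) →
      ∀ l : ℕ, |k l - ((l : ℝ) + 1) / (μ + 1) -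
        ν / (μ * (μ + 1)) * Real.log ((l : ℝ) + 1)| ≤ K := by
  have hμ0 : 0 < μ := by linarith
  -- The value that cancels the `log m / m` terms: `-μ κ` from the contraction against `ν / (μ + 1)`
  -- from the correction of `χ` acting on `m / (μ + 1)`.
  set κ := ν / (μ * (μ + 1)) with hκ
  set E := 4 * |ν * κ| + C * (1 + |κ|) + C + |κ| with hE
  have hE0 : 0 ≤ E := by positivity
  set S := 2 * μ ^ 2 + 2 * |ν| + C with hS
  have hS0 : 0 ≤ S := by positivity
  have hW := weightSum_nonneg
  refine ⟨Real.exp (S * weightSum) * (|K₀| + 1 + E), by positivity,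
    fun χ r k hk0 hk hχ hr l => ?_⟩
  set e : ℕ → ℝ := fun l => k l - ((l : ℝ) + 1) / (μ + 1) - κ * Real.log ((l : ℝ) + 1) with he
  have hstep : ∀ l : ℕ, |e (l + 1)| ≤ |χ l| * |e l| + E / ((l : ℝ) + 1) := by
    intro l
    have hm1 : (1 : ℝ) ≤ (l : ℝ) + 1 := by linarith [Nat.cast_nonneg (α := ℝ) l]
    have h1 := hχ l
    have h2 := hr l
    have h3 : e (l + 1) = χ l * k l + r l - ((l : ℝ) + 1 + 1) / (μ + 1) -
      κ * Real.log ((l : ℝ) + 1 + 1) := by simp only [he]; push_cast; rw [hk]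
    have h4 : k l = e l + ((l : ℝ) + 1) / (μ + 1) + κ * Real.log ((l : ℝ) + 1) := by
      simp only [he]; ring
    rw [h3, h4]
    generalize (l : ℝ) + 1 = m at *
    generalize e l = z at *
    generalize χ l = X at *
    generalize r l = R at *
    have hm : 0 < m := by linarith
    obtain ⟨g0, g1, g2⟩ := log_succ_sub_log_le hm
    set d := Real.log (m + 1) - Real.log m with hd
    have hl0 : 0 ≤ Real.log m := Real.log_nonneg hm1
    have hl1 : Real.log m ≤ m := (Real.log_le_sub_one_of_pos hm).trans (by linarith)
    have hl2 := sq_log_le hm1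
    set ξ := X - (1 - μ / m + ν * (Real.log m / m ^ 2)) with hξ
    have hdec : X * (z + m / (μ + 1) + κ * Real.log m) + R - (m + 1) / (μ + 1) -
        κ * Real.log (m + 1) = X * z + (ν * κ * (Real.log m ^ 2 / m ^ 2) +
          ξ * (m / (μ + 1) + κ * Real.log m) + (R - 1) - κ * d) := by
      have hX : X = ξ + (1 - μ / m + ν * (Real.log m / m ^ 2)) := by rw [hξ]; ring
      have hl : Real.log (m + 1) = d + Real.log m := by rw [hd]; ring
      rw [hl, hκ]
      have : ν * (Real.log m / m ^ 2) * (m / (μ + 1)) =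
        ν / (μ * (μ + 1)) * μ * Real.log m / m := by field_simp
      have h6 : m / (μ + 1) - μ / m * (m / (μ + 1)) + 1 - (m + 1) / (μ + 1) = 0 := by
        field_simp; ring
      have h7 : X * (m / (μ + 1) + ν / (μ * (μ + 1)) * Real.log m) =
        (ξ + (1 - μ / m + ν * (Real.log m / m ^ 2))) *
          (m / (μ + 1) + ν / (μ * (μ + 1)) * Real.log m) := by rw [← hX]
      linear_combination h7 + this + h6
    rw [hdec]
    refine (abs_add_le _ _).trans ?_
    rw [abs_mul X]
    gcongr
    have b1 : |ν * κ * (Real.log m ^ 2 / m ^ 2)| ≤ 4 * |ν * κ| / m := by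
      rw [abs_mul, abs_of_nonneg (by positivity : 0 ≤ Real.log m ^ 2 / m ^ 2)]
      calc |ν * κ| * (Real.log m ^ 2 / m ^ 2) ≤ |ν * κ| * (4 * m / m ^ 2) := by gcongr
        _ = _ := by field_simp
    have b2 : |ξ * (m / (μ + 1) + κ * Real.log m)| ≤ C * (1 + |κ|) / m := by
      rw [abs_mul]
      have : |m / (μ + 1) + κ * Real.log m| ≤ m + |κ| * m := by
        refine (abs_add_le _ _).trans ?_
        rw [abs_mul, abs_of_nonneg hl0, abs_of_nonneg (by positivity : 0 ≤ m / (μ + 1))]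
        gcongr
        exact div_le_self hm.le (by linarith)
      calc |ξ| * |m / (μ + 1) + κ * Real.log m| ≤ C / m ^ 2 * (m + |κ| * m) := by gcongr
        _ = _ := by field_simp
    have b3 : |κ * d| ≤ |κ| / m := by
      rw [abs_mul, abs_of_nonneg g0, ← mul_one_div]; gcongr
    calc _ ≤ |ν * κ * (Real.log m ^ 2 / m ^ 2) + ξ * (m / (μ + 1) + κ * Real.log m) + (R - 1)|
            + |κ * d| := abs_sub _ _
      _ ≤ |ν * κ * (Real.log m ^ 2 / m ^ 2)| + |ξ * (m / (μ + 1) + κ * Real.log m)| + |R - 1|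
            + |κ * d| := by gcongr; exact abs_add_three _ _ _
      _ ≤ 4 * |ν * κ| / m + C * (1 + |κ|) / m + C / m + |κ| / m := by gcongr
      _ = E / m := by rw [hE]; ring
  have hχb : ∀ l : ℕ, |χ l| ≤ 1 - 1 / ((l : ℝ) + 1) +
      S * (√((l : ℝ) + 1) / ((l : ℝ) + 1) ^ 2) := by
    intro l
    have hm1 : (1 : ℝ) ≤ (l : ℝ) + 1 := by linarith [Nat.cast_nonneg (α := ℝ) l]
    have h1 := hχ l
    have f5 := one_div_sq_le_weight l
    generalize (l : ℝ) + 1 = m at *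
    generalize χ l = X at *
    have hm : 0 < m := by linarith
    have hl0 : 0 ≤ Real.log m := Real.log_nonneg hm1
    have hl1 : Real.log m ≤ 2 * √m := by linarith [log_le_two_sqrt hm1]
    -- In the first layers `1 - μ / m` may be negative; the summable quadratic term covers them.
    -- Elsewhere `μ ≥ 1` gives a contraction by at least `1 - 1 / m`.
    have b1 : |1 - μ / m| ≤ 1 - 1 / m + 2 * μ ^ 2 * (1 / m ^ 2) := by
      have e0 : 2 * μ ^ 2 * (1 / m ^ 2) = 2 * (μ / m) ^ 2 := by field_simp
      have e1 : 1 / m ≤ μ / m := by gcongr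
      have e2 : 0 < μ / m := by positivity
      rw [e0]
      rcases le_or_gt (μ / m) 1 with h | h
      · rw [abs_of_nonneg (by linarith)]; nlinarith
      · rw [abs_of_neg (by linarith)]; nlinarith
    have b2 : |ν * (Real.log m / m ^ 2)| ≤ 2 * |ν| * (√m / m ^ 2) := by
      rw [abs_mul, abs_of_nonneg (by positivity : 0 ≤ Real.log m / m ^ 2)]
      calc |ν| * (Real.log m / m ^ 2) ≤ |ν| * (2 * √m / m ^ 2) := by gcongr
        _ = _ := by ring
    have e : X = (X - (1 - μ / m + ν * (Real.log m / m ^ 2))) + (1 - μ / m) +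
      ν * (Real.log m / m ^ 2) := by ring
    calc |X| ≤ |X - (1 - μ / m + ν * (Real.log m / m ^ 2))| + |1 - μ / m| +
          |ν * (Real.log m / m ^ 2)| := by
          conv_lhs => rw [e]
          exact abs_add_three _ _ _
      _ ≤ C * (1 / m ^ 2) + (1 - 1 / m + 2 * μ ^ 2 * (1 / m ^ 2)) + 2 * |ν| * (√m / m ^ 2) := by
          rw [mul_one_div]; gcongr
      _ ≤ C * (√m / m ^ 2) + (1 - 1 / m + 2 * μ ^ 2 * (√m / m ^ 2)) + 2 * |ν| * (√m / m ^ 2) := by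
          gcongr
      _ = _ := by rw [hS]; ring
  -- The forcing `E / m` is not summable, but the contraction compensates it: `(1 - 1 / m) v + (1 /
  -- m) E ≤ v` as soon as `E ≤ v`. Hence Grönwall is applied to `max |e| E`, where only the summable
  -- part of `|χ|` remains.
  have hmax := gronwall_seq (u := fun l => max |e l| E)
    (α := fun l => S * (√((l : ℝ) + 1) / ((l : ℝ) + 1) ^ 2)) (β := fun _ => 0)
    (le_max_of_le_right hE0) (fun l => by positivity) (fun _ => le_rfl) (fun l => by
      have h1 := hstep l
      have h2 := hχb l
      have hm1 : (1 : ℝ) ≤ (l : ℝ) + 1 := by linarith [Nat.cast_nonneg (α := ℝ) l]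
      have hs : 0 ≤ S * (√((l : ℝ) + 1) / ((l : ℝ) + 1) ^ 2) := by positivity
      have h3 : |e l| ≤ max |e l| E := le_max_left _ _
      have h4 : E ≤ max |e l| E := le_max_right _ _
      have h5 := abs_nonneg (e l)
      simp only [add_zero]
      generalize (l : ℝ) + 1 = m at *
      generalize S * (√m / m ^ 2) = s at *
      generalize max |e l| E = v at *
      generalize |e l| = z at *
      have hm : 0 < m := by linarith
      have hv : 0 ≤ v := h5.trans h3
      have h8 : 1 / m ≤ 1 := by rw [div_le_one hm]; exact hm1
      apply max_le
      · calc _ ≤ |χ l| * z + E / m := h1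
          _ ≤ (1 - 1 / m + s) * z + E / m := by gcongr
          _ = (1 - 1 / m) * z + s * z + 1 / m * E := by ring
          _ ≤ (1 - 1 / m) * v + s * v + 1 / m * v := by
            have : 0 ≤ 1 - 1 / m := by linarith
            gcongr
          _ = (1 + s) * v := by ring
      · nlinarith) l
  have h1 : |e l| ≤ max |e l| E := le_max_left _ _
  refine h1.trans (hmax.trans ?_)
  rw [← Finset.mul_sum]
  have s1 := sum_weight_le l
  have h0 : max |e 0| E ≤ |K₀| + 1 + E := by
    have : |e 0| ≤ |K₀| + 1 := by
      simp only [he, Nat.cast_zero, zero_add, Real.log_one, mul_zero, sub_zero]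
      refine (abs_sub _ _).trans ?_
      have h9 : 1 / (μ + 1) ≤ 1 := by rw [div_le_one (by linarith)]; linarith
      rw [abs_of_pos (by positivity : 0 < 1 / (μ + 1))]
      have := hk0.trans (le_abs_self K₀)
      linarith
    apply max_le
    · linarith
    · have := abs_nonneg K₀; linarith
  simp only [Finset.sum_const_zero, add_zero]
  gcongr

/-- The kernel of a network whose correlation defect `x` satisfies
`x' = x - a x² + b x³ + O(x⁴)`, up to summable perturbations, and whose derivative factor is
`1 - D x + O(x²)`. -/
theorem kernel_of_defect {κ C a a' b D ε M K₀ : ℝ} (hκ : 0 < κ) (hC : 0 ≤ C) (ha : 0 < a)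
    (ha' : 0 < a') (hε : 0 < ε) (hM : 0 < M) (hD : a ≤ D) :
    ∃ K ≥ 0, ∀ x χ r k : ℕ → ℝ, ε ≤ x 0 → (∀ l, x l ≤ M) → (∀ l, κ * x l ≤ x (l + 1)) →
      (∀ l : ℕ, x l * (1 - C / ((l : ℝ) + 1) ^ 4 - C * x l) ≤ x (l + 1)) →
      (∀ l : ℕ, x (l + 1) ≤ x l - a' * x l ^ 2 + C / ((l : ℝ) + 1) ^ 4) →
      (∀ l : ℕ, |x (l + 1) - (x l - a * x l ^ 2 + b * x l ^ 3)| ≤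
        C * (x l ^ 4 + 1 / ((l : ℝ) + 1) ^ 4)) →
      |k 0| ≤ K₀ → (∀ l, k (l + 1) = χ l * k l + r l) →
      (∀ l : ℕ, |χ l - (1 - D * x l)| ≤ C * (x l ^ 2 + 1 / ((l : ℝ) + 1) ^ 4)) →
      (∀ l : ℕ, |r l - 1| ≤ C * (x l + 1 / ((l : ℝ) + 1) ^ 4)) →
      ∀ l : ℕ, |k l - ((l : ℝ) + 1) / (D / a + 1) -
        (a ^ 2 - b) / a ^ 2 / (D / a + 1) * Real.log ((l : ℝ) + 1)| ≤ K := by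
  have hD0 : 0 < D := by linarith
  obtain ⟨c, hc, c₂, hc₂, hbd⟩ := decay_linear_bounds hκ hC ha' hε hM
  obtain ⟨K₁, hK₁, hinc⟩ := inv_increment (a := a) (b := b) hC hc hc₂
  obtain ⟨K₂, hK₂, hgr⟩ := growth_asymptotics (h := a ^ 2 - b) (W := 1 / c) ha
    (by positivity : 0 < 1 / c₂) hK₁
  obtain ⟨K₃, hK₃, hinv⟩ := inv_asymptotics (g := (a ^ 2 - b) / a) ha
    (by positivity : 0 < 1 / c₂) hK₂
  set C' := C * (c₂ ^ 2 + 1) + D * K₃ + C * (c₂ + 1) with hC'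
  have hC'0 : 0 ≤ C' := by positivity
  -- Obtained by inserting `x = 1 / (a n) - (g / a²) log n / n² + O(n⁻²)`, with `g = (a² - b) / a`,
  -- into `1 - D x`. The assumption `a ≤ D` is the condition `1 ≤ μ`.
  obtain ⟨K₄, hK₄, hker⟩ := kernel_asymptotics (μ := D / a) (ν := D * ((a ^ 2 - b) / a / a ^ 2))
    (K₀ := K₀) ((one_le_div ha).2 hD) hC'0
  refine ⟨K₄, hK₄, fun x χ r k h0 h1 h2 h3 h4 h5 h6 h7 h8 h9 => ?_⟩
  have hb := hbd x h0 h1 h2 h3 h4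
  have hx : ∀ l, 0 < x l := fun l => lt_of_lt_of_le (by positivity) (hb l).1
  have hlow : ∀ l : ℕ, 1 / c₂ * ((l : ℝ) + 1) ≤ 1 / x l := fun l => by
    rw [le_div_iff₀ (hx l)]
    have := (hb l).2
    rw [le_div_iff₀ (by positivity)] at this
    calc 1 / c₂ * ((l : ℝ) + 1) * x l = x l * ((l : ℝ) + 1) / c₂ := by ring
      _ ≤ 1 := by rw [div_le_one hc₂]; exact this
  have hw := hgr (fun l => 1 / x l) (by
    have := (hb 0).1
    simp only [Nat.cast_zero, zero_add, div_one] at this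
    rw [abs_of_pos (one_div_pos.2 (hx 0))]
    exact one_div_le_one_div_of_le hc this) hlow (fun l => by
      have := hinc x hb h5 l
      simpa using this)
  have hxa : ∀ l : ℕ, |x l - (1 / (a * ((l : ℝ) + 1)) - (a ^ 2 - b) / a / a ^ 2 *
      (Real.log ((l : ℝ) + 1) / ((l : ℝ) + 1) ^ 2))| ≤ K₃ / ((l : ℝ) + 1) ^ 2 := fun l => by
    have := hinv ((l : ℝ) + 1) (1 / x l) (by linarith [Nat.cast_nonneg (α := ℝ) l]) (hlow l) (hw l)
    simpa using this
  have hk := hker χ r k h6 h7 (fun l => by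
    have hm1 : (1 : ℝ) ≤ (l : ℝ) + 1 := by linarith [Nat.cast_nonneg (α := ℝ) l]
    have g1 := h8 l
    have g2 := hxa l
    have g3 := (hb l).2
    have g4 := hx l
    generalize (l : ℝ) + 1 = m at *
    generalize x l = z at *
    have hm : 0 < m := by linarith
    have e : χ l - (1 - D / a / m + D * ((a ^ 2 - b) / a / a ^ 2) * (Real.log m / m ^ 2)) =
        (χ l - (1 - D * z)) - D * (z - (1 / (a * m) - (a ^ 2 - b) / a / a ^ 2 *
          (Real.log m / m ^ 2))) := by field_simp; ring
    rw [e]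
    refine (abs_sub _ _).trans ?_
    rw [abs_mul, abs_of_pos hD0]
    have q1 : z ^ 2 ≤ c₂ ^ 2 / m ^ 2 := by rw [← div_pow]; gcongr
    have q2 : 1 / m ^ 4 ≤ 1 / m ^ 2 := by gcongr; norm_num
    calc _ ≤ C * (c₂ ^ 2 / m ^ 2 + 1 / m ^ 2) + D * (K₃ / m ^ 2) := by
          gcongr; exact g1.trans (by gcongr)
      _ = (C * (c₂ ^ 2 + 1) + D * K₃) / m ^ 2 := by ring
      _ ≤ C' / m ^ 2 := by
          gcongr; rw [hC']; linarith [show 0 ≤ C * (c₂ + 1) by positivity])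
    (fun l => by
      have hm1 : (1 : ℝ) ≤ (l : ℝ) + 1 := by linarith [Nat.cast_nonneg (α := ℝ) l]
      have g1 := h9 l
      have g3 := (hb l).2
      generalize (l : ℝ) + 1 = m at *
      have hm : 0 < m := by linarith
      have q2 : 1 / m ^ 4 ≤ 1 / m := by
        apply one_div_le_one_div_of_le hm
        exact le_self_pow₀ hm1 (by norm_num)
      calc _ ≤ C * (c₂ / m + 1 / m) := g1.trans (by gcongr)
        _ = C * (c₂ + 1) / m := by ring
        _ ≤ C' / m := by
          gcongr; rw [hC']
          linarith [show 0 ≤ C * (c₂ ^ 2 + 1) + D * K₃ by positivity])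
  intro l
  have e : (a ^ 2 - b) / a ^ 2 / (D / a + 1) =
      D * ((a ^ 2 - b) / a / a ^ 2) / (D / a * (D / a + 1)) := by
    field_simp
  rw [e]
  exact hk l

/-- Converts the geometric convergence of Tanh variances into the `n⁻⁴` perturbations admitted by
the scalar recursions. -/
lemma geometric_le_inv_pow_four {ρ : ℝ} (h0 : 0 ≤ ρ) (h1 : ρ < 1) :
    ∃ C ≥ 0, ∀ l : ℕ, ρ ^ l ≤ C / ((l : ℝ) + 1) ^ 4 := by
  have h : Tendsto (fun n : ℕ => (n : ℝ) ^ 4 * ρ ^ n) atTop (𝓝 0) :=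
    tendsto_pow_const_mul_const_pow_of_abs_lt_one 4 (by rwa [abs_of_nonneg h0])
  rcases h0.eq_or_lt with rfl | hρ
  · refine ⟨1, by norm_num, fun l => ?_⟩
    rcases l with _ | l
    · simp
    · simp; positivity
  obtain ⟨B, hB⟩ := h.bddAbove_range
  refine ⟨|B| / ρ, by positivity, fun l => ?_⟩
  have := hB ⟨l + 1, rfl⟩
  simp only [Nat.cast_add, Nat.cast_one, pow_succ ρ] at this
  rw [le_div_iff₀ (by positivity), le_div_iff₀ hρ]
  calc _ = ((l : ℝ) + 1) ^ 4 * (ρ ^ l * ρ) := by ring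
    _ ≤ |B| := this.trans (le_abs_self _)

/-! ### ReLU: arc-cosine kernels -/

lemma relu_of_pos {x : ℝ} (hx : 0 < x) : relu x = x := max_eq_left hx.le

lemma relu_of_nonpos {x : ℝ} (hx : x ≤ 0) : relu x = 0 := max_eq_right hx

lemma relu_mul {s x : ℝ} (hs : 0 ≤ s) : relu (s * x) = s * relu x := by
  simp [relu, mul_max_of_nonneg _ _ hs]

lemma deriv_relu (x : ℝ) : deriv relu x = if 0 < x then 1 else 0 := by
  rcases lt_trichotomy x 0 with h | rfl | h
  · rw [if_neg h.not_gt]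
    have : relu =ᶠ[𝓝 x] fun _ => 0 :=
      (eventually_lt_nhds h).mono fun y hy => relu_of_nonpos hy.le
    rw [this.deriv_eq, deriv_const]
  · rw [if_neg (lt_irrefl _)]
    -- At the kink the one-sided derivatives are 1 and 0, so `deriv` takes its default value 0.
    apply deriv_zero_of_not_differentiableAt
    intro hd
    have h1 : HasDerivWithinAt relu 1 (Set.Ici 0) 0 :=
      (hasDerivWithinAt_id 0 _).congr (fun y hy => max_eq_left hy) (by simp [relu])
    have h2 : HasDerivWithinAt relu 0 (Set.Iic 0) 0 :=
      (hasDerivWithinAt_const 0 _ 0).congr (fun y hy => relu_of_nonpos hy) (by simp [relu])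
    have e1 := h1.derivWithin (uniqueDiffOn_Ici 0 0 Set.self_mem_Ici)
    have e2 := h2.derivWithin (uniqueDiffOn_Iic 0 0 Set.self_mem_Iic)
    rw [hd.derivWithin (uniqueDiffOn_Ici 0 0 Set.self_mem_Ici)] at e1
    rw [hd.derivWithin (uniqueDiffOn_Iic 0 0 Set.self_mem_Iic)] at e2
    linarith
  · rw [if_pos h]
    have : relu =ᶠ[𝓝 x] id := (eventually_gt_nhds h).mono fun y hy => relu_of_pos hy
    rw [this.deriv_eq, deriv_id]

lemma deriv_relu_mul {s x : ℝ} (hs : 0 < s) : deriv relu (s * x) = deriv relu x := by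
  simp [deriv_relu, hs]

/-- Integrals of positively homogeneous functions against the planar Gaussian, in polar
coordinates. -/
lemma integral_gaussian_homogeneous (F : ℝ × ℝ → ℝ) (k : ℕ) (A : ℝ → ℝ)
    (hF : ∀ r ψ : ℝ, 0 < r → F (r * Real.cos ψ, r * Real.sin ψ) = r ^ k * A ψ) :
    ∫ z, F z ∂((gaussianReal 0 1).prod (gaussianReal 0 1)) =
      (∫ r in Set.Ioi (0 : ℝ), r ^ (k + 1) * Real.exp (-(1 / 2) * r ^ 2)) *
        ((2 * Real.pi)⁻¹ * ∫ ψ in Set.Ioo (-Real.pi) Real.pi, A ψ) := by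
  have h1 : (gaussianReal 0 1).prod (gaussianReal 0 1) =
      (volume : Measure (ℝ × ℝ)).withDensity
        (fun z => gaussianPDF 0 1 z.1 * gaussianPDF 0 1 z.2) := by
    rw [gaussianReal_of_var_ne_zero _ one_ne_zero, prod_withDensity
      (measurable_gaussianPDF _ _) (measurable_gaussianPDF _ _), Measure.volume_eq_prod]
  have hm : Measurable fun z : ℝ × ℝ => gaussianPDF 0 1 z.1 * gaussianPDF 0 1 z.2 :=
    ((measurable_gaussianPDF _ _).comp measurable_fst).mul
      ((measurable_gaussianPDF _ _).comp measurable_snd)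
  rw [h1, integral_withDensity_eq_integral_toReal_smul hm
    (ae_of_all _ fun z => ENNReal.mul_lt_top gaussianPDF_lt_top gaussianPDF_lt_top),
    ← integral_comp_polarCoord_symm]
  have h2 : polarCoord.target = Set.Ioi (0 : ℝ) ×ˢ Set.Ioo (-Real.pi) Real.pi := rfl
  have h3 : ∀ p ∈ polarCoord.target,
      p.1 • ((gaussianPDF 0 1 (polarCoord.symm p).1 * gaussianPDF 0 1 (polarCoord.symm p).2).toReal •
        F (polarCoord.symm p)) =
      (p.1 ^ (k + 1) * Real.exp (-(1 / 2) * p.1 ^ 2)) * ((2 * Real.pi)⁻¹ * A p.2) := by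
    rintro ⟨r, ψ⟩ hp
    have hr : 0 < r := hp.1
    have e : polarCoord.symm (r, ψ) = (r * Real.cos ψ, r * Real.sin ψ) := rfl
    rw [e, hF r ψ hr, ENNReal.toReal_mul, toReal_gaussianPDF, toReal_gaussianPDF, gaussianPDFReal,
      gaussianPDFReal]
    simp only [NNReal.coe_one, mul_one, sub_zero, smul_eq_mul]
    have h4 : (√(2 * Real.pi))⁻¹ * (√(2 * Real.pi))⁻¹ = (2 * Real.pi)⁻¹ := by
      rw [← mul_inv, Real.mul_self_sqrt (by positivity)]
    have h5 : Real.exp (-(r * Real.cos ψ) ^ 2 / 2) * Real.exp (-(r * Real.sin ψ) ^ 2 / 2) =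
        Real.exp (-(1 / 2) * r ^ 2) := by
      rw [← Real.exp_add]; congr 1
      linear_combination -(r ^ 2 / 2) * Real.sin_sq_add_cos_sq ψ
    rw [← h4, ← h5]
    ring
  rw [setIntegral_congr_fun polarCoord.open_target.measurableSet h3, h2, Measure.volume_eq_prod,
    setIntegral_prod_mul (fun r : ℝ => r ^ (k + 1) * Real.exp (-(1 / 2) * r ^ 2))
      (fun ψ => (2 * Real.pi)⁻¹ * A ψ), integral_const_mul]

/-- In general a factor `Γ((k + 2) / 2)` appears; only the degrees `k = 0` and `k = 2` are needed,
and there it equals 1. -/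
lemma radial_integral (k : ℕ) (hk : Real.Gamma ((k + 2 : ℝ) / 2) = 1) :
    ∫ r in Set.Ioi (0 : ℝ), r ^ (k + 1) * Real.exp (-(1 / 2) * r ^ 2) = 2 ^ (k / 2 : ℝ) := by
  have h := integral_rpow_mul_exp_neg_mul_rpow (p := 2) (q := k + 1) (b := 1 / 2) (by norm_num)
    (by linarith [Nat.cast_nonneg (α := ℝ) k]) (by norm_num)
  have e : ((k : ℝ) + 1 + 1) / 2 = (k + 2 : ℝ) / 2 := by ring
  rw [e, hk] at h
  have h2 : ∫ r in Set.Ioi (0 : ℝ), r ^ (k + 1) * Real.exp (-(1 / 2) * r ^ 2) =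
      ∫ x in Set.Ioi (0 : ℝ), x ^ ((k : ℝ) + 1) * Real.exp (-(1 / 2) * x ^ (2 : ℝ)) := by
    refine setIntegral_congr_fun measurableSet_Ioi fun r hr => ?_
    simp only [Real.rpow_ofNat]
    congr 1
    exact_mod_cast (Real.rpow_natCast r (k + 1)).symm
  rw [h2, h, one_div, Real.inv_rpow (by norm_num), ← Real.rpow_neg (by norm_num)]
  have : -(-((k : ℝ) + 1 + 1) / 2) = k / 2 + 1 := by ring
  rw [this, Real.rpow_add (by norm_num)]
  norm_num
  ring

/-- The window extends down to `-3π/2` so that it contains `ψ - θ` as well as `ψ`, once `ψ` is known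
to exceed `-π/2`. -/
lemma cos_pos_iff_of_mem {ψ : ℝ} (h : ψ ∈ Set.Ioo (-(3 * Real.pi / 2)) Real.pi) :
    0 < Real.cos ψ ↔ ψ ∈ Set.Ioo (-(Real.pi / 2)) (Real.pi / 2) := by
  refine ⟨fun hc => ?_, fun hm => Real.cos_pos_of_mem_Ioo hm⟩
  by_contra hn
  simp only [Set.mem_Ioo, not_and_or, not_lt] at hn
  rcases hn with hn | hn
  · have := Real.cos_nonpos_of_pi_div_two_le_of_le (x := -ψ) (by linarith) (by linarith [h.1])
    rw [Real.cos_neg] at this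
    linarith
  · have := Real.cos_nonpos_of_pi_div_two_le_of_le hn (by linarith [h.2, Real.pi_pos])
    linarith

/-- Two half-planes whose normals make an angle `θ` meet in a sector of opening `π - θ`. Both
arc-cosine kernels are integrals over this sector. -/
lemma angular_support {θ ψ : ℝ} (h0 : 0 ≤ θ) (hπ : θ ≤ Real.pi)
    (hψ : ψ ∈ Set.Ioo (-Real.pi) Real.pi) :
    (0 < Real.cos ψ ∧ 0 < Real.cos (ψ - θ)) ↔
      ψ ∈ Set.Ioo (θ - Real.pi / 2) (Real.pi / 2) := by
  have hp := Real.pi_pos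
  rw [cos_pos_iff_of_mem ⟨by linarith [hψ.1], hψ.2⟩]
  constructor
  · rintro ⟨h1, h2⟩
    rw [cos_pos_iff_of_mem ⟨by linarith [h1.1], by linarith [hψ.2]⟩] at h2
    exact ⟨by linarith [h2.1], h1.2⟩
  · intro h
    exact ⟨⟨by linarith [h.1], h.2⟩,
      Real.cos_pos_of_mem_Ioo ⟨by linarith [h.1], by linarith [h.2]⟩⟩

lemma angular_integral_of_support {θ : ℝ} (h0 : 0 ≤ θ) (hπ : θ ≤ Real.pi) (A B : ℝ → ℝ)
    (h1 : ∀ ψ, 0 < Real.cos ψ → 0 < Real.cos (ψ - θ) → A ψ = B ψ)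
    (h2 : ∀ ψ, ¬ (0 < Real.cos ψ ∧ 0 < Real.cos (ψ - θ)) → A ψ = 0) :
    ∫ ψ in Set.Ioo (-Real.pi) Real.pi, A ψ = ∫ ψ in (θ - Real.pi / 2)..(Real.pi / 2), B ψ := by
  have hp := Real.pi_pos
  have hsub : Set.Ioo (θ - Real.pi / 2) (Real.pi / 2) ⊆ Set.Ioo (-Real.pi) Real.pi :=
    Set.Ioo_subset_Ioo (by linarith) (by linarith)
  have e : ∀ ψ ∈ Set.Ioo (-Real.pi) Real.pi,
      A ψ = (Set.Ioo (θ - Real.pi / 2) (Real.pi / 2)).indicator B ψ := by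
    intro ψ hψ
    by_cases h : ψ ∈ Set.Ioo (θ - Real.pi / 2) (Real.pi / 2)
    · rw [Set.indicator_of_mem h]
      have := (angular_support h0 hπ hψ).2 h
      exact h1 ψ this.1 this.2
    · rw [Set.indicator_of_notMem h]
      exact h2 ψ fun hh => h ((angular_support h0 hπ hψ).1 hh)
  rw [setIntegral_congr_fun measurableSet_Ioo e, setIntegral_indicator measurableSet_Ioo,
    Set.inter_eq_self_of_subset_right hsub,
    intervalIntegral.integral_of_le (by linarith), integral_Ioc_eq_integral_Ioo]

lemma integral_cos_mul_cos_sub (θ : ℝ) :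
    ∫ ψ in (θ - Real.pi / 2)..(Real.pi / 2), Real.cos ψ * Real.cos (ψ - θ) =
      1 / 2 * (Real.sin θ + (Real.pi - θ) * Real.cos θ) := by
  have hd : ∀ ψ ∈ Set.uIcc (θ - Real.pi / 2) (Real.pi / 2),
      HasDerivAt (fun ψ => 1 / 2 * (ψ * Real.cos θ + 1 / 2 * Real.sin (2 * ψ - θ)))
        (Real.cos ψ * Real.cos (ψ - θ)) ψ := by
    intro ψ _
    have h1 : HasDerivAt (fun ψ : ℝ => 2 * ψ - θ) 2 ψ := by
      simpa using ((hasDerivAt_id ψ).const_mul 2).sub_const θ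
    have h2 := ((hasDerivAt_id ψ).mul_const (Real.cos θ)).add
      ((h1.sin).const_mul (1 / 2 : ℝ))
    refine (h2.const_mul (1 / 2 : ℝ)).congr_deriv ?_
    have e1 : 2 * ψ - θ = ψ + (ψ - θ) := by ring
    have e2 : Real.cos θ = Real.cos (ψ - (ψ - θ)) := by congr 1; ring
    rw [e2, e1, Real.cos_add, Real.cos_sub ψ (ψ - θ)]
    ring
  rw [intervalIntegral.integral_eq_sub_of_hasDerivAt hd
    (by apply Continuous.intervalIntegrable; fun_prop)]
  have e1 : 2 * (Real.pi / 2) - θ = Real.pi - θ := by ring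
  have e2 : 2 * (θ - Real.pi / 2) - θ = θ - Real.pi := by ring
  rw [e1, e2, Real.sin_pi_sub, Real.sin_sub_pi]
  ring

lemma corr_mem {a b p : ℝ} (ha : 0 < a) (hb : 0 < b) (hp : |p| ≤ √(a * b)) :
    -1 ≤ p / √(a * b) ∧ p / √(a * b) ≤ 1 := by
  have hs : 0 < √(a * b) := Real.sqrt_pos.2 (by positivity)
  have := abs_le.1 hp
  constructor
  · rw [le_div_iff₀ hs]; linarith
  · rw [div_le_iff₀ hs]; linarith

/-- In polar coordinates, with `θ` the arccosine of the correlation, the pair is `√a r cos ψ` and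
`√b r cos (ψ - θ)`. Homogeneity separates a radial integral from the integral of `cos ψ cos (ψ - θ)`
over the sector where both are positive. -/
theorem gaussE_relu {a b p : ℝ} (ha : 0 < a) (hb : 0 < b) (hp : |p| ≤ √(a * b)) :
    gaussE relu a b p = √(a * b) * ((2 * Real.pi)⁻¹ *
      (Real.sin (Real.arccos (p / √(a * b))) + (Real.pi - Real.arccos (p / √(a * b))) *
        (p / √(a * b)))) := by
  obtain ⟨h1, h2⟩ := corr_mem ha hb hp
  set c := p / √(a * b) with hc
  set θ := Real.arccos c with hθ
  have hcos : Real.cos θ = c := Real.cos_arccos h1 h2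
  have hsin : Real.sin θ = √(1 - c ^ 2) := Real.sin_arccos c
  have hF : ∀ r ψ : ℝ, 0 < r → relu (√a * (r * Real.cos ψ)) *
      relu (√b * (c * (r * Real.cos ψ) + √(1 - c ^ 2) * (r * Real.sin ψ))) =
      r ^ 2 * (√(a * b) * (relu (Real.cos ψ) * relu (Real.cos (ψ - θ)))) := by
    intro r ψ hr
    have e : c * (r * Real.cos ψ) + √(1 - c ^ 2) * (r * Real.sin ψ) =
        r * Real.cos (ψ - θ) := by
      rw [Real.cos_sub, hcos, hsin]; ring
    rw [e, relu_mul (Real.sqrt_nonneg _), relu_mul hr.le, relu_mul (Real.sqrt_nonneg _),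
      relu_mul hr.le, Real.sqrt_mul ha.le]
    ring
  have hang := angular_integral_of_support (θ := θ) (Real.arccos_nonneg _) (Real.arccos_le_pi _)
    (fun ψ => relu (Real.cos ψ) * relu (Real.cos (ψ - θ)))
    (fun ψ => Real.cos ψ * Real.cos (ψ - θ))
    (fun ψ h3 h4 => by simp only [relu_of_pos h3, relu_of_pos h4])
    (fun ψ h => by
      rw [not_and_or, not_lt, not_lt] at h
      rcases h with h | h <;> simp [relu_of_nonpos h])
  have h := integral_gaussian_homogeneous (fun z => relu (√a * z.1) *
    relu (√b * (c * z.1 + √(1 - c ^ 2) * z.2))) 2 _ hF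
  unfold gaussE
  rw [← hc, h, radial_integral 2 (by norm_num), integral_const_mul, hang, integral_cos_mul_cos_sub,
    hcos]
  norm_num
  ring

/-- The expectation is the probability that both variables are positive, i.e. the proportion `(π -
θ) / (2π)` of the plane filled by the sector. -/
theorem gaussE_deriv_relu {a b p : ℝ} (ha : 0 < a) (hb : 0 < b) (hp : |p| ≤ √(a * b)) :
    gaussE (deriv relu) a b p =
      (2 * Real.pi)⁻¹ * (Real.pi - Real.arccos (p / √(a * b))) := by
  obtain ⟨h1, h2⟩ := corr_mem ha hb hp
  set c := p / √(a * b) with hc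
  set θ := Real.arccos c with hθ
  have hcos : Real.cos θ = c := Real.cos_arccos h1 h2
  have hsin : Real.sin θ = √(1 - c ^ 2) := Real.sin_arccos c
  have hF : ∀ r ψ : ℝ, 0 < r → deriv relu (√a * (r * Real.cos ψ)) *
      deriv relu (√b * (c * (r * Real.cos ψ) + √(1 - c ^ 2) * (r * Real.sin ψ))) =
      r ^ 0 * (deriv relu (Real.cos ψ) * deriv relu (Real.cos (ψ - θ))) := by
    intro r ψ hr
    have e : c * (r * Real.cos ψ) + √(1 - c ^ 2) * (r * Real.sin ψ) =
        r * Real.cos (ψ - θ) := by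
      rw [Real.cos_sub, hcos, hsin]; ring
    rw [e, deriv_relu_mul (Real.sqrt_pos.2 ha), deriv_relu_mul hr,
      deriv_relu_mul (Real.sqrt_pos.2 hb), deriv_relu_mul hr]
    ring
  have hang := angular_integral_of_support (θ := θ) (Real.arccos_nonneg _) (Real.arccos_le_pi _)
    (fun ψ => deriv relu (Real.cos ψ) * deriv relu (Real.cos (ψ - θ)))
    (fun _ => 1) (fun ψ h3 h4 => by simp only [deriv_relu, h3, h4, if_true, mul_one])
    (fun ψ h => by
      rw [not_and_or] at h
      rcases h with h | h <;> simp [deriv_relu, h])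
  have h := integral_gaussian_homogeneous (fun z => deriv relu (√a * z.1) *
    deriv relu (√b * (c * z.1 + √(1 - c ^ 2) * z.2))) 0 _ hF
  unfold gaussE
  rw [← hc, h, radial_integral 0 (by norm_num), hang]
  simp
  ring

/-! ### The scalar recursions of a pair of inputs -/

/-- Variances along the layers, from the first-layer variance `a`. -/
noncomputable def varSeq (φ : ℝ → ℝ) (σb σw a : ℝ) (l : ℕ) : ℝ :=
  (fun q => σb ^ 2 + σw ^ 2 * gaussE φ q q q)^[l] a

/-- Covariances along the layers, from the first-layer variances `a`, `b` and covariance `p`. -/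
noncomputable def covSeq (φ : ℝ → ℝ) (σb σw a b p : ℝ) : ℕ → ℝ
  | 0 => p
  | l + 1 => σb ^ 2 + σw ^ 2 * gaussE φ (varSeq φ σb σw a l) (varSeq φ σb σw b l)
      (covSeq φ σb σw a b p l)

/-- The factors `q̇` along the layers. -/
noncomputable def dotSeq (φ : ℝ → ℝ) (σb σw a b p : ℝ) (l : ℕ) : ℝ :=
  σw ^ 2 * gaussE (deriv φ) (varSeq φ σb σw a l) (varSeq φ σb σw b l) (covSeq φ σb σw a b p l)

/-- Neural tangent kernels along the layers. -/
noncomputable def ntkSeq (φ : ℝ → ℝ) (σb σw a b p : ℝ) : ℕ → ℝ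
  | 0 => p
  | l + 1 => dotSeq φ σb σw a b p l * ntkSeq φ σb σw a b p l + covSeq φ σb σw a b p (l + 1)

lemma varSeq_zero (φ : ℝ → ℝ) (σb σw a : ℝ) : varSeq φ σb σw a 0 = a := rfl

lemma varSeq_succ (φ : ℝ → ℝ) (σb σw a : ℝ) (l : ℕ) : varSeq φ σb σw a (l + 1) =
    σb ^ 2 + σw ^ 2 * gaussE φ (varSeq φ σb σw a l) (varSeq φ σb σw a l) (varSeq φ σb σw a l) := by
  rw [varSeq, Function.iterate_succ_apply']; rfl

lemma covSeq_self (φ : ℝ → ℝ) (σb σw a : ℝ) (l : ℕ) :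
    covSeq φ σb σw a a a l = varSeq φ σb σw a l := by
  induction l with
  | zero => rfl
  | succ l ih => rw [covSeq, varSeq_succ, ih]

lemma gaussE_self (ψ : ℝ → ℝ) {a : ℝ} (ha : 0 ≤ a) :
    gaussE ψ a a a = ∫ z, ψ (√a * z) ^ 2 ∂(gaussianReal 0 1) := by
  have h : gaussE ψ a a a = ∫ z : ℝ × ℝ, ψ (√a * z.1) ^ 2
      ∂((gaussianReal 0 1).prod (gaussianReal 0 1)) := by
    refine integral_congr_ae (ae_of_all _ fun z => ?_)
    -- For `a = 0` the correlation is `0 / 0 = 0` by convention; this is harmless because both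
    -- arguments of `ψ` are multiplied by `√0`.
    rcases ha.eq_or_lt with rfl | ha
    · simp [sq]
    · have : a / √(a * a) = 1 := by rw [Real.sqrt_mul_self ha.le, div_self ha.ne']
      simp [this, sq]
  rw [h, integral_fun_fst (fun z => ψ (√a * z) ^ 2)]
  simp

/-! ### ReLU recursions -/

/-- With `t` half the angle of the pair, `sin 2t - 2t cos 2t` is `π` times the gain of correlation
in one ReLU layer. Its derivative is `8 t sin t cos t`, while that of `8/3 sin³ t` is `8 sin² t cos
t`; so both estimates reduce to `sin t ≤ t ≤ sin t + sin³ t`. -/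
lemma arc_bounds {t : ℝ} (h0 : 0 ≤ t) (h1 : t ≤ Real.pi / 2) :
    8 / 3 * Real.sin t ^ 3 ≤ Real.sin (2 * t) - 2 * t * Real.cos (2 * t) ∧
      Real.sin (2 * t) - 2 * t * Real.cos (2 * t) ≤
        8 / 3 * Real.sin t ^ 3 + 8 / 5 * Real.sin t ^ 5 ∧
      t - Real.sin t ≤ Real.sin t ^ 3 ∧ Real.sin t ≤ t := by
  have hpi := Real.pi_pos
  -- Cubic Taylor bound for the sine, then Jordan's inequality `2 s / π ≤ sin s`; the constants fit
  -- because `π³ ≤ 48`.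
  have hsub : ∀ s : ℝ, 0 ≤ s → s ≤ Real.pi / 2 → s - Real.sin s ≤ Real.sin s ^ 3 := by
    intro s hs0 hs1
    have e1 := Real.sin_ge_sub_cube hs0
    have e2 := Real.mul_le_sin hs0 hs1
    have e3 : s ^ 3 / 6 ≤ (2 / Real.pi * s) ^ 3 := by
      have : (2 / Real.pi * s) ^ 3 = 8 / Real.pi ^ 3 * s ^ 3 := by ring
      rw [this]
      have h8 : 1 / 6 ≤ 8 / Real.pi ^ 3 := by
        rw [div_le_div_iff₀ (by norm_num) (by positivity)]
        have : Real.pi ^ 3 ≤ (3.15 : ℝ) ^ 3 := by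
          gcongr; exact Real.pi_lt_d2.le
        norm_num at this ⊢
        linarith
      have : 0 ≤ s ^ 3 := by positivity
      nlinarith
    have e4 : (2 / Real.pi * s) ^ 3 ≤ Real.sin s ^ 3 := by gcongr
    linarith
  have hd : ∀ s : ℝ, HasDerivAt (fun t => Real.sin (2 * t) - 2 * t * Real.cos (2 * t))
      (8 * s * Real.sin s * Real.cos s) s := by
    intro s
    have e : HasDerivAt (fun t : ℝ => 2 * t) 2 s := by simpa using (hasDerivAt_id s).const_mul 2
    refine (e.sin.sub (e.mul e.cos)).congr_deriv ?_
    rw [Real.sin_two_mul]; ring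
  have hd3 : ∀ s : ℝ, HasDerivAt (fun t => 8 / 3 * Real.sin t ^ 3)
      (8 * Real.sin s ^ 2 * Real.cos s) s := by
    intro s
    refine (((Real.hasDerivAt_sin s).pow 3).const_mul (8 / 3 : ℝ)).congr_deriv ?_
    push_cast; ring
  have hd5 : ∀ s : ℝ, HasDerivAt (fun t => 8 / 5 * Real.sin t ^ 5)
      (8 * Real.sin s ^ 4 * Real.cos s) s := by
    intro s
    refine (((Real.hasDerivAt_sin s).pow 5).const_mul (8 / 5 : ℝ)).congr_deriv ?_
    push_cast; ring
  have hpos : ∀ s ∈ interior (Set.Icc 0 (Real.pi / 2)), 0 < s ∧ s < Real.pi / 2 ∧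
      0 < Real.sin s ∧ 0 < Real.cos s := by
    intro s hs
    rw [interior_Icc] at hs
    exact ⟨hs.1, hs.2, Real.sin_pos_of_pos_of_lt_pi hs.1 (by linarith [hs.2]),
      Real.cos_pos_of_mem_Ioo ⟨by linarith [hs.1], hs.2⟩⟩
  have m1 : MonotoneOn (fun t => Real.sin (2 * t) - 2 * t * Real.cos (2 * t) -
      8 / 3 * Real.sin t ^ 3) (Set.Icc 0 (Real.pi / 2)) := by
    refine monotoneOn_of_hasDerivWithinAt_nonneg (convex_Icc _ _)
      (f' := fun s => 8 * s * Real.sin s * Real.cos s - 8 * Real.sin s ^ 2 * Real.cos s)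
      (by fun_prop) (fun s _ => ((hd s).sub (hd3 s)).hasDerivWithinAt) fun s hs => ?_
    obtain ⟨p1, p2, p3, p4⟩ := hpos s hs
    have : 8 * s * Real.sin s * Real.cos s - 8 * Real.sin s ^ 2 * Real.cos s =
      8 * Real.sin s * Real.cos s * (s - Real.sin s) := by ring
    rw [this]
    exact mul_nonneg (by positivity) (by linarith [Real.sin_lt p1])
  have m2 : AntitoneOn (fun t => Real.sin (2 * t) - 2 * t * Real.cos (2 * t) -
      8 / 3 * Real.sin t ^ 3 - 8 / 5 * Real.sin t ^ 5) (Set.Icc 0 (Real.pi / 2)) := by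
    refine antitoneOn_of_hasDerivWithinAt_nonpos (convex_Icc _ _)
      (f' := fun s => 8 * s * Real.sin s * Real.cos s - 8 * Real.sin s ^ 2 * Real.cos s -
        8 * Real.sin s ^ 4 * Real.cos s)
      (by fun_prop) (fun s _ => (((hd s).sub (hd3 s)).sub (hd5 s)).hasDerivWithinAt) fun s hs => ?_
    obtain ⟨p1, p2, p3, p4⟩ := hpos s hs
    have : 8 * s * Real.sin s * Real.cos s - 8 * Real.sin s ^ 2 * Real.cos s -
        8 * Real.sin s ^ 4 * Real.cos s =
      8 * Real.sin s * Real.cos s * (s - Real.sin s - Real.sin s ^ 3) := by ring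
    rw [this]
    exact mul_nonpos_of_nonneg_of_nonpos (by positivity) (by linarith [hsub s p1.le p2.le])
  have z : (0 : ℝ) ∈ Set.Icc 0 (Real.pi / 2) := ⟨le_rfl, by linarith⟩
  have a1 := m1 z ⟨h0, h1⟩ h0
  have a2 := m2 z ⟨h0, h1⟩ h0
  simp at a1 a2
  exact ⟨by linarith, by linarith, hsub t h0 h1, Real.sin_le h0⟩

/-- A global bound, valid far from correlation 1: it says that a layer keeps at least a quarter of
the squared defect. The cases are the two signs of `cos 2t`. -/
lemma arc_upper_bound {t : ℝ} (h0 : 0 ≤ t) (h1 : t ≤ Real.pi / 2) :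
    Real.sin (2 * t) - 2 * t * Real.cos (2 * t) ≤ 3 / 2 * Real.pi * Real.sin t ^ 2 := by
  have hpi := Real.pi_gt_three
  have hc : Real.cos (2 * t) = 1 - 2 * Real.sin t ^ 2 := by
    rw [Real.cos_two_mul]; linarith [Real.sin_sq_add_cos_sq t]
  have hs1 := Real.sin_le (x := 2 * t) (by linarith)
  have hs2 := Real.sin_le_one (2 * t)
  have hs3 := Real.sin_nonneg_of_nonneg_of_le_pi (x := 2 * t) (by linarith) (by linarith)
  rw [hc]
  set v := Real.sin t ^ 2
  have hv : 0 ≤ v := sq_nonneg _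
  rcases le_or_gt v (1 / 2) with h | h
  · have : Real.sin (2 * t) * (1 - 2 * v) ≤ 2 * t * (1 - 2 * v) := by
      apply mul_le_mul_of_nonneg_right hs1; linarith
    nlinarith
  · have : 2 * t * (2 * v - 1) ≤ Real.pi * (2 * v - 1) := by
      apply mul_le_mul_of_nonneg_right _ _ <;> linarith
    have hv1 : v ≤ 1 := Real.sin_sq_le_one t
    nlinarith

/-- The correlation map of ReLU networks. -/
noncomputable def arcMap (c : ℝ) : ℝ :=
  Real.pi⁻¹ * (Real.sin (Real.arccos c) + (Real.pi - Real.arccos c) * c)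

/-- The defect `√((1 - c) / 2)` of a correlation. -/
noncomputable def arcDefect (c : ℝ) : ℝ := √((1 - c) / 2)

lemma arcDefect_eq {c : ℝ} (h1 : -1 ≤ c) (h2 : c ≤ 1) :
    arcDefect c = Real.sin (Real.arccos c / 2) := by
  have h3 := Real.arccos_nonneg c
  have h4 := Real.arccos_le_pi c
  rw [arcDefect, Real.sqrt_eq_iff_mul_self_eq (by linarith)
    (Real.sin_nonneg_of_nonneg_of_le_pi (by linarith) (by linarith [Real.pi_pos]))]
  have h5 := Real.cos_sq (Real.arccos c / 2)
  rw [mul_div_cancel₀ _ two_ne_zero, Real.cos_arccos h1 h2] at h5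
  linarith [Real.sin_sq_add_cos_sq (Real.arccos c / 2)]

lemma arcDefect_sq {c : ℝ} (h2 : c ≤ 1) : arcDefect c ^ 2 = (1 - c) / 2 :=
  Real.sq_sqrt (by linarith)

/-- The map loses a multiple of `(1 - c)^(3/2)` from `1 - c`, so the defect `u = √((1 - c) / 2)`,
the sine of half the angle, is the variable with an expansion in integer powers. The remainder `r`
is kept relative to `u²`, and the bound by `3 / 4` keeps the bracket at least `1 / 4`. -/
lemma arcMap_spec {c : ℝ} (h1 : -1 ≤ c) (h2 : c ≤ 1) :
    -1 ≤ arcMap c ∧ arcMap c ≤ 1 ∧ ∃ r, 0 ≤ r ∧ r ≤ arcDefect c ^ 3 ∧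
      r + 4 / (3 * Real.pi) * arcDefect c ≤ 3 / 4 ∧
      arcDefect (arcMap c) ^ 2 =
        arcDefect c ^ 2 * (1 - 4 / (3 * Real.pi) * arcDefect c - r) := by
  have hpi := Real.pi_gt_three
  set t := Real.arccos c / 2 with ht
  have ht0 : 0 ≤ t := by have := Real.arccos_nonneg c; positivity
  have ht1 : t ≤ Real.pi / 2 := by have := Real.arccos_le_pi c; rw [ht]; linarith
  have htc : Real.arccos c = 2 * t := by rw [ht]; ring
  have hcos : Real.cos (2 * t) = c := by rw [← htc, Real.cos_arccos h1 h2]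
  obtain ⟨b1, b2, b3, b4⟩ := arc_bounds ht0 ht1
  have b5 := arc_upper_bound ht0 ht1
  have hu : arcDefect c = Real.sin t := arcDefect_eq h1 h2
  have hu0 : 0 ≤ arcDefect c := Real.sqrt_nonneg _
  have hu2 := arcDefect_sq h2
  rw [← hu] at b1 b2 b5
  have hu1 : arcDefect c ≤ 1 := by rw [hu]; exact Real.sin_le_one _
  have hmap : arcMap c = c + (Real.sin (2 * t) - 2 * t * Real.cos (2 * t)) / Real.pi := by
    rw [arcMap, htc, hcos]; field_simp; ring
  set u := arcDefect c with hud
  set G := Real.sin (2 * t) - 2 * t * Real.cos (2 * t) with hG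
  have hG0 : 0 ≤ G := le_trans (by positivity) b1
  have hGd : G / Real.pi ≤ 3 / 2 * u ^ 2 := by
    rw [div_le_iff₀ (by positivity)]; linarith
  have hm1 : arcMap c ≤ 1 := by
    rw [hmap]
    nlinarith
  have hm0 : -1 ≤ arcMap c := by
    rw [hmap]
    have : 0 ≤ G / Real.pi := by positivity
    linarith
  refine ⟨hm0, hm1, ?_⟩
  have hu' : arcDefect (arcMap c) ^ 2 = u ^ 2 - G / (2 * Real.pi) := by
    rw [arcDefect_sq hm1, hmap, hu2]; field_simp; ring
  rcases hu0.eq_or_lt with h | h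
  · refine ⟨0, le_rfl, by positivity, by rw [← h]; norm_num, ?_⟩
    have : G = 0 := by
      rw [← h] at b2
      norm_num at b2
      linarith
    rw [hu', this, ← h]; ring
  · refine ⟨G / (2 * Real.pi) / u ^ 2 - 4 / (3 * Real.pi) * u, ?_, ?_, ?_, ?_⟩
    · rw [sub_nonneg, le_div_iff₀ (by positivity), le_div_iff₀ (by positivity)]
      calc 4 / (3 * Real.pi) * u * u ^ 2 * (2 * Real.pi) = 8 / 3 * u ^ 3 := by field_simp; ring
        _ ≤ G := b1
    · rw [sub_le_iff_le_add, div_le_iff₀ (by positivity), div_le_iff₀ (by positivity)]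
      calc G ≤ 8 / 3 * u ^ 3 + 8 / 5 * u ^ 5 := b2
        _ ≤ 8 / 3 * u ^ 3 + 2 * Real.pi * u ^ 5 := by gcongr; linarith
        _ = _ := by field_simp; ring
    · rw [sub_add_cancel, div_le_iff₀ (by positivity), div_le_iff₀ (by positivity)]
      linarith
    · rw [hu']; field_simp; ring

/-- With `w = a u`, compare `y = √(1 - 2w - r)` to `z = 1 - w - w² / 2` through `y² - z² = -r - w³ -
w⁴ / 4` and `y + z ≥ 1`. The term `-w² / 2` is the source of the cubic coefficient `-a² / 2` of the
ReLU recursion. -/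
lemma sqrt_expansion {a u r : ℝ} (hu0 : 0 ≤ u) (hu1 : u ≤ 1) (ha0 : 0 ≤ a) (ha1 : a ≤ 1 / 4)
    (r0 : 0 ≤ r) (r1 : r ≤ u ^ 3) (r2 : r + 2 * a * u ≤ 3 / 4) :
    1 / 2 ≤ √(1 - 2 * a * u - r) ∧ √(1 - 2 * a * u - r) ≤ 1 - a * u ∧
      1 - 2 * u ≤ √(1 - 2 * a * u - r) ∧
      |√(1 - 2 * a * u - r) - (1 - a * u - a ^ 2 / 2 * u ^ 2)| ≤ 10 * u ^ 3 := by
  have hy2 : √(1 - 2 * a * u - r) ^ 2 = 1 - 2 * a * u - r := Real.sq_sqrt (by linarith)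
  have hy0 : 0 ≤ √(1 - 2 * a * u - r) := Real.sqrt_nonneg _
  have hau : 0 ≤ a * u := by positivity
  have hau1 : a * u ≤ 1 / 4 * 1 := by gcongr
  have hau2 : a * u ≤ u := by
    calc a * u ≤ 1 * u := by gcongr; linarith
      _ = u := one_mul u
  have hyh : 1 / 2 ≤ √(1 - 2 * a * u - r) := by
    apply Real.le_sqrt_of_sq_le; linarith
  have hy1 : √(1 - 2 * a * u - r) ≤ 1 - a * u :=
    Real.sqrt_le_iff.2 ⟨by linarith, by linarith [sq_nonneg (a * u), sub_sq 1 (a * u)]⟩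
  generalize √(1 - 2 * a * u - r) = y at *
  have hyl : 1 - 2 * u ≤ y := by
    have e1 : r ≤ u := r1.trans (pow_le_of_le_one hu0 hu1 (by norm_num))
    have e2 : y ^ 2 ≤ y := pow_le_of_le_one hy0 (by linarith) (by norm_num)
    have e3 : a * u ≤ 1 / 4 * u := by gcongr
    linarith
  refine ⟨hyh, hy1, hyl, ?_⟩
  have f2 : a ^ 2 / 2 * u ^ 2 = (a * u) ^ 2 / 2 := by ring
  have f6 : 2 * a * u = 2 * (a * u) := by ring
  rw [f2]
  rw [f6] at hy2
  clear r2
  generalize a * u = w at *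
  have hz0 : 1 / 2 ≤ 1 - w - w ^ 2 / 2 := by
    have : w ^ 2 ≤ w := pow_le_of_le_one hau (by linarith) (by norm_num)
    linarith
  have e2 : (y - (1 - w - w ^ 2 / 2)) * (y + (1 - w - w ^ 2 / 2)) = -r - w ^ 3 - w ^ 4 / 4 := by
    linear_combination hy2
  generalize 1 - w - w ^ 2 / 2 = z at *
  have e3 : |(y - z) * (y + z)| ≤ 10 * u ^ 3 := by
    rw [e2]
    have f1 : 0 ≤ w ^ 3 := by positivity
    have f2 : 0 ≤ w ^ 4 := by positivity
    have f3 : w ^ 3 ≤ u ^ 3 := by gcongr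
    have f4 : w ^ 4 ≤ w ^ 3 := pow_le_pow_of_le_one hau (by linarith) (by norm_num)
    rw [abs_le]
    constructor <;> linarith
  refine le_trans ?_ e3
  rw [abs_mul, abs_of_pos (by linarith : 0 < y + z)]
  exact le_mul_of_one_le_right (abs_nonneg _) (by linarith)

/-- One step of the ReLU recursion in terms of the defect. -/
lemma arc_step {c : ℝ} (h1 : -1 ≤ c) (h2 : c ≤ 1) :
    1 / 2 * arcDefect c ≤ arcDefect (arcMap c) ∧
      arcDefect c * (1 - 2 * arcDefect c) ≤ arcDefect (arcMap c) ∧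
      arcDefect (arcMap c) ≤ arcDefect c - 2 / (3 * Real.pi) * arcDefect c ^ 2 ∧
      |arcDefect (arcMap c) - (arcDefect c - 2 / (3 * Real.pi) * arcDefect c ^ 2 +
        -(2 / (3 * Real.pi)) ^ 2 / 2 * arcDefect c ^ 3)| ≤ 10 * arcDefect c ^ 4 := by
  obtain ⟨m0, m1, r, r0, r1, r2, hsq⟩ := arcMap_spec h1 h2
  have hpi := Real.pi_gt_three
  have hu0 : 0 ≤ arcDefect c := Real.sqrt_nonneg _
  have hv0 : 0 ≤ arcDefect (arcMap c) := Real.sqrt_nonneg _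
  have hu1 : arcDefect c ≤ 1 := Real.sqrt_le_iff.2 ⟨by norm_num, by linarith⟩
  have ha0 : 0 ≤ 2 / (3 * Real.pi) := by positivity
  have ha1 : 2 / (3 * Real.pi) ≤ 1 / 4 := by
    rw [div_le_div_iff₀ (by positivity) (by norm_num)]; linarith
  have h2a : 4 / (3 * Real.pi) = 2 * (2 / (3 * Real.pi)) := by ring
  rw [h2a] at r2 hsq
  generalize 2 / (3 * Real.pi) = a at *
  generalize arcDefect c = u at *
  generalize arcDefect (arcMap c) = v at *
  have hpos : 0 ≤ 1 - 2 * a * u - r := by linarith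
  obtain ⟨y1, y2, y3, y4⟩ := sqrt_expansion hu0 hu1 ha0 ha1 r0 r1 r2
  have hvy : v = u * √(1 - 2 * a * u - r) := by
    rw [← abs_of_nonneg hv0, ← abs_of_nonneg (mul_nonneg hu0 (Real.sqrt_nonneg _)),
      ← sq_eq_sq_iff_abs_eq_abs, mul_pow, Real.sq_sqrt hpos, hsq]
  generalize √(1 - 2 * a * u - r) = y at *
  rw [hvy]
  refine ⟨by rw [mul_comm]; gcongr, by gcongr, ?_, ?_⟩
  · calc u * y ≤ u * (1 - a * u) := by gcongr
      _ = _ := by ring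
  · have e1 : u * y - (u - a * u ^ 2 + -a ^ 2 / 2 * u ^ 3) =
      u * (y - (1 - a * u - a ^ 2 / 2 * u ^ 2)) := by ring
    rw [e1, abs_mul, abs_of_nonneg hu0]
    calc _ ≤ u * (10 * u ^ 3) := by gcongr
      _ = _ := by ring

/-! ### The ReLU kernel of one input and of a pair. -/

lemma gaussE_relu_self {a : ℝ} (ha : 0 ≤ a) : gaussE relu a a a = a / 2 := by
  rcases ha.eq_or_lt with rfl | ha
  · simp [gaussE, relu]
  · have h : √(a * a) = a := Real.sqrt_mul_self ha.le
    rw [gaussE_relu ha ha (by rw [h, abs_of_pos ha]), h, div_self ha.ne', Real.arccos_one]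
    have := Real.pi_pos
    simp
    field_simp

lemma varSeq_relu {σw a : ℝ} (hσ : σw ^ 2 = 2) (ha : 0 ≤ a) (l : ℕ) :
    varSeq relu 0 σw a l = a := by
  induction l with
  | zero => rfl
  | succ l ih => rw [varSeq_succ, ih, gaussE_relu_self ha, hσ]; ring

/-- For `a > 0` the variance stays `a` and the derivative factor is 1, so each layer adds `a`. For
`a = 0` everything vanishes, whatever the factor. -/
theorem ntkSeq_relu_self {σw a : ℝ} (hσ : σw ^ 2 = 2) (ha : 0 ≤ a) (l : ℕ) :
    ntkSeq relu 0 σw a a a l = ((l : ℝ) + 1) * a := by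
  induction l with
  | zero => simp [ntkSeq]
  | succ l ih =>
    rw [ntkSeq, ih, covSeq_self, varSeq_relu hσ ha, dotSeq, covSeq_self, varSeq_relu hσ ha, hσ]
    rcases ha.eq_or_lt with rfl | ha
    · simp
    · have h : √(a * a) = a := Real.sqrt_mul_self ha.le
      rw [gaussE_deriv_relu ha ha (by rw [h, abs_of_pos ha]), h, div_self ha.ne', Real.arccos_one]
      have := Real.pi_pos
      push_cast
      field_simp
      ring

lemma covSeq_relu {σw a b p : ℝ} (hσ : σw ^ 2 = 2) (ha : 0 < a) (hb : 0 < b)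
    (hp : |p| ≤ √(a * b)) (l : ℕ) :
    |covSeq relu 0 σw a b p l| ≤ √(a * b) ∧
      covSeq relu 0 σw a b p (l + 1) / √(a * b) =
        arcMap (covSeq relu 0 σw a b p l / √(a * b)) := by
  have hs : 0 < √(a * b) := Real.sqrt_pos.2 (by positivity)
  have key : ∀ l, |covSeq relu 0 σw a b p l| ≤ √(a * b) →
      covSeq relu 0 σw a b p (l + 1) / √(a * b) =
        arcMap (covSeq relu 0 σw a b p l / √(a * b)) := by
    intro l h
    rw [covSeq, varSeq_relu hσ ha.le, varSeq_relu hσ hb.le, gaussE_relu ha hb h, hσ, arcMap,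
      mul_inv]
    field_simp
    ring
  have hb' : ∀ l, |covSeq relu 0 σw a b p l| ≤ √(a * b) := by
    intro l
    induction l with
    | zero => exact hp
    | succ l ih =>
      obtain ⟨h1, h2⟩ := corr_mem ha hb ih
      obtain ⟨h3, h4, -⟩ := arcMap_spec h1 h2
      rw [← key l ih] at h3 h4
      rw [le_div_iff₀ hs] at h3
      rw [div_le_iff₀ hs] at h4
      rw [abs_le]
      constructor <;> linarith
  exact ⟨hb' l, key l (hb' l)⟩

/-- Divide by `√(a b)`. The derivative factor is `1 - θ / π` with `θ / 2 = u + O(u³)`, hence `D = 2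
/ π`, and the defect has quadratic coefficient `2 / (3π)`. The ratio 3 gives the slope `1 / 4`; the
cubic coefficient gives `(a² - b) / a² = 3 / 2`, whence `3 / 8` before the logarithm. -/
theorem ntkSeq_relu_asymptotics {σw ε R : ℝ} (hσ : σw ^ 2 = 2) (hε : 0 < ε) :
    ∃ K ≥ 0, ∀ a b p : ℝ, 0 < a → 0 < b → √(a * b) ≤ R → |p| ≤ √(a * b) →
      p / √(a * b) ≤ 1 - ε → ∀ l : ℕ, |ntkSeq relu 0 σw a b p l -
        √(a * b) * (((l : ℝ) + 1) / 4 + 3 / 8 * Real.log ((l : ℝ) + 1))| ≤ K := by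
  have hpi := Real.pi_gt_three
  obtain ⟨K, hK, h⟩ := kernel_of_defect (κ := 1 / 2) (C := 10) (a := 2 / (3 * Real.pi))
    (a' := 2 / (3 * Real.pi)) (b := -(2 / (3 * Real.pi)) ^ 2 / 2) (D := 2 / Real.pi)
    (ε := √(ε / 2)) (M := 1) (K₀ := 1) (by norm_num) (by norm_num) (by positivity) (by positivity)
    (by positivity) (by norm_num) (by gcongr; linarith)
  refine ⟨|R| * K, by positivity, fun a b p ha hb hR hp hε' l => ?_⟩
  have hs : 0 < √(a * b) := Real.sqrt_pos.2 (by positivity)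
  set s := √(a * b) with hsd
  set c : ℕ → ℝ := fun l => covSeq relu 0 σw a b p l / s with hc
  have hcm : ∀ l, -1 ≤ c l ∧ c l ≤ 1 := fun l => corr_mem ha hb (covSeq_relu hσ ha hb hp l).1
  have hcs : ∀ l, c (l + 1) = arcMap (c l) := fun l => (covSeq_relu hσ ha hb hp l).2
  have hu0 : ∀ l, 0 ≤ arcDefect (c l) := fun l => Real.sqrt_nonneg _
  have hu1 : ∀ l, arcDefect (c l) ≤ 1 := fun l => by
    exact Real.sqrt_le_iff.2 ⟨by norm_num, by linarith [(hcm l).1]⟩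
  have hpert : ∀ l : ℕ, 0 ≤ 1 / ((l : ℝ) + 1) ^ 4 := fun l => by positivity
  have := h (fun l => arcDefect (c l)) (fun l => 1 - Real.arccos (c l) / Real.pi)
    (fun l => c (l + 1)) (fun l => ntkSeq relu 0 σw a b p l / s)
    (by
      apply Real.sqrt_le_sqrt
      have : c 0 ≤ 1 - ε := hε'
      linarith) hu1
    (fun l => by rw [hcs]; exact (arc_step (hcm l).1 (hcm l).2).1)
    (fun l => by
      rw [hcs]
      refine le_trans ?_ (arc_step (hcm l).1 (hcm l).2).2.1
      have h1 := hu0 l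
      have h2 : (0 : ℝ) ≤ 10 / ((l : ℝ) + 1) ^ 4 := by positivity
      apply mul_le_mul_of_nonneg_left _ h1
      linarith)
    (fun l => by
      rw [hcs]
      have h2 : (0 : ℝ) ≤ 10 / ((l : ℝ) + 1) ^ 4 := by positivity
      linarith [(arc_step (hcm l).1 (hcm l).2).2.2.1])
    (fun l => by
      rw [hcs]
      have := (arc_step (hcm l).1 (hcm l).2).2.2.2
      linarith [hpert l])
    (by
      have := hcm 0
      exact abs_le.2 this)
    (fun l => by
      have h1 := (covSeq_relu hσ ha hb hp l).1
      simp only [ntkSeq, dotSeq, varSeq_relu hσ ha.le, varSeq_relu hσ hb.le,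
        gaussE_deriv_relu ha hb h1, hσ, hc, ← hsd]
      field_simp)
    (fun l => by
      have h1 := hcm l
      have h3 := Real.arccos_nonneg (c l)
      have h4 := Real.arccos_le_pi (c l)
      obtain ⟨-, -, b3, b4⟩ := arc_bounds (t := Real.arccos (c l) / 2) (by linarith) (by linarith)
      rw [← arcDefect_eq h1.1 h1.2] at b3 b4
      have e : 1 - Real.arccos (c l) / Real.pi - (1 - 2 / Real.pi * arcDefect (c l)) =
        - (2 / Real.pi * (Real.arccos (c l) / 2 - arcDefect (c l))) := by field_simp; ring
      rw [e, abs_neg, abs_of_nonneg (mul_nonneg (by positivity) (by linarith))]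
      have h5 : 2 / Real.pi ≤ 1 := by rw [div_le_one (by positivity)]; linarith
      have h6 : arcDefect (c l) ^ 3 ≤ arcDefect (c l) ^ 2 :=
        pow_le_pow_of_le_one (hu0 l) (hu1 l) (by norm_num)
      have h7 : 0 ≤ arcDefect (c l) ^ 2 := by positivity
      calc _ ≤ 1 * arcDefect (c l) ^ 2 := by
            gcongr
            · linarith
        _ ≤ _ := by linarith [hpert l])
    (fun l => by
      have h1 := arcDefect_sq (hcm (l + 1)).2
      have h2 := (arc_step (hcm l).1 (hcm l).2).2.2.1
      rw [← hcs] at h2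
      have h3 : 0 ≤ 2 / (3 * Real.pi) * arcDefect (c l) ^ 2 := by positivity
      have h4 : arcDefect (c (l + 1)) ^ 2 ≤ arcDefect (c (l + 1)) := by
        nlinarith [hu0 (l + 1), hu1 (l + 1)]
      rw [abs_le]
      constructor
      · linarith [hpert l, hu0 l]
      · linarith [hpert l, hu0 l, (hcm (l + 1)).2]) l
  have e1 : 2 / Real.pi / (2 / (3 * Real.pi)) = 3 := by field_simp
  have e2 : ((2 / (3 * Real.pi)) ^ 2 - -(2 / (3 * Real.pi)) ^ 2 / 2) / (2 / (3 * Real.pi)) ^ 2 =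
      3 / 2 := by field_simp; norm_num
  rw [e1, e2] at this
  have e3 : ntkSeq relu 0 σw a b p l -
        s * (((l : ℝ) + 1) / 4 + 3 / 8 * Real.log ((l : ℝ) + 1)) =
      s * (ntkSeq relu 0 σw a b p l / s - ((l : ℝ) + 1) / (3 + 1) -
        3 / 2 / (3 + 1) * Real.log ((l : ℝ) + 1)) := by field_simp; ring
  rw [e3, abs_mul, abs_of_pos hs]
  gcongr
  exact hR.trans (le_abs_self _)

/-! ### Polynomials in `tanh` -/

lemma hasDerivAt_tanh (x : ℝ) : HasDerivAt Real.tanh (1 - Real.tanh x ^ 2) x := by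
  have h := (Real.hasDerivAt_sinh x).div (Real.hasDerivAt_cosh x) (Real.cosh_pos x).ne'
  have e : Real.tanh = fun x => Real.sinh x / Real.cosh x := by
    ext y; exact Real.tanh_eq_sinh_div_cosh y
  rw [e]
  refine h.congr_deriv ?_
  have := (Real.cosh_pos x).ne'
  field_simp

lemma continuous_tanh : Continuous Real.tanh :=
  continuous_iff_continuousAt.2 fun x => (hasDerivAt_tanh x).continuousAt

lemma deriv_tanh : deriv Real.tanh = fun x => 1 - Real.tanh x ^ 2 :=
  funext fun x => (hasDerivAt_tanh x).deriv

open Polynomial in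
/-- The polynomial `D P` with `(P ∘ tanh)' = (D P) ∘ tanh`. -/
noncomputable def tanhD (P : ℝ[X]) : ℝ[X] := derivative P * (1 - X ^ 2)

/-- The function `P ∘ tanh`. -/
noncomputable def tanhPoly (P : Polynomial ℝ) (x : ℝ) : ℝ := P.eval (Real.tanh x)

/-- Polynomials in `tanh` form a class of bounded functions closed under products and
differentiation, hence also Lipschitz. Every activation, derivative and integrand of the Tanh case
lies in it, so differentiation under the integral and integration by parts need no growth
conditions. -/
lemma hasDerivAt_tanhPoly (P : Polynomial ℝ) (x : ℝ) :
    HasDerivAt (tanhPoly P) (tanhPoly (tanhD P) x) x := by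
  refine ((P.hasDerivAt (Real.tanh x)).comp x (hasDerivAt_tanh x)).congr_deriv ?_
  simp [tanhPoly, tanhD]

lemma continuous_tanhPoly (P : Polynomial ℝ) : Continuous (tanhPoly P) :=
  P.continuous.comp continuous_tanh

lemma exists_tanhPoly_bound (P : Polynomial ℝ) : ∃ C ≥ 0, ∀ x, |tanhPoly P x| ≤ C := by
  obtain ⟨C, hC⟩ := (isCompact_Icc (a := (-1 : ℝ)) (b := 1)).exists_bound_of_continuousOn
    P.continuous.continuousOn
  refine ⟨C, (norm_nonneg _).trans (hC 0 (by norm_num)), fun x => hC _ ?_⟩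
  exact ⟨(Real.neg_one_lt_tanh x).le, (Real.tanh_lt_one x).le⟩

/-- A bound for `|P ∘ tanh|`. -/
noncomputable def tanhBound (P : Polynomial ℝ) : ℝ := (exists_tanhPoly_bound P).choose

lemma tanhBound_nonneg (P : Polynomial ℝ) : 0 ≤ tanhBound P :=
  (exists_tanhPoly_bound P).choose_spec.1

lemma abs_tanhPoly_le (P : Polynomial ℝ) (x : ℝ) : |tanhPoly P x| ≤ tanhBound P :=
  (exists_tanhPoly_bound P).choose_spec.2 x

lemma tanhPoly_lipschitz (P : Polynomial ℝ) (x y : ℝ) :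
    |tanhPoly P x - tanhPoly P y| ≤ tanhBound (tanhD P) * |x - y| := by
  have := convex_univ.norm_image_sub_le_of_norm_hasDerivWithin_le
    (f := tanhPoly P) (f' := tanhPoly (tanhD P)) (C := tanhBound (tanhD P))
    (fun x _ => (hasDerivAt_tanhPoly P x).hasDerivWithinAt)
    (fun x _ => abs_tanhPoly_le _ x) (Set.mem_univ y) (Set.mem_univ x)
  simpa using this

/-! ### Gaussian integration by parts -/

/-- The standard Gaussian measure. -/
noncomputable abbrev stdG : Measure ℝ := gaussianReal 0 1

lemma integrable_id_stdG : Integrable (fun z : ℝ => z) stdG :=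
  (memLp_id_gaussianReal (μ := 0) (v := 1) 1).integrable le_rfl

lemma integrable_of_bounded {α : Type*} [MeasurableSpace α] {μ : Measure α} [IsFiniteMeasure μ]
    {f : α → ℝ} (hf : AEStronglyMeasurable f μ) {C : ℝ} (h : ∀ x, |f x| ≤ C) : Integrable f μ :=
  Integrable.of_bound hf C (ae_of_all _ h)

lemma integral_abs_id_stdG_le : ∫ z, |z| ∂stdG ≤ 1 := by
  have h2 : Integrable (fun z : ℝ => z ^ 2) stdG :=
    (memLp_id_gaussianReal (μ := 0) (v := 1) 2).integrable_sq
  have hv : ∫ z, z ^ 2 ∂stdG = 1 := by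
    have h := variance_fun_id_gaussianReal (μ := 0) (v := 1)
    rw [variance_of_integral_eq_zero (by fun_prop) (by simp)] at h
    simpa using h
  have h3 : ∫ z, |z| ∂stdG ≤ ∫ z, (z ^ 2 + 1) / 2 ∂stdG := by
    apply integral_mono integrable_id_stdG.abs ((h2.add (integrable_const 1)).div_const 2)
    intro z
    have : 0 ≤ (|z| - 1) ^ 2 := sq_nonneg _
    have h4 : |z| ^ 2 = z ^ 2 := sq_abs z
    simp only [Pi.add_apply]
    linarith [sub_sq |z| 1]
  rw [integral_div, integral_add h2 (integrable_const 1), hv] at h3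
  simpa using h3

lemma hasDerivAt_gaussianPDFReal (x : ℝ) :
    HasDerivAt (gaussianPDFReal 0 1) (-x * gaussianPDFReal 0 1 x) x := by
  have h1 : HasDerivAt (fun x : ℝ => -(x - 0) ^ 2 / (2 * ((1 : NNReal) : ℝ))) (-x) x := by
    have := (((hasDerivAt_id x).sub_const 0).pow 2).neg.div_const (2 * ((1 : NNReal) : ℝ))
    refine this.congr_deriv ?_
    simp
    ring
  have := (h1.exp).const_mul ((√(2 * Real.pi * ((1 : NNReal) : ℝ)))⁻¹)
  refine this.congr_deriv ?_
  rw [gaussianPDFReal]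
  ring

/-- Stein's lemma for bounded functions with bounded derivative. -/
theorem stein {g g' : ℝ → ℝ} (hd : ∀ x, HasDerivAt g (g' x) x) (hc : Continuous g') {C : ℝ}
    (hg : ∀ x, |g x| ≤ C) (hg' : ∀ x, |g' x| ≤ C) :
    ∫ z, z * g z ∂stdG = ∫ z, g' z ∂stdG := by
  have hgc : Continuous g := continuous_iff_continuousAt.2 fun x => (hd x).continuousAt
  have hp : Integrable (gaussianPDFReal 0 1) := integrable_gaussianPDFReal 0 1
  have hxp : Integrable fun x => x * gaussianPDFReal 0 1 x := by
    have := (integrable_mul_exp_neg_mul_sq (b := 1 / 2) (by norm_num)).const_mul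
      ((√(2 * Real.pi * ((1 : NNReal) : ℝ)))⁻¹)
    refine this.congr (ae_of_all _ fun x => ?_)
    simp only [gaussianPDFReal, NNReal.coe_one, mul_one, sub_zero]
    have e : -(1 / 2) * x ^ 2 = -x ^ 2 / 2 := by ring
    rw [e]; ring
  have i1 : Integrable fun x => gaussianPDFReal 0 1 x * g x :=
    hp.mul_bdd hgc.aestronglyMeasurable (ae_of_all _ hg)
  have i2 : Integrable fun x => gaussianPDFReal 0 1 x * g' x :=
    hp.mul_bdd hc.aestronglyMeasurable (ae_of_all _ hg')
  have i3 : Integrable fun x => x * gaussianPDFReal 0 1 x * g x :=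
    hxp.mul_bdd hgc.aestronglyMeasurable (ae_of_all _ hg)
  have key := integral_eq_zero_of_hasDerivAt_of_integrable
    (f := fun x => gaussianPDFReal 0 1 x * g x)
    (f' := fun x => gaussianPDFReal 0 1 x * g' x - x * gaussianPDFReal 0 1 x * g x)
    (fun x => ((hasDerivAt_gaussianPDFReal x).mul (hd x)).congr_deriv (by ring)) (i2.sub i3) i1
  rw [integral_sub i2 i3, sub_eq_zero] at key
  rw [integral_gaussianReal_eq_integral_smul one_ne_zero,
    integral_gaussianReal_eq_integral_smul one_ne_zero]
  simp only [smul_eq_mul]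
  rw [key]
  congr 1; ext x; ring

/-! ### One-dimensional Gaussian expectations -/

/-- `E[P(tanh(s Z))]`. -/
noncomputable def tanhMean (P : Polynomial ℝ) (s : ℝ) : ℝ := ∫ z, tanhPoly P (s * z) ∂stdG

lemma integrable_tanhPoly (P : Polynomial ℝ) (s : ℝ) :
    Integrable (fun z => tanhPoly P (s * z)) stdG :=
  integrable_of_bounded
    ((continuous_tanhPoly P).comp (continuous_const_mul s)).aestronglyMeasurable
    fun _ => abs_tanhPoly_le P _

lemma integrable_mul_tanhPoly (P : Polynomial ℝ) (s : ℝ) :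
    Integrable (fun z => z * tanhPoly P (s * z)) stdG :=
  integrable_id_stdG.mul_bdd
    ((continuous_tanhPoly P).comp (continuous_const_mul s)).aestronglyMeasurable
    (ae_of_all _ fun _ => abs_tanhPoly_le P _)

lemma hasDerivAt_tanhPoly_mul (P : Polynomial ℝ) (s x : ℝ) :
    HasDerivAt (fun z => tanhPoly P (s * z)) (s * tanhPoly (tanhD P) (s * x)) x := by
  refine ((hasDerivAt_tanhPoly P (s * x)).comp x
    ((hasDerivAt_id x).const_mul s)).congr_deriv ?_
  simp [mul_comm]

lemma stein_tanhPoly (P : Polynomial ℝ) (s : ℝ) :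
    ∫ z, z * tanhPoly P (s * z) ∂stdG = s * tanhMean (tanhD P) s := by
  have hc := tanhBound_nonneg P
  have hc' := tanhBound_nonneg (tanhD P)
  rw [stein (hasDerivAt_tanhPoly_mul P s)
    (((continuous_tanhPoly _).comp (continuous_const_mul s)).const_mul s)
    (C := tanhBound P + |s| * tanhBound (tanhD P))
    (fun x => (abs_tanhPoly_le P _).trans (by linarith [mul_nonneg (abs_nonneg s) hc']))
    (fun x => by
      rw [abs_mul]
      have := mul_le_mul_of_nonneg_left (abs_tanhPoly_le (tanhD P) (s * x)) (abs_nonneg s)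
      linarith), integral_const_mul]
  rfl

lemma hasDerivAt_tanhMean (P : Polynomial ℝ) (s : ℝ) :
    HasDerivAt (tanhMean P) (∫ z, z * tanhPoly (tanhD P) (s * z) ∂stdG) s := by
  refine (hasDerivAt_integral_of_dominated_loc_of_deriv_le (s := Set.univ) univ_mem
    (F := fun s z => tanhPoly P (s * z)) (F' := fun s z => z * tanhPoly (tanhD P) (s * z))
    (bound := fun z => |z| * tanhBound (tanhD P))
    (Eventually.of_forall fun s => (integrable_tanhPoly P s).aestronglyMeasurable)
    (integrable_tanhPoly P s) (integrable_mul_tanhPoly _ s).aestronglyMeasurable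
    (ae_of_all _ fun z s _ => ?_) (integrable_id_stdG.abs.mul_const _)
    (ae_of_all _ fun z s _ => ?_)).2
  · rw [Real.norm_eq_abs, abs_mul]
    exact mul_le_mul_of_nonneg_left (abs_tanhPoly_le _ _) (abs_nonneg _)
  · refine ((hasDerivAt_tanhPoly P (s * z)).comp s ((hasDerivAt_id s).mul_const z)).congr_deriv ?_
    simp [mul_comm]

lemma continuous_tanhMean (P : Polynomial ℝ) : Continuous (tanhMean P) :=
  continuous_iff_continuousAt.2 fun s => (hasDerivAt_tanhMean P s).continuousAt

lemma tanhMean_add (P Q : Polynomial ℝ) (s : ℝ) :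
    tanhMean (P + Q) s = tanhMean P s + tanhMean Q s := by
  rw [tanhMean, tanhMean, tanhMean, ← integral_add (integrable_tanhPoly P s)
    (integrable_tanhPoly Q s)]
  simp [tanhPoly]

lemma tanhMean_C_mul (c : ℝ) (P : Polynomial ℝ) (s : ℝ) :
    tanhMean (Polynomial.C c * P) s = c * tanhMean P s := by
  rw [tanhMean, tanhMean, ← integral_const_mul]
  simp [tanhPoly]

lemma tanhMean_nonneg {P : Polynomial ℝ} (h : ∀ t ∈ Set.Icc (-1 : ℝ) 1, 0 ≤ P.eval t) (s : ℝ) :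
    0 ≤ tanhMean P s :=
  integral_nonneg fun _ => h _ ⟨(Real.neg_one_lt_tanh _).le, (Real.tanh_lt_one _).le⟩

lemma tanhMean_lipschitz (P : Polynomial ℝ) (s t : ℝ) :
    |tanhMean P s - tanhMean P t| ≤ tanhBound (tanhD P) * |s - t| := by
  have hb := tanhBound_nonneg (tanhD P)
  rw [tanhMean, tanhMean, ← integral_sub (integrable_tanhPoly P s) (integrable_tanhPoly P t)]
  refine (abs_integral_le_integral_abs).trans ?_
  calc ∫ z, |tanhPoly P (s * z) - tanhPoly P (t * z)| ∂stdG
      ≤ ∫ z, tanhBound (tanhD P) * |s - t| * |z| ∂stdG := by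
        refine integral_mono_of_nonneg (ae_of_all _ fun _ => abs_nonneg _)
          (integrable_id_stdG.abs.const_mul _) (ae_of_all _ fun z => ?_)
        have := tanhPoly_lipschitz P (s * z) (t * z)
        rw [← sub_mul, abs_mul, ← mul_assoc] at this
        exact this
    _ = tanhBound (tanhD P) * |s - t| * ∫ z, |z| ∂stdG := integral_const_mul _ _
    _ ≤ tanhBound (tanhD P) * |s - t| * 1 := by
        gcongr; exact integral_abs_id_stdG_le
    _ = _ := mul_one _

/-- Lebesgue measure is absolutely continuous with respect to the Gaussian one, so a nonempty open
support has positive Gaussian mass. -/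
lemma integral_stdG_pos {f : ℝ → ℝ} (hf : Continuous f) (hi : Integrable f stdG)
    (hnn : ∀ z, 0 ≤ f z) {x : ℝ} (hx : 0 < f x) : 0 < ∫ z, f z ∂stdG := by
  rw [integral_pos_iff_support_of_nonneg hnn hi, pos_iff_ne_zero]
  intro h0
  have h2 := gaussianReal_absolutelyContinuous' 0 (one_ne_zero : (1 : NNReal) ≠ 0) h0
  rw [hf.isOpen_support.measure_eq_zero_iff (μ := volume)] at h2
  have : x ∈ Function.support f := hx.ne'
  rw [h2] at this
  exact this

lemma tanhMean_pos {P : Polynomial ℝ} (h : ∀ t ∈ Set.Icc (-1 : ℝ) 1, 0 ≤ P.eval t) {s x : ℝ}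
    (h1 : 0 < tanhPoly P (s * x)) : 0 < tanhMean P s :=
  integral_stdG_pos ((continuous_tanhPoly P).comp (continuous_const_mul s))
    (integrable_tanhPoly P s)
    (fun _ => h _ ⟨(Real.neg_one_lt_tanh _).le, (Real.tanh_lt_one _).le⟩) h1

/-! ### Gaussian pairs -/

/-- The planar standard Gaussian measure. -/
noncomputable abbrev stdG2 : Measure (ℝ × ℝ) := stdG.prod stdG

/-- `E[P(tanh(s Z₁)) Q(tanh(t (c Z₁ + d Z₂)))]`. -/
noncomputable def pairMean (P Q : Polynomial ℝ) (s t c d : ℝ) : ℝ :=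
  ∫ z : ℝ × ℝ, tanhPoly P (s * z.1) * tanhPoly Q (t * (c * z.1 + d * z.2)) ∂stdG2

lemma continuous_pair (P Q : Polynomial ℝ) (s t c d : ℝ) : Continuous fun z : ℝ × ℝ =>
    tanhPoly P (s * z.1) * tanhPoly Q (t * (c * z.1 + d * z.2)) :=
  ((continuous_tanhPoly P).comp (by fun_prop)).mul ((continuous_tanhPoly Q).comp (by fun_prop))

lemma abs_pair_le (P Q : Polynomial ℝ) (x y : ℝ) :
    |tanhPoly P x * tanhPoly Q y| ≤ tanhBound P * tanhBound Q := by
  rw [abs_mul]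
  exact mul_le_mul (abs_tanhPoly_le _ _) (abs_tanhPoly_le _ _) (abs_nonneg _) (tanhBound_nonneg _)

lemma integrable_pair (P Q : Polynomial ℝ) (s t c d : ℝ) : Integrable (fun z : ℝ × ℝ =>
    tanhPoly P (s * z.1) * tanhPoly Q (t * (c * z.1 + d * z.2))) stdG2 :=
  integrable_of_bounded (continuous_pair P Q s t c d).aestronglyMeasurable
    fun _ => abs_pair_le P Q _ _

lemma integrable_fst_stdG2 : Integrable (fun z : ℝ × ℝ => z.1) stdG2 :=
  integrable_id_stdG.comp_fst _

lemma integrable_snd_stdG2 : Integrable (fun z : ℝ × ℝ => z.2) stdG2 :=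
  integrable_id_stdG.comp_snd _

lemma integrable_fst_mul_pair (P Q : Polynomial ℝ) (s t c d : ℝ) : Integrable (fun z : ℝ × ℝ =>
    z.1 * (tanhPoly P (s * z.1) * tanhPoly Q (t * (c * z.1 + d * z.2)))) stdG2 :=
  integrable_fst_stdG2.mul_bdd (continuous_pair P Q s t c d).aestronglyMeasurable
    (ae_of_all _ fun _ => abs_pair_le P Q _ _)

lemma integrable_snd_mul_pair (P Q : Polynomial ℝ) (s t c d : ℝ) : Integrable (fun z : ℝ × ℝ =>
    z.2 * (tanhPoly P (s * z.1) * tanhPoly Q (t * (c * z.1 + d * z.2)))) stdG2 :=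
  integrable_snd_stdG2.mul_bdd (continuous_pair P Q s t c d).aestronglyMeasurable
    (ae_of_all _ fun _ => abs_pair_le P Q _ _)

/-- One-dimensional Stein with the second coordinate frozen; both factors depend on the first
coordinate, hence the two terms. -/
lemma stein_fst (P Q : Polynomial ℝ) (s t c d : ℝ) :
    ∫ z : ℝ × ℝ, z.1 * (tanhPoly P (s * z.1) * tanhPoly Q (t * (c * z.1 + d * z.2))) ∂stdG2 =
      s * pairMean (tanhD P) Q s t c d + t * c * pairMean P (tanhD Q) s t c d := by
  have i1 := (integrable_pair (tanhD P) Q s t c d).const_mul s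
  have i2 := (integrable_pair P (tanhD Q) s t c d).const_mul (t * c)
  have i3 : Integrable (fun z : ℝ × ℝ =>
      s * (tanhPoly (tanhD P) (s * z.1) * tanhPoly Q (t * (c * z.1 + d * z.2))) +
      t * c * (tanhPoly P (s * z.1) * tanhPoly (tanhD Q) (t * (c * z.1 + d * z.2)))) stdG2 :=
    i1.add i2
  rw [pairMean, pairMean, ← integral_const_mul, ← integral_const_mul, ← integral_add i1 i2,
    integral_prod_symm _ (integrable_fst_mul_pair P Q s t c d), integral_prod_symm _ i3]
  congr 1; ext y
  refine stein (C := tanhBound P * tanhBound Q + (|s| * (tanhBound (tanhD P) * tanhBound Q) +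
    |t * c| * (tanhBound P * tanhBound (tanhD Q)))) (fun x => ?_) ?_ (fun x => ?_) fun x => ?_
  · have h1 := hasDerivAt_tanhPoly_mul P s x
    have h2 : HasDerivAt (fun x : ℝ => t * (c * x + d * y)) (t * c) x := by
      simpa using (((hasDerivAt_id x).const_mul c).add_const (d * y)).const_mul t
    refine (h1.mul ((hasDerivAt_tanhPoly Q _).comp x h2)).congr_deriv ?_
    simp only [Function.comp_apply]
    ring
  · exact (((continuous_pair (tanhD P) Q s t c d).const_mul s).add
      ((continuous_pair P (tanhD Q) s t c d).const_mul (t * c))).comp (by fun_prop : Continuous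
        fun x : ℝ => (x, y))
  · refine (abs_pair_le P Q _ _).trans (le_add_of_nonneg_right ?_)
    have := tanhBound_nonneg P
    have := tanhBound_nonneg Q
    have := tanhBound_nonneg (tanhD P)
    have := tanhBound_nonneg (tanhD Q)
    positivity
  · have h0 := mul_nonneg (tanhBound_nonneg P) (tanhBound_nonneg Q)
    refine (abs_add_le _ _).trans ?_
    rw [abs_mul s, abs_mul (t * c)]
    have h1 := mul_le_mul_of_nonneg_left (abs_pair_le (tanhD P) Q (s * x) (t * (c * x + d * y)))
      (abs_nonneg s)
    have h2 := mul_le_mul_of_nonneg_left (abs_pair_le P (tanhD Q) (s * x) (t * (c * x + d * y)))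
      (abs_nonneg (t * c))
    linarith

lemma stein_snd (P Q : Polynomial ℝ) (s t c d : ℝ) :
    ∫ z : ℝ × ℝ, z.2 * (tanhPoly P (s * z.1) * tanhPoly Q (t * (c * z.1 + d * z.2))) ∂stdG2 =
      t * d * pairMean P (tanhD Q) s t c d := by
  have i2 := (integrable_pair P (tanhD Q) s t c d).const_mul (t * d)
  rw [pairMean, ← integral_const_mul,
    integral_prod _ (integrable_snd_mul_pair P Q s t c d), integral_prod _ i2]
  congr 1; ext x
  have hP := tanhBound_nonneg P
  have hQ := tanhBound_nonneg Q
  have hQ' := tanhBound_nonneg (tanhD Q)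
  refine stein (C := tanhBound P * tanhBound Q + |t * d| * (tanhBound P * tanhBound (tanhD Q)))
    (fun y => ?_) ?_ (fun y => ?_) fun y => ?_
  · have h2 : HasDerivAt (fun y : ℝ => t * (c * x + d * y)) (t * d) y := by
      simpa using (((hasDerivAt_id y).const_mul d).const_add (c * x)).const_mul t
    refine (((hasDerivAt_tanhPoly Q _).comp y h2).const_mul (tanhPoly P (s * x))).congr_deriv ?_
    ring
  · exact ((continuous_pair P (tanhD Q) s t c d).const_mul (t * d)).comp (by fun_prop : Continuous
        fun y : ℝ => (x, y))
  · exact (abs_pair_le P Q _ _).trans (le_add_of_nonneg_right (by positivity))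
  · rw [abs_mul (t * d)]
    have h2 := mul_le_mul_of_nonneg_left (abs_pair_le P (tanhD Q) (s * x) (t * (c * x + d * y)))
      (abs_nonneg (t * d))
    linarith [mul_nonneg hP hQ]

/-- Rotating the second variable. -/
lemma hasDerivAt_pairMean (P Q : Polynomial ℝ) (s t θ : ℝ) :
    HasDerivAt (fun θ => pairMean P Q s t (Real.cos θ) (Real.sin θ))
      (-Real.sin θ * (s * t * pairMean (tanhD P) (tanhD Q) s t (Real.cos θ) (Real.sin θ))) θ := by
  set F' : ℝ → ℝ × ℝ → ℝ := fun θ z =>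
    -(t * Real.sin θ) * (z.1 * (tanhPoly P (s * z.1) *
      tanhPoly (tanhD Q) (t * (Real.cos θ * z.1 + Real.sin θ * z.2)))) +
    t * Real.cos θ * (z.2 * (tanhPoly P (s * z.1) *
      tanhPoly (tanhD Q) (t * (Real.cos θ * z.1 + Real.sin θ * z.2)))) with hF'
  have i1 := fun θ => (integrable_fst_mul_pair P (tanhD Q) s t (Real.cos θ)
    (Real.sin θ)).const_mul (-(t * Real.sin θ))
  have i2 := fun θ => (integrable_snd_mul_pair P (tanhD Q) s t (Real.cos θ)
    (Real.sin θ)).const_mul (t * Real.cos θ)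
  set B := tanhBound P * tanhBound (tanhD Q) with hB
  have hB0 : 0 ≤ B := mul_nonneg (tanhBound_nonneg _) (tanhBound_nonneg _)
  have h := (hasDerivAt_integral_of_dominated_loc_of_deriv_le (μ := stdG2) (s := Set.univ)
    (x₀ := θ) univ_mem
    (F := fun θ z => tanhPoly P (s * z.1) *
      tanhPoly Q (t * (Real.cos θ * z.1 + Real.sin θ * z.2))) (F' := F')
    (bound := fun z => |t| * (|z.1| * B) + |t| * (|z.2| * B))
    (Eventually.of_forall fun θ => (integrable_pair P Q s t _ _).aestronglyMeasurable)
    (integrable_pair P Q s t _ _) ((i1 θ).add (i2 θ)).aestronglyMeasurable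
    (ae_of_all _ fun z θ _ => ?_)
    (((integrable_fst_stdG2.abs.mul_const B).const_mul _).add
      ((integrable_snd_stdG2.abs.mul_const B).const_mul _))
    (ae_of_all _ fun z θ _ => ?_)).2
  -- The two Stein identities produce the expectation of `P` against the second derivative of `Q`
  -- with opposite coefficients `∓ t² sin θ cos θ`. Only the term with one derivative on each factor
  -- survives.
  · refine h.congr_deriv ?_
    rw [hF', integral_add (i1 θ) (i2 θ), integral_const_mul, integral_const_mul, stein_fst,
      stein_snd]
    ring
  · rw [Real.norm_eq_abs, hF']
    refine (abs_add_le _ _).trans ?_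
    have h0 := abs_pair_le P (tanhD Q) (s * z.1) (t * (Real.cos θ * z.1 + Real.sin θ * z.2))
    rw [abs_mul, abs_mul z.1, abs_mul _ (z.2 * _), abs_mul z.2, abs_neg, abs_mul t, abs_mul t]
    have hs := Real.abs_sin_le_one θ
    have hc := Real.abs_cos_le_one θ
    have a1 : |t| * |Real.sin θ| ≤ |t| := mul_le_of_le_one_right (abs_nonneg _) hs
    have a2 : |t| * |Real.cos θ| ≤ |t| := mul_le_of_le_one_right (abs_nonneg _) hc
    gcongr
  · have h2 : HasDerivAt (fun θ : ℝ => t * (Real.cos θ * z.1 + Real.sin θ * z.2))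
        (t * (-Real.sin θ * z.1 + Real.cos θ * z.2)) θ :=
      (((Real.hasDerivAt_cos θ).mul_const z.1).add
        ((Real.hasDerivAt_sin θ).mul_const z.2)).const_mul t
    refine (((hasDerivAt_tanhPoly Q _).comp θ h2).const_mul (tanhPoly P (s * z.1))).congr_deriv ?_
    rw [hF']; ring

/-- `E[P(tanh(s Z₁)) Q(tanh(t Z_c))]` for a standard Gaussian pair `(Z₁, Z_c)` with
correlation `c`. -/
noncomputable def corrMean (P Q : Polynomial ℝ) (s t c : ℝ) : ℝ := pairMean P Q s t c (√(1 - c ^ 2))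

lemma corrMean_eq (P Q : Polynomial ℝ) (s t : ℝ) {c : ℝ} (h1 : -1 ≤ c) (h2 : c ≤ 1) :
    corrMean P Q s t c =
      pairMean P Q s t (Real.cos (Real.arccos c)) (Real.sin (Real.arccos c)) := by
  rw [Real.cos_arccos h1 h2, Real.sin_arccos, corrMean]

/-- The angle removes the singularity of `√(1 - c²)` at the end points: in `θ` the expectation is
differentiable everywhere, and `arccos` is continuous. -/
lemma continuousOn_corrMean (P Q : Polynomial ℝ) (s t : ℝ) :
    ContinuousOn (corrMean P Q s t) (Set.Icc (-1) 1) := by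
  have h : Continuous fun θ => pairMean P Q s t (Real.cos θ) (Real.sin θ) :=
    continuous_iff_continuousAt.2 fun θ => (hasDerivAt_pairMean P Q s t θ).continuousAt
  exact (h.comp Real.continuous_arccos).continuousOn.congr fun c hc => corrMean_eq P Q s t hc.1 hc.2

/-- Price's theorem: differentiating in the correlation puts one derivative on each factor. It
follows from the rotation formula, the factor `sin θ` cancelling the derivative of `arccos`. -/
lemma hasDerivAt_corrMean (P Q : Polynomial ℝ) (s t : ℝ) {c : ℝ} (h1 : -1 < c) (h2 : c < 1) :
    HasDerivAt (corrMean P Q s t) (s * t * corrMean (tanhD P) (tanhD Q) s t c) c := by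
  have h := (hasDerivAt_pairMean P Q s t (Real.arccos c)).comp c
    (Real.hasDerivAt_arccos h1.ne' h2.ne)
  rw [← corrMean_eq _ _ s t h1.le h2.le, Real.sin_arccos] at h
  have hs : 0 < √(1 - c ^ 2) := Real.sqrt_pos.2 (by nlinarith)
  have h3 : HasDerivAt ((fun θ => pairMean P Q s t (Real.cos θ) (Real.sin θ)) ∘ Real.arccos)
      (s * t * corrMean (tanhD P) (tanhD Q) s t c) c := by
    refine h.congr_deriv ?_
    field_simp
  refine h3.congr_of_eventuallyEq ?_
  filter_upwards [Ioo_mem_nhds h1 h2] with y hy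
  exact corrMean_eq P Q s t hy.1.le hy.2.le

lemma exists_corrMean_slope (P Q : Polynomial ℝ) (s t : ℝ) {c : ℝ} (h1 : -1 ≤ c) (h2 : c < 1) :
    ∃ ξ ∈ Set.Ioo c 1, corrMean P Q s t 1 - corrMean P Q s t c =
      (1 - c) * (s * t * corrMean (tanhD P) (tanhD Q) s t ξ) := by
  obtain ⟨ξ, hξ, h⟩ := exists_hasDerivAt_eq_slope (corrMean P Q s t)
    (fun c => s * t * corrMean (tanhD P) (tanhD Q) s t c) h2
    ((continuousOn_corrMean P Q s t).mono (Set.Icc_subset_Icc_left h1))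
    (fun x hx => hasDerivAt_corrMean P Q s t (by linarith [hx.1]) hx.2)
  refine ⟨ξ, hξ, ?_⟩
  rw [h]
  have : 1 - c ≠ 0 := by linarith
  field_simp

lemma corrMean_one (P Q : Polynomial ℝ) (s : ℝ) : corrMean P Q s s 1 = tanhMean (P * Q) s := by
  have e : corrMean P Q s s 1 = ∫ z : ℝ × ℝ, tanhPoly (P * Q) (s * z.1) ∂stdG2 := by
    simp [corrMean, pairMean, tanhPoly]
  rw [e, integral_fun_fst (fun z => tanhPoly (P * Q) (s * z))]
  simp [tanhMean]

lemma corrMean_right_one (P : Polynomial ℝ) (s t c : ℝ) : corrMean P 1 s t c = tanhMean P s := by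
  have e : corrMean P 1 s t c = ∫ z : ℝ × ℝ, tanhPoly P (s * z.1) ∂stdG2 := by
    simp [corrMean, pairMean, tanhPoly]
  rw [e, integral_fun_fst (fun z => tanhPoly P (s * z))]
  simp [tanhMean]

/-- The second variable is standard normal whatever `c`. Instead of a change of variables: `tanhD 1
= 0`, so the slope in `c` vanishes, and the value at `c = 1` is explicit. -/
lemma corrMean_left_one (Q : Polynomial ℝ) (s t : ℝ) {c : ℝ} (h1 : -1 ≤ c) (h2 : c ≤ 1) :
    corrMean 1 Q s t c = tanhMean Q t := by
  have h : corrMean 1 Q s t 1 = tanhMean Q t := by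
    rw [← one_mul Q, ← corrMean_one]; simp [corrMean, pairMean, tanhPoly]
  rcases h2.eq_or_lt with rfl | h2
  · exact h
  · obtain ⟨ξ, -, e⟩ := exists_corrMean_slope 1 Q s t h1 h2
    have : corrMean (tanhD 1) (tanhD Q) s t ξ = 0 := by
      simp [corrMean, pairMean, tanhPoly, tanhD]
    rw [this, h] at e
    linarith

/-- The arithmetic-geometric form of the Cauchy-Schwarz inequality. -/
lemma abs_corrMean_le_sq (P : Polynomial ℝ) (s t : ℝ) {c τ : ℝ} (h1 : -1 ≤ c) (h2 : c ≤ 1)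
    (hτ : 0 < τ) : |corrMean P P s t c| ≤
      (τ * tanhMean (P ^ 2) s + τ⁻¹ * tanhMean (P ^ 2) t) / 2 := by
  have e1 := corrMean_right_one (P ^ 2) s t c
  have e2 := corrMean_left_one (P ^ 2) s t h1 h2
  rw [← e1, ← e2]
  refine (abs_integral_le_integral_abs).trans ?_
  rw [corrMean, corrMean, pairMean, pairMean, ← integral_const_mul, ← integral_const_mul,
    ← integral_add ((integrable_pair _ _ _ _ _ _).const_mul _)
      ((integrable_pair _ _ _ _ _ _).const_mul _), ← integral_div]
  refine integral_mono (integrable_pair P P s t _ _).abs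
    ((((integrable_pair _ _ _ _ _ _).const_mul _).add
      ((integrable_pair _ _ _ _ _ _).const_mul _)).div_const 2) fun z => ?_
  simp only [tanhPoly, Polynomial.eval_pow, Polynomial.eval_one, one_mul, mul_one]
  generalize Polynomial.eval _ P = x
  generalize Polynomial.eval _ P = y
  rw [abs_mul]
  have h3 : 0 ≤ τ * (|x| - τ⁻¹ * |y|) ^ 2 := by positivity
  have h4 : τ * (|x| - τ⁻¹ * |y|) ^ 2 = τ * |x| ^ 2 + τ⁻¹ * |y| ^ 2 - 2 * (|x| * |y|) := by
    field_simp; ring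
  rw [sq_abs, sq_abs] at h4
  linarith

lemma corrMean_lipschitz (P Q : Polynomial ℝ) : ∃ C ≥ 0, ∀ s t s' t' c : ℝ, -1 ≤ c → c ≤ 1 →
    |corrMean P Q s t c - corrMean P Q s' t' c| ≤ C * (|s - s'| + |t - t'|) := by
  have hP := tanhBound_nonneg P
  have hQ := tanhBound_nonneg Q
  have hP' := tanhBound_nonneg (tanhD P)
  have hQ' := tanhBound_nonneg (tanhD Q)
  set A := tanhBound (tanhD P) * tanhBound Q with hA
  set B := tanhBound P * tanhBound (tanhD Q) with hB
  refine ⟨A + 2 * B, by positivity, fun s t s' t' c h1 h2 => ?_⟩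
  rw [corrMean, corrMean, pairMean, pairMean, ← integral_sub (integrable_pair _ _ _ _ _ _)
    (integrable_pair _ _ _ _ _ _)]
  refine (abs_integral_le_integral_abs).trans ?_
  have hd : √(1 - c ^ 2) ≤ 1 := Real.sqrt_le_iff.2 ⟨by norm_num, by nlinarith [sq_nonneg c]⟩
  have hd0 : 0 ≤ √(1 - c ^ 2) := Real.sqrt_nonneg _
  have hc : |c| ≤ 1 := abs_le.2 ⟨h1, h2⟩
  have i1 := integrable_fst_stdG2.abs
  have i2 := integrable_snd_stdG2.abs
  have m1 : ∫ z : ℝ × ℝ, |z.1| ∂stdG2 ≤ 1 := by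
    rw [integral_fun_fst (fun z : ℝ => |z|)]; simpa using integral_abs_id_stdG_le
  have m2 : ∫ z : ℝ × ℝ, |z.2| ∂stdG2 ≤ 1 := by
    rw [integral_fun_snd (fun z : ℝ => |z|)]; simpa using integral_abs_id_stdG_le
  have i3 : Integrable (fun z : ℝ × ℝ => A * |s - s'| * |z.1| + B * |t - t'| * (|z.1| + |z.2|))
    stdG2 := (i1.const_mul _).add ((i1.add i2).const_mul _)
  refine (integral_mono_of_nonneg (ae_of_all _ fun z => abs_nonneg _) i3
    (ae_of_all _ fun z => ?_)).trans ?_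
  · simp only
    set w := c * z.1 + √(1 - c ^ 2) * z.2 with hw
    have hwb : |w| ≤ |z.1| + |z.2| := by
      refine (abs_add_le _ _).trans ?_
      rw [abs_mul, abs_mul, abs_of_nonneg hd0]
      exact add_le_add (mul_le_of_le_one_left (abs_nonneg _) hc)
        (mul_le_of_le_one_left (abs_nonneg _) hd)
    have e : tanhPoly P (s * z.1) * tanhPoly Q (t * w) -
        tanhPoly P (s' * z.1) * tanhPoly Q (t' * w) =
      (tanhPoly P (s * z.1) - tanhPoly P (s' * z.1)) * tanhPoly Q (t * w) +
        tanhPoly P (s' * z.1) * (tanhPoly Q (t * w) - tanhPoly Q (t' * w)) := by ring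
    rw [e]
    refine (abs_add_le _ _).trans ?_
    rw [abs_mul, abs_mul (tanhPoly P _)]
    have l1 := tanhPoly_lipschitz P (s * z.1) (s' * z.1)
    have l2 := tanhPoly_lipschitz Q (t * w) (t' * w)
    rw [← sub_mul, abs_mul] at l1 l2
    calc _ ≤ tanhBound (tanhD P) * (|s - s'| * |z.1|) * tanhBound Q +
          tanhBound P * (tanhBound (tanhD Q) * (|t - t'| * |w|)) := by
          gcongr
          · exact abs_tanhPoly_le _ _
          · exact abs_tanhPoly_le _ _
      _ ≤ tanhBound (tanhD P) * (|s - s'| * |z.1|) * tanhBound Q +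
          tanhBound P * (tanhBound (tanhD Q) * (|t - t'| * (|z.1| + |z.2|))) := by gcongr
      _ = _ := by rw [hA, hB]; ring
  · have i4 : Integrable (fun z : ℝ × ℝ => |z.1| + |z.2|) stdG2 := i1.add i2
    rw [integral_add (i1.const_mul _) (i4.const_mul _), integral_const_mul,
      integral_const_mul, integral_add i1 i2]
    calc _ ≤ A * |s - s'| * 1 + B * |t - t'| * (1 + 1) := by gcongr
      _ ≤ _ := by
        have := abs_nonneg (s - s')
        have := abs_nonneg (t - t')
        have f1 : 0 ≤ A * |t - t'| := by positivity
        have f2 : 0 ≤ B * |s - s'| := by positivity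
        linarith

lemma gaussE_tanhPoly (P : Polynomial ℝ) (a b p : ℝ) :
    gaussE (tanhPoly P) a b p = corrMean P P √a √b (p / √(a * b)) := rfl

/-! ### The variance recursion of Tanh networks -/

open Polynomial in
lemma tanhPoly_X : tanhPoly (X : ℝ[X]) = Real.tanh := by
  ext x; simp [tanhPoly]

open Polynomial in
lemma tanhD_X : tanhD (X : ℝ[X]) = 1 - X ^ 2 := by simp [tanhD]

open Polynomial in
lemma deriv_tanh_eq_tanhPoly : deriv Real.tanh = tanhPoly (tanhD (X : ℝ[X])) := by
  rw [deriv_tanh]; ext x; simp [tanhPoly, tanhD]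

lemma tanh_pos {x : ℝ} (hx : 0 < x) : 0 < Real.tanh x := by
  rw [Real.tanh_eq_sinh_div_cosh]
  exact div_pos (Real.sinh_pos_iff.2 hx) (Real.cosh_pos x)

lemma tanh_strictMono : StrictMono Real.tanh :=
  strictMono_of_hasDerivAt_pos hasDerivAt_tanh fun x => by linarith [Real.tanh_sq_lt_one x]

/-- The difference of the two sides has derivative `2 x tanh x (1 - tanh² x)`, positive for `x > 0`.
It makes `tanh x / x` decrease and the Poincaré gap increase. -/
lemma mul_deriv_lt_tanh {x : ℝ} (hx : 0 < x) : x * (1 - Real.tanh x ^ 2) < Real.tanh x := by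
  have hd : ∀ y : ℝ, HasDerivAt (fun x => Real.tanh x - x * (1 - Real.tanh x ^ 2))
      (2 * y * Real.tanh y * (1 - Real.tanh y ^ 2)) y := fun y => by
    refine ((hasDerivAt_tanh y).sub ((hasDerivAt_id y).mul
      (((hasDerivAt_tanh y).pow 2).const_sub 1))).congr_deriv ?_
    simp; ring
  have hm : StrictMonoOn (fun x => Real.tanh x - x * (1 - Real.tanh x ^ 2)) (Set.Ici 0) := by
    refine strictMonoOn_of_hasDerivWithinAt_pos (convex_Ici 0)
      (fun y _ => (hd y).continuousAt.continuousWithinAt)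
      (fun y _ => (hd y).hasDerivWithinAt) fun y hy => ?_
    rw [interior_Ici] at hy
    have h1 : 0 < y := hy
    have h2 := tanh_pos h1
    have h3 : 0 < 1 - Real.tanh y ^ 2 := by linarith [Real.tanh_sq_lt_one y]
    positivity
  have := hm Set.self_mem_Ici hx.le hx
  simp at this
  linarith

lemma tanh_mul_sub_nonneg (x : ℝ) :
    0 ≤ Real.tanh x * (Real.tanh x - x * (1 - Real.tanh x ^ 2)) := by
  rcases lt_trichotomy x 0 with h | rfl | h
  · have h1 := mul_deriv_lt_tanh (neg_pos.2 h)
    have h2 := tanh_pos (neg_pos.2 h)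
    rw [Real.tanh_neg] at h1 h2
    apply mul_nonneg_of_nonpos_of_nonpos <;> linarith
  · simp
  · exact mul_nonneg (tanh_pos h).le (by linarith [mul_deriv_lt_tanh h])

lemma tanh_div_antitone {x y : ℝ} (hx : 0 < x) (hxy : x ≤ y) :
    Real.tanh y / y ≤ Real.tanh x / x := by
  have hm : AntitoneOn (fun x => Real.tanh x / x) (Set.Ioi 0) := by
    have hd : ∀ y : ℝ, 0 < y → HasDerivAt (fun x => Real.tanh x / x)
        (((1 - Real.tanh y ^ 2) * y - Real.tanh y * 1) / y ^ 2) y := fun y hy =>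
      (hasDerivAt_tanh y).div (hasDerivAt_id y) hy.ne'
    refine antitoneOn_of_hasDerivWithinAt_nonpos (convex_Ioi 0)
      (f' := fun y => ((1 - Real.tanh y ^ 2) * y - Real.tanh y * 1) / y ^ 2)
      (fun y hy => (hd y hy).continuousAt.continuousWithinAt)
      (fun y hy => ?_) fun y hy => ?_
    · rw [interior_Ioi] at hy
      exact (hd y hy).hasDerivWithinAt
    · rw [interior_Ioi] at hy
      exact div_nonpos_of_nonpos_of_nonneg (by linarith [mul_deriv_lt_tanh hy]) (sq_nonneg y)
  exact hm hx (hx.trans_le hxy) hxy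

lemma tanh_sq_abs (x : ℝ) : Real.tanh x ^ 2 = Real.tanh |x| ^ 2 := by
  rcases abs_choice x with h | h <;> rw [h]
  rw [Real.tanh_neg, neg_sq]

lemma tanh_sq_mul_le {s t : ℝ} (hs : 0 < s) (hst : s ≤ t) (z : ℝ) :
    Real.tanh (t * z) ^ 2 ≤ (t / s) ^ 2 * Real.tanh (s * z) ^ 2 := by
  have ht : 0 < t := hs.trans_le hst
  rw [tanh_sq_abs, tanh_sq_abs (s * z), abs_mul, abs_mul, abs_of_pos hs, abs_of_pos ht]
  rcases (abs_nonneg z).eq_or_lt with h | h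
  · simp [← h]
  · generalize |z| = y at *
    have h1 := tanh_div_antitone (mul_pos hs h) (mul_le_mul_of_nonneg_right hst h.le)
    rw [div_le_div_iff₀ (by positivity) (by positivity)] at h1
    have h2 : Real.tanh (t * y) ≤ t / s * Real.tanh (s * y) := by
      rw [div_mul_eq_mul_div, le_div_iff₀ hs]
      nlinarith
    rw [← mul_pow]
    have := tanh_pos (mul_pos ht h)
    gcongr

lemma tanh_sq_mono {s t : ℝ} (hs : 0 ≤ s) (hst : s ≤ t) (z : ℝ) :
    Real.tanh (s * z) ^ 2 ≤ Real.tanh (t * z) ^ 2 := by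
  have ht : 0 ≤ t := hs.trans hst
  rw [tanh_sq_abs, tanh_sq_abs (t * z), abs_mul, abs_mul, abs_of_nonneg hs, abs_of_nonneg ht]
  have h0 : 0 ≤ Real.tanh (s * |z|) := by
    rw [← Real.tanh_zero]
    exact tanh_strictMono.monotone (by positivity)
  have := tanh_strictMono.monotone (mul_le_mul_of_nonneg_right hst (abs_nonneg z))
  gcongr

open Polynomial in
lemma tanhMean_X_sq (s : ℝ) : tanhMean (X ^ 2) s = ∫ z, Real.tanh (s * z) ^ 2 ∂stdG := by
  simp [tanhMean, tanhPoly]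

open Polynomial in
lemma integrable_tanh_sq (s : ℝ) : Integrable (fun z => Real.tanh (s * z) ^ 2) stdG := by
  have := integrable_tanhPoly (X ^ 2) s
  simpa [tanhPoly] using this

open Polynomial in
lemma tanhMean_X_sq_mono {s t : ℝ} (hs : 0 ≤ s) (hst : s ≤ t) :
    tanhMean (X ^ 2) s ≤ tanhMean (X ^ 2) t := by
  rw [tanhMean_X_sq, tanhMean_X_sq]
  exact integral_mono (integrable_tanh_sq s) (integrable_tanh_sq t) (tanh_sq_mono hs hst)

open Polynomial in
-- Since `tanh x / x` decreases on the positive axis, so does `E[tanh(sZ)²] / s²`. This sublinearity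
-- of the variance map is the source of its contraction.
lemma tanhMean_X_sq_le {s t : ℝ} (hs : 0 < s) (hst : s ≤ t) :
    tanhMean (X ^ 2) t ≤ (t / s) ^ 2 * tanhMean (X ^ 2) s := by
  rw [tanhMean_X_sq, tanhMean_X_sq, ← integral_const_mul]
  exact integral_mono (integrable_tanh_sq t) ((integrable_tanh_sq s).const_mul _)
    (tanh_sq_mul_le hs hst)

open Polynomial in
/-- The Poincaré gap `s² E[tanh'(sZ)²] - E[tanh(sZ)²]`. -/
noncomputable def poincareGap (s : ℝ) : ℝ :=
  s ^ 2 * tanhMean (tanhD X ^ 2) s - tanhMean (X ^ 2) s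

open Polynomial in
-- Applying Stein only to the derivative of `E[tanh(sZ)²]` makes the derivative of the gap the
-- integral of `4 s tanh' · tanh · (tanh - sz tanh')` at `sz`, which is pointwise nonnegative for `s
-- > 0`. Strictness yields a positive bias on the Edge of Chaos, and later the sign of the diagonal
-- error.
theorem poincareGap_strictMonoOn : StrictMonoOn poincareGap (Set.Ici 0) := by
  have hd : ∀ s : ℝ, HasDerivAt poincareGap
      (∫ z, 4 * s * ((1 - Real.tanh (s * z) ^ 2) * (Real.tanh (s * z) *
        (Real.tanh (s * z) - s * z * (1 - Real.tanh (s * z) ^ 2)))) ∂stdG) s ∧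
      Integrable (fun z => 4 * s * ((1 - Real.tanh (s * z) ^ 2) * (Real.tanh (s * z) *
        (Real.tanh (s * z) - s * z * (1 - Real.tanh (s * z) ^ 2))))) stdG := fun s => by
    have h := ((hasDerivAt_pow 2 s).mul (hasDerivAt_tanhMean (tanhD X ^ 2) s)).sub
      (hasDerivAt_tanhMean (X ^ 2) s)
    have i1 := (integrable_tanhPoly (tanhD X ^ 2) s).const_mul (2 * s)
    have i2 := (integrable_mul_tanhPoly (tanhD (tanhD X ^ 2)) s).const_mul (s ^ 2)
    have i3 := (integrable_tanhPoly (tanhD (tanhD (X ^ 2))) s).const_mul s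
    have e : (fun z => 4 * s * ((1 - Real.tanh (s * z) ^ 2) * (Real.tanh (s * z) *
        (Real.tanh (s * z) - s * z * (1 - Real.tanh (s * z) ^ 2))))) =
        fun z => 2 * s * tanhPoly (tanhD X ^ 2) (s * z) +
          s ^ 2 * (z * tanhPoly (tanhD (tanhD X ^ 2)) (s * z)) -
          s * tanhPoly (tanhD (tanhD (X ^ 2))) (s * z) := by
      ext z
      simp [tanhPoly, tanhD, derivative_pow]
      ring
    have i4 : Integrable (fun z => 2 * s * tanhPoly (tanhD X ^ 2) (s * z) +
          s ^ 2 * (z * tanhPoly (tanhD (tanhD X ^ 2)) (s * z))) stdG := i1.add i2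
    refine ⟨h.congr_deriv ?_, ?_⟩
    · rw [e, integral_sub i4 i3, integral_add i1 i2, integral_const_mul, integral_const_mul,
        integral_const_mul, stein_tanhPoly (tanhD (X ^ 2))]
      simp [tanhMean]
    · rw [e]; exact i4.sub i3
  refine strictMonoOn_of_hasDerivWithinAt_pos (convex_Ici 0)
    (fun s _ => (hd s).1.continuousAt.continuousWithinAt)
    (fun s _ => (hd s).1.hasDerivWithinAt) fun s hs => ?_
  rw [interior_Ici] at hs
  have hs : 0 < s := hs
  refine integral_stdG_pos ?_ (hd s).2 (fun z => ?_) (x := 1) ?_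
  · have := continuous_tanh
    fun_prop
  · have h3 : 0 < 1 - Real.tanh (s * z) ^ 2 := by linarith [Real.tanh_sq_lt_one (s * z)]
    have := tanh_mul_sub_nonneg (s * z)
    positivity
  · have h3 : 0 < 1 - Real.tanh (s * 1) ^ 2 := by linarith [Real.tanh_sq_lt_one (s * 1)]
    have h1 : 0 < s * 1 := by linarith
    have h2 : 0 < Real.tanh (s * 1) - s * 1 * (1 - Real.tanh (s * 1) ^ 2) := by
      linarith [mul_deriv_lt_tanh h1]
    have := tanh_pos h1
    positivity

open Polynomial in
/-- The analytic content of the Edge of Chaos for Tanh networks. -/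
structure TanhEOC (σb σw q : ℝ) : Prop where
  bias : 0 < σb ^ 2
  pos : 0 < q
  fixed : σb ^ 2 + σw ^ 2 * tanhMean (X ^ 2) √q = q
  chi : σw ^ 2 * tanhMean (tanhD X ^ 2) √q = 1

open Polynomial in
lemma varianceMap_tanh (σb σw q : ℝ) :
    varianceMap Real.tanh σb σw q = σb ^ 2 + σw ^ 2 * tanhMean (X ^ 2) √q := by
  rw [tanhMean_X_sq]; rfl

open Polynomial in
lemma chi_tanh (σw q : ℝ) :
    chi Real.tanh σw q = σw ^ 2 * tanhMean (tanhD X ^ 2) √q := by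
  simp [NTKEOC.chi, deriv_tanh_eq_tanhPoly, tanhMean, tanhPoly]

open Polynomial in
-- By continuity the limiting variance is a fixed point. Combining the fixed point equation with
-- `χ(q) = 1` gives `σw² * poincareGap √q = σb²`, so strict positivity of the gap rules out a zero
-- bias.
theorem exists_tanhEOC {σb σw : ℝ} (h : (σb, σw) ∈ EOC Real.tanh) : ∃ q, TanhEOC σb σw q := by
  obtain ⟨-, -, q, ⟨hq, q₁, -, hlim⟩, hchi⟩ := h
  have hfun : varianceMap Real.tanh σb σw = fun q => σb ^ 2 + σw ^ 2 * tanhMean (X ^ 2) √q :=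
    funext fun q => varianceMap_tanh σb σw q
  have hc : Continuous (varianceMap Real.tanh σb σw) := by
    rw [hfun]
    exact continuous_const.add (continuous_const.mul
      ((continuous_tanhMean _).comp Real.continuous_sqrt))
  have hfix : varianceMap Real.tanh σb σw q = q := isFixedPt_of_tendsto_iterate hlim hc.continuousAt
  rw [varianceMap_tanh] at hfix
  rw [chi_tanh] at hchi
  refine ⟨q, ?_, hq, hfix, hchi⟩
  have hσ : 0 < σw ^ 2 := by
    rcases (sq_nonneg σw).eq_or_lt with h0 | h0
    · rw [← h0, zero_mul] at hchi; norm_num at hchi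
    · exact h0
  have h1 := poincareGap_strictMonoOn Set.self_mem_Ici (Real.sqrt_nonneg q) (Real.sqrt_pos.2 hq)
  have h0 : poincareGap 0 = 0 := by simp [poincareGap, tanhMean, tanhPoly]
  rw [h0, poincareGap, Real.sq_sqrt hq.le] at h1
  have h2 := mul_pos hσ h1
  have : σw ^ 2 * (q * tanhMean (tanhD X ^ 2) √q - tanhMean (X ^ 2) √q) =
    q * (σw ^ 2 * tanhMean (tanhD X ^ 2) √q) - σw ^ 2 * tanhMean (X ^ 2) √q := by ring
  rw [this, hchi] at h2
  linarith

namespace TanhEOC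

variable {σb σw q : ℝ}

lemma weight_pos (h : TanhEOC σb σw q) : 0 < σw ^ 2 := by
  rcases (sq_nonneg σw).eq_or_lt with h0 | h0
  · have := h.chi
    rw [← h0, zero_mul] at this; norm_num at this
  · exact h0

open Polynomial in
lemma bias_le (h : TanhEOC σb σw q) : σb ^ 2 ≤ q := by
  have := h.fixed
  have h1 : 0 ≤ tanhMean (X ^ 2) √q := by
    rw [tanhMean_X_sq]; exact integral_nonneg fun _ => sq_nonneg _
  have := mul_nonneg (sq_nonneg σw) h1
  linarith

open Polynomial in
/-- One step of the variance recursion contracts towards `q`, preserving the side of `q`. -/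
lemma variance_step (h : TanhEOC σb σw q) {p : ℝ} (hp : 0 ≤ p) :
    |σb ^ 2 + σw ^ 2 * tanhMean (X ^ 2) √p - q| ≤ (1 - σb ^ 2 / q) * |p - q| ∧
      (q ≤ p → q ≤ σb ^ 2 + σw ^ 2 * tanhMean (X ^ 2) √p) ∧
      (p ≤ q → σb ^ 2 + σw ^ 2 * tanhMean (X ^ 2) √p ≤ q) := by
  have hσ := h.weight_pos
  have hq := h.pos
  have hfix := h.fixed
  have hb := h.bias_le
  have hexp : σw ^ 2 * tanhMean (X ^ 2) √q = q - σb ^ 2 := by linarith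
  have up : q ≤ p → q ≤ σb ^ 2 + σw ^ 2 * tanhMean (X ^ 2) √p := fun hqp => by
    have := mul_le_mul_of_nonneg_left
      (tanhMean_X_sq_mono (Real.sqrt_nonneg q) (Real.sqrt_le_sqrt hqp)) hσ.le
    linarith
  have dn : p ≤ q → σb ^ 2 + σw ^ 2 * tanhMean (X ^ 2) √p ≤ q := fun hqp => by
    have := mul_le_mul_of_nonneg_left
      (tanhMean_X_sq_mono (Real.sqrt_nonneg p) (Real.sqrt_le_sqrt hqp)) hσ.le
    linarith
  refine ⟨?_, up, dn⟩
  -- Comparison with the line through `(0, σb²)` and `(q, q)`, of slope `1 - σb² / q`: sublinearity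
  -- puts the variance map below it to the right of `q` and above it to the left.
  have hlin : σb ^ 2 + p / q * (q - σb ^ 2) - q = (1 - σb ^ 2 / q) * (p - q) := by
    field_simp; ring
  rcases le_total q p with hqp | hqp
  · rw [abs_of_nonneg (by linarith [up hqp]), abs_of_nonneg (by linarith), ← hlin]
    have h1 := mul_le_mul_of_nonneg_left
      (tanhMean_X_sq_le (Real.sqrt_pos.2 hq) (Real.sqrt_le_sqrt hqp)) hσ.le
    rw [div_pow, Real.sq_sqrt hp, Real.sq_sqrt hq.le] at h1
    have h2 : σw ^ 2 * (p / q * tanhMean (X ^ 2) √q) =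
      p / q * (σw ^ 2 * tanhMean (X ^ 2) √q) := by ring
    rw [h2, hexp] at h1
    linarith
  · rw [abs_of_nonpos (by linarith [dn hqp]), abs_of_nonpos (by linarith)]
    rcases hp.eq_or_lt with rfl | hp
    · have : 0 ≤ tanhMean (X ^ 2) √0 := by
        rw [tanhMean_X_sq]; exact integral_nonneg fun _ => sq_nonneg _
      have := mul_nonneg hσ.le this
      have e : (1 - σb ^ 2 / q) * -(0 - q) = q - σb ^ 2 := by field_simp; ring
      rw [e]; linarith
    have h1 := mul_le_mul_of_nonneg_left
      (tanhMean_X_sq_le (Real.sqrt_pos.2 hp) (Real.sqrt_le_sqrt hqp)) hσ.le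
    rw [div_pow, Real.sq_sqrt hp.le, Real.sq_sqrt hq.le, hexp] at h1
    have h3 : p / q * (q - σb ^ 2) ≤ σw ^ 2 * tanhMean (X ^ 2) √p := by
      have h4 := mul_le_mul_of_nonneg_left h1 (by positivity : 0 ≤ p / q)
      have e : p / q * (σw ^ 2 * (q / p * tanhMean (X ^ 2) √p)) =
        σw ^ 2 * tanhMean (X ^ 2) √p := by field_simp
      rwa [e] at h4
    linarith

/-- The contraction rate of the variances. -/
lemma rate_mem (h : TanhEOC σb σw q) : 0 ≤ 1 - σb ^ 2 / q ∧ 1 - σb ^ 2 / q < 1 := by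
  have hq := h.pos
  have hb := h.bias
  constructor
  · rw [sub_nonneg, div_le_one hq]; exact h.bias_le
  · have : 0 < σb ^ 2 / q := by positivity
    linarith

end TanhEOC

open Polynomial in
lemma gaussE_tanh_self {p : ℝ} (hp : 0 ≤ p) :
    gaussE Real.tanh p p p = tanhMean (X ^ 2) √p := by
  rw [gaussE_self _ hp, tanhMean_X_sq]

open Polynomial in
lemma gaussE_deriv_tanh_self {p : ℝ} (hp : 0 ≤ p) :
    gaussE (deriv Real.tanh) p p p = tanhMean (tanhD X ^ 2) √p := by
  rw [gaussE_self _ hp, deriv_tanh_eq_tanhPoly]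
  simp [tanhMean, tanhPoly]

open Polynomial in
lemma varSeq_tanh_nonneg (σb σw : ℝ) {a : ℝ} (ha : 0 ≤ a) (l : ℕ) :
    0 ≤ varSeq Real.tanh σb σw a l ∧ varSeq Real.tanh σb σw a (l + 1) =
      σb ^ 2 + σw ^ 2 * tanhMean (X ^ 2) √(varSeq Real.tanh σb σw a l) := by
  induction l with
  | zero => exact ⟨ha, by rw [varSeq_succ, varSeq_zero, gaussE_tanh_self ha]⟩
  | succ l ih =>
    have h1 : 0 ≤ varSeq Real.tanh σb σw a (l + 1) := by
      rw [ih.2, tanhMean_X_sq]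
      have : 0 ≤ ∫ z, Real.tanh (√(varSeq Real.tanh σb σw a l) * z) ^ 2 ∂stdG :=
        integral_nonneg fun _ => sq_nonneg _
      positivity
    exact ⟨h1, by rw [varSeq_succ, gaussE_tanh_self h1]⟩

open Polynomial in
lemma bias_le_varSeq_tanh {σb σw a : ℝ} (ha : σb ^ 2 ≤ a) (l : ℕ) :
    σb ^ 2 ≤ varSeq Real.tanh σb σw a l := by
  have ha0 : 0 ≤ a := (sq_nonneg σb).trans ha
  rcases l with _ | l
  · exact ha
  · rw [(varSeq_tanh_nonneg σb σw ha0 l).2, tanhMean_X_sq]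
    have : 0 ≤ ∫ z, Real.tanh (√(varSeq Real.tanh σb σw a l) * z) ^ 2 ∂stdG :=
      integral_nonneg fun _ => sq_nonneg _
    have := mul_nonneg (sq_nonneg σw) this
    linarith

/-! ### Convergence of the variances and the diagonal of the Tanh kernel. -/

namespace TanhEOC

variable {σb σw q : ℝ}

lemma abs_varSeq_sub_le (h : TanhEOC σb σw q) {a : ℝ} (ha : 0 ≤ a) (l : ℕ) :
    |varSeq Real.tanh σb σw a l - q| ≤ (1 - σb ^ 2 / q) ^ l * |a - q| := by
  induction l with
  | zero => simp [varSeq_zero]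
  | succ l ih =>
    obtain ⟨h0, h1⟩ := varSeq_tanh_nonneg σb σw ha l
    rw [h1, pow_succ' (1 - σb ^ 2 / q) l]
    refine (h.variance_step h0).1.trans ?_
    rw [mul_assoc]
    exact mul_le_mul_of_nonneg_left ih h.rate_mem.1

lemma tendsto_varSeq (h : TanhEOC σb σw q) {a : ℝ} (ha : 0 ≤ a) :
    Tendsto (varSeq Real.tanh σb σw a) atTop (𝓝 q) := by
  have h1 : Tendsto (fun l : ℕ => (1 - σb ^ 2 / q) ^ l * |a - q|) atTop (𝓝 0) := by
    simpa using (tendsto_pow_atTop_nhds_zero_of_lt_one h.rate_mem.1 h.rate_mem.2).mul_const |a - q|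
  rw [tendsto_iff_norm_sub_tendsto_zero]
  exact squeeze_zero (fun _ => norm_nonneg _) (h.abs_varSeq_sub_le ha) h1

/-- Uniform polynomial decay of the variances to their limit. -/
lemma exists_varSeq_rate (h : TanhEOC σb σw q) (R : ℝ) :
    ∃ C ≥ 0, ∀ a, 0 ≤ a → a ≤ R → ∀ l : ℕ,
      |varSeq Real.tanh σb σw a l - q| ≤ C / ((l : ℝ) + 1) ^ 4 := by
  obtain ⟨C, hC, hg⟩ := geometric_le_inv_pow_four h.rate_mem.1 h.rate_mem.2
  refine ⟨C * (|R| + |q|), by positivity, fun a h0 h1 l => ?_⟩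
  have h2 : |a - q| ≤ |R| + |q| := by
    refine (abs_sub _ _).trans ?_
    have : |a| ≤ |R| := abs_le_abs_of_nonneg h0 h1
    linarith
  calc _ ≤ (1 - σb ^ 2 / q) ^ l * |a - q| := h.abs_varSeq_sub_le h0 l
    _ ≤ C / ((l : ℝ) + 1) ^ 4 * (|R| + |q|) := by
      gcongr
      exact hg l
    _ = _ := by ring

lemma abs_sqrt_sub_le (h : TanhEOC σb σw q) (p : ℝ) : |√p - √q| ≤ |p - q| / √q := by
  have hq := Real.sqrt_pos.2 h.pos
  have hp := Real.sqrt_nonneg p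
  rw [le_div_iff₀ hq]
  rcases le_total 0 p with h0 | h0
  · have e : p - q = (√p - √q) * (√p + √q) := by
      have h1 := Real.sq_sqrt h0
      have h2 := Real.sq_sqrt h.pos.le
      linear_combination -h1 + h2
    rw [e, abs_mul, abs_of_pos (by linarith : 0 < √p + √q)]
    exact mul_le_mul_of_nonneg_left (by linarith) (abs_nonneg _)
  · rw [Real.sqrt_eq_zero_of_nonpos h0, zero_sub, abs_neg, abs_of_pos hq,
      Real.mul_self_sqrt h.pos.le, abs_of_nonpos (by linarith [h.pos])]
    linarith

lemma dotSeq_self {a : ℝ} (ha : 0 ≤ a) (l : ℕ) : dotSeq Real.tanh σb σw a a a l =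
    σw ^ 2 * tanhMean (tanhD Polynomial.X ^ 2) √(varSeq Real.tanh σb σw a l) := by
  rw [dotSeq, covSeq_self, gaussE_deriv_tanh_self (varSeq_tanh_nonneg σb σw ha l).1]

open Polynomial in
-- The factor differs from 1 by `O(n⁻⁴)`. Acting on the main part `n q` it leaves `O(n⁻³)`, so the
-- error of the kernel obeys a Grönwall recursion with summable coefficients and stays bounded.
theorem ntkSeq_self_bound (h : TanhEOC σb σw q) (R : ℝ) :
    ∃ K ≥ 0, ∀ a, 0 ≤ a → a ≤ R → ∀ l : ℕ,
      |ntkSeq Real.tanh σb σw a a a l - ((l : ℝ) + 1) * q| ≤ K := by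
  obtain ⟨C, hC, hv⟩ := h.exists_varSeq_rate R
  have hq := h.pos
  have hsq := Real.sqrt_pos.2 hq
  have hB := tanhBound_nonneg (tanhD (tanhD X ^ 2))
  set C₁ := σw ^ 2 * (tanhBound (tanhD (tanhD X ^ 2)) * (C / √q)) with hC₁
  have hC₁0 : 0 ≤ C₁ := by positivity
  have hW := weightSum_nonneg
  refine ⟨Real.exp (C₁ * weightSum) * (|R| + q + (C₁ * q + C) * weightSum), by positivity,
    fun a h0 h1 l => ?_⟩
  have hχ : ∀ l : ℕ, |dotSeq Real.tanh σb σw a a a l - 1| ≤ C₁ / ((l : ℝ) + 1) ^ 4 := fun l => by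
    have e : dotSeq Real.tanh σb σw a a a l - 1 =
        σw ^ 2 * (tanhMean (tanhD X ^ 2) √(varSeq Real.tanh σb σw a l) -
          tanhMean (tanhD X ^ 2) √q) := by rw [dotSeq_self h0, mul_sub, h.chi]
    rw [e, abs_mul, abs_of_pos h.weight_pos]
    calc _ ≤ σw ^ 2 * (tanhBound (tanhD (tanhD X ^ 2)) *
          (C / ((l : ℝ) + 1) ^ 4 / √q)) := by
          refine mul_le_mul_of_nonneg_left ((tanhMean_lipschitz _ _ _).trans ?_) (sq_nonneg _)
          refine mul_le_mul_of_nonneg_left ((h.abs_sqrt_sub_le _).trans ?_) hB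
          have := hv a h0 h1 l
          gcongr
      _ = C₁ / ((l : ℝ) + 1) ^ 4 := by rw [hC₁]; ring
  have hg := gronwall_seq (u := fun l => |ntkSeq Real.tanh σb σw a a a l - ((l : ℝ) + 1) * q|)
    (α := fun l => C₁ * (1 / ((l : ℝ) + 1) ^ 2))
    (β := fun l => (C₁ * q + C) * (1 / ((l : ℝ) + 1) ^ 2)) (abs_nonneg _)
    (fun l => by positivity) (fun l => by positivity) (fun l => by
      have hm1 : (1 : ℝ) ≤ (l : ℝ) + 1 := by linarith [Nat.cast_nonneg (α := ℝ) l]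
      have g1 := hχ l
      have g2 := hv a h0 h1 (l + 1)
      rw [ntkSeq, covSeq_self]
      push_cast at g2 ⊢
      generalize (l : ℝ) + 1 = m at *
      generalize dotSeq Real.tanh σb σw a a a l = X at *
      generalize ntkSeq Real.tanh σb σw a a a l = k at *
      generalize varSeq Real.tanh σb σw a (l + 1) = v at *
      have hm : 0 < m := by linarith
      have e : X * k + v - (m + 1) * q =
        (k - m * q) + (X - 1) * (k - m * q) + ((X - 1) * (m * q) + (v - q)) := by ring
      have p42 : 1 / m ^ 4 ≤ 1 / m ^ 2 := by gcongr; norm_num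
      have p32 : 1 / m ^ 3 ≤ 1 / m ^ 2 := by gcongr; norm_num
      have p43 : C / (m + 1) ^ 4 ≤ C * (1 / m ^ 2) := by
        calc C / (m + 1) ^ 4 ≤ C / m ^ 4 := by gcongr; linarith
          _ = C * (1 / m ^ 4) := by ring
          _ ≤ _ := by gcongr
      have g3 : |X - 1| ≤ C₁ * (1 / m ^ 2) := g1.trans (by
        rw [← mul_one_div]; gcongr)
      have g4 : |X - 1| * (m * q) ≤ C₁ * q * (1 / m ^ 2) := by
        calc |X - 1| * (m * q) ≤ C₁ / m ^ 4 * (m * q) := by gcongr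
          _ = C₁ * q * (1 / m ^ 3) := by field_simp
          _ ≤ _ := by gcongr
      rw [e]
      calc _ ≤ |k - m * q| + |(X - 1) * (k - m * q)| + |(X - 1) * (m * q) + (v - q)| :=
            abs_add_three _ _ _
        _ ≤ |k - m * q| + |X - 1| * |k - m * q| + (|X - 1| * (m * q) + |v - q|) := by
            rw [abs_mul]
            gcongr
            refine (abs_add_le _ _).trans ?_
            rw [abs_mul, abs_of_pos (by positivity : 0 < m * q)]
        _ ≤ |k - m * q| + C₁ * (1 / m ^ 2) * |k - m * q| +
            (C₁ * q * (1 / m ^ 2) + C * (1 / m ^ 2)) := by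
            gcongr
            exact g2.trans p43
        _ = _ := by ring) l
  refine hg.trans ?_
  rw [← Finset.mul_sum, ← Finset.mul_sum]
  have s1 := sum_one_div_sq_le l
  have hz : |ntkSeq Real.tanh σb σw a a a 0 - (((0 : ℕ) : ℝ) + 1) * q| ≤ |R| + q := by
    rw [ntkSeq, Nat.cast_zero, zero_add, one_mul]
    refine (abs_sub _ _).trans ?_
    have : |a| ≤ |R| := abs_le_abs_of_nonneg h0 h1
    rw [abs_of_pos hq]; linarith
  gcongr

open Polynomial in
-- Writing `χ(p)` for the derivative factor and `V(p)` for the next variance, `χ(p) p - V(p) = σw² *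
-- poincareGap √p - σb²`. This vanishes at `q` and is strictly increasing in `p`.
lemma sign_chi_sub (h : TanhEOC σb σw q) {p : ℝ} (hp : 0 ≤ p) :
    (q < p → σb ^ 2 + σw ^ 2 * tanhMean (X ^ 2) √p < σw ^ 2 * tanhMean (tanhD X ^ 2) √p * p) ∧
      (p < q → σw ^ 2 * tanhMean (tanhD X ^ 2) √p * p <
        σb ^ 2 + σw ^ 2 * tanhMean (X ^ 2) √p) := by
  have hσ := h.weight_pos
  have hval : σw ^ 2 * poincareGap √q = σb ^ 2 := by
    rw [poincareGap, Real.sq_sqrt h.pos.le]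
    have h1 := h.fixed
    have h2 := h.chi
    linear_combination q * h2 - h1
  have hgen : σw ^ 2 * tanhMean (tanhD X ^ 2) √p * p =
      σw ^ 2 * poincareGap √p + σw ^ 2 * tanhMean (X ^ 2) √p := by
    rw [poincareGap, Real.sq_sqrt hp]; ring
  rw [hgen]
  constructor
  · intro hlt
    have := mul_lt_mul_of_pos_left (poincareGap_strictMonoOn (Real.sqrt_nonneg q)
      (Real.sqrt_nonneg p) (Real.sqrt_lt_sqrt h.pos.le hlt)) hσ
    linarith
  · intro hlt
    have := mul_lt_mul_of_pos_left (poincareGap_strictMonoOn (Real.sqrt_nonneg p)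
      (Real.sqrt_nonneg q) (Real.sqrt_lt_sqrt hp hlt)) hσ
    linarith

open Polynomial in
lemma chi_mul_ge (h : TanhEOC σb σw q) {p : ℝ} (hp : 0 ≤ p) :
    (q ≤ p → σb ^ 2 + σw ^ 2 * tanhMean (X ^ 2) √p ≤ σw ^ 2 * tanhMean (tanhD X ^ 2) √p * p) ∧
      (p ≤ q → σw ^ 2 * tanhMean (tanhD X ^ 2) √p * p ≤
        σb ^ 2 + σw ^ 2 * tanhMean (X ^ 2) √p) := by
  have heq : σb ^ 2 + σw ^ 2 * tanhMean (X ^ 2) √q = σw ^ 2 * tanhMean (tanhD X ^ 2) √q * q := by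
    rw [h.fixed, h.chi, one_mul]
  constructor
  · intro hle
    rcases hle.eq_or_lt with rfl | hlt
    · exact heq.le
    · exact ((h.sign_chi_sub hp).1 hlt).le
  · intro hle
    rcases hle.eq_or_lt with rfl | hlt
    · exact heq.ge
    · exact ((h.sign_chi_sub hp).2 hlt).le

open Polynomial in
-- The variances stay on the side of `q` where they start. On the right of `q`, `χ(v) v` is at least
-- the next variance, so a lower bound `(n + η) v` on the kernel at layer `n` propagates; the left
-- side is symmetric. The first step is strict and fixes `η > 0`; comparing `v` to `q` then leaves a
-- gap `η q`.
theorem ntkSeq_self_lower (h : TanhEOC σb σw q) {a : ℝ} (ha : 0 ≤ a) (hne : a ≠ q) :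
    ∃ η > 0, ∀ l : ℕ,
      η ≤ |ntkSeq Real.tanh σb σw a a a (l + 1) - (((l + 1 : ℕ) : ℝ) + 1) * q| := by
  have hq := h.pos
  set v := varSeq Real.tanh σb σw a with hv
  set χ : ℝ → ℝ := fun p => σw ^ 2 * tanhMean (tanhD X ^ 2) √p with hχ
  set k := ntkSeq Real.tanh σb σw a a a with hk
  have hχ0 : ∀ p, 0 ≤ χ p := fun p => mul_nonneg (sq_nonneg _)
    (tanhMean_nonneg (fun t _ => by rw [eval_pow]; exact sq_nonneg _) _)
  have hv0 : ∀ l, 0 ≤ v l := fun l => (varSeq_tanh_nonneg σb σw ha l).1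
  have hvs : ∀ l, v (l + 1) = σb ^ 2 + σw ^ 2 * tanhMean (X ^ 2) √(v l) := fun l =>
    (varSeq_tanh_nonneg σb σw ha l).2
  have hks : ∀ l, k (l + 1) = χ (v l) * k l + v (l + 1) := fun l => by
    simp only [hk, ntkSeq, dotSeq_self ha, covSeq_self, hχ, hv]
  have hk1 : k 1 = χ a * a + v 1 := hks 0
  have hv1 : 0 < v 1 := by
    rw [hvs 0, tanhMean_X_sq]
    have : 0 ≤ ∫ z, Real.tanh (√(v 0) * z) ^ 2 ∂stdG := integral_nonneg fun _ => sq_nonneg _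
    have := mul_nonneg (sq_nonneg σw) this
    linarith [h.bias]
  have hva : v 0 = a := rfl
  rcases lt_or_gt_of_ne hne with hlt | hgt
  · set η := 1 - χ a * a / v 1 with hη
    have hη0 : 0 < η := by
      have := (h.sign_chi_sub ha).2 hlt
      rw [← hva, ← hvs 0] at this
      rw [hη, sub_pos, div_lt_one hv1]
      exact this
    have hη1 : η ≤ 1 := by
      have : 0 ≤ χ a * a / v 1 := div_nonneg (mul_nonneg (hχ0 a) ha) hv1.le
      linarith
    have hvq : ∀ l, v l ≤ q := by
      intro l
      induction l with
      | zero => exact hlt.le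
      | succ l ih => rw [hvs]; exact (h.variance_step (hv0 l)).2.2 ih
    have hrec : ∀ l : ℕ, k (l + 1) ≤ ((l : ℝ) + 2 - η) * v (l + 1) := by
      intro l
      induction l with
      | zero => rw [hk1, hη]; field_simp; push_cast; linarith
      | succ l ih =>
        rw [hks (l + 1)]
        have h1 := mul_le_mul_of_nonneg_left ih (hχ0 (v (l + 1)))
        have h2 := (h.chi_mul_ge (hv0 (l + 1))).2 (hvq _)
        rw [← hvs] at h2
        have h3 : χ (v (l + 1)) * v (l + 1) * ((l : ℝ) + 2 - η) ≤
          v (l + 1 + 1) * ((l : ℝ) + 2 - η) := by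
          apply mul_le_mul_of_nonneg_right h2
          linarith [Nat.cast_nonneg (α := ℝ) l]
        push_cast
        linarith
    refine ⟨η * q, by positivity, fun l => ?_⟩
    have h1 : ((l : ℝ) + 2 - η) * v (l + 1) ≤ ((l : ℝ) + 2 - η) * q := by
      apply mul_le_mul_of_nonneg_left (hvq _)
      linarith [Nat.cast_nonneg (α := ℝ) l]
    have h2 := hrec l
    rw [← abs_neg]
    refine le_trans ?_ (le_abs_self _)
    push_cast
    linarith
  · set η := χ a * a / v 1 - 1 with hη
    have hη0 : 0 < η := by
      have := (h.sign_chi_sub ha).1 hgt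
      rw [← hva, ← hvs 0] at this
      rw [hη, sub_pos, one_lt_div hv1]
      exact this
    have hvq : ∀ l, q ≤ v l := by
      intro l
      induction l with
      | zero => exact hgt.le
      | succ l ih => rw [hvs]; exact (h.variance_step (hv0 l)).2.1 ih
    have hrec : ∀ l : ℕ, ((l : ℝ) + 2 + η) * v (l + 1) ≤ k (l + 1) := by
      intro l
      induction l with
      | zero => rw [hk1, hη]; field_simp; push_cast; linarith
      | succ l ih =>
        rw [hks (l + 1)]
        have h1 := mul_le_mul_of_nonneg_left ih (hχ0 (v (l + 1)))
        have h2 := (h.chi_mul_ge (hv0 (l + 1))).1 (hvq _)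
        rw [← hvs] at h2
        have h3 : v (l + 1 + 1) * ((l : ℝ) + 2 + η) ≤
          χ (v (l + 1)) * v (l + 1) * ((l : ℝ) + 2 + η) := by
          apply mul_le_mul_of_nonneg_right h2
          linarith [Nat.cast_nonneg (α := ℝ) l]
        push_cast
        linarith
    refine ⟨η * q, by positivity, fun l => ?_⟩
    have h1 : ((l : ℝ) + 2 + η) * q ≤ ((l : ℝ) + 2 + η) * v (l + 1) := by
      apply mul_le_mul_of_nonneg_left (hvq _)
      linarith [Nat.cast_nonneg (α := ℝ) l]
    have h2 := hrec l
    refine le_trans ?_ (le_abs_self _)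
    push_cast
    linarith

end TanhEOC

/-! ### The correlation recursion of Tanh networks -/

open Polynomial in
/-- The polynomial `T_k` with `tanh^(k) = T_k ∘ tanh`. -/
noncomputable def tanhT : ℕ → ℝ[X]
  | 0 => X
  | k + 1 => tanhD (tanhT k)

/-- The moments `E[tanh^(k)(√q Z)²]`. -/
noncomputable def tanhMoment (q : ℝ) (k : ℕ) : ℝ := tanhMean (tanhT k ^ 2) √q

/-- The functions `E[tanh^(k)(√q Z₁) tanh^(k)(√q Z_c)]` of the correlation `c`. -/
noncomputable def tanhCorr (q : ℝ) (k : ℕ) (c : ℝ) : ℝ := corrMean (tanhT k) (tanhT k) √q √q c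

lemma tanhCorr_one (q : ℝ) (k : ℕ) : tanhCorr q k 1 = tanhMoment q k := by
  rw [tanhCorr, corrMean_one, tanhMoment, sq]

lemma continuousOn_tanhCorr (q : ℝ) (k : ℕ) : ContinuousOn (tanhCorr q k) (Set.Icc (-1) 1) :=
  continuousOn_corrMean _ _ _ _

lemma hasDerivAt_tanhCorr {q : ℝ} (hq : 0 ≤ q) (k : ℕ) {c : ℝ} (h1 : -1 < c) (h2 : c < 1) :
    HasDerivAt (tanhCorr q k) (q * tanhCorr q (k + 1) c) c := by
  have := hasDerivAt_corrMean (tanhT k) (tanhT k) √q √q h1 h2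
  rwa [Real.mul_self_sqrt hq] at this

lemma abs_tanhCorr_le {q : ℝ} (k : ℕ) {c : ℝ} (h1 : -1 ≤ c) (h2 : c ≤ 1) :
    |tanhCorr q k c| ≤ tanhMoment q k := by
  have := abs_corrMean_le_sq (tanhT k) √q √q h1 h2 one_pos
  rw [inv_one, one_mul] at this
  unfold tanhMoment
  exact this.trans (by linarith)

/-- Integrating a polynomial bound from the right end point of `[-1, 1]`. -/
lemma abs_le_of_deriv_le {h h' : ℝ → ℝ} {C : ℝ} (n : ℕ) (hC : 0 ≤ C)
    (hc : ContinuousOn h (Set.Icc (-1) 1)) (h1 : h 1 = 0)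
    (hd : ∀ c, -1 < c → c < 1 → HasDerivAt h (h' c) c)
    (hb : ∀ c, -1 < c → c < 1 → |h' c| ≤ C * (1 - c) ^ n) {c : ℝ} (hc1 : -1 ≤ c) (hc2 : c ≤ 1) :
    |h c| ≤ C * (1 - c) ^ (n + 1) := by
  rcases hc2.eq_or_lt with rfl | hc2
  · simp [h1]
  · obtain ⟨ξ, hξ, e⟩ := exists_hasDerivAt_eq_slope h h' hc2
      (hc.mono (Set.Icc_subset_Icc_left hc1)) (fun x hx => hd x (by linarith [hx.1]) hx.2)
    have hpos : 0 < 1 - c := by linarith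
    rw [h1, zero_sub, eq_div_iff hpos.ne'] at e
    rw [← abs_neg, ← e, abs_mul, abs_of_pos hpos, pow_succ, ← mul_assoc]
    have h3 := hb ξ (by linarith [hξ.1]) hξ.2
    have h4 : 0 ≤ 1 - ξ := by linarith [hξ.2]
    have h5 : C * (1 - ξ) ^ n ≤ C * (1 - c) ^ n := by
      gcongr
      exact hξ.1.le
    exact mul_le_mul_of_nonneg_right (h3.trans h5) hpos.le

lemma tanhMoment_nonneg (q : ℝ) (k : ℕ) : 0 ≤ tanhMoment q k :=
  (abs_nonneg _).trans (abs_tanhCorr_le (q := q) k (c := 1) (by norm_num) le_rfl)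

lemma abs_tanhCorr_sub_le {q : ℝ} (hq : 0 ≤ q) (k : ℕ) {c : ℝ} (h1 : -1 ≤ c) (h2 : c ≤ 1) :
    |tanhCorr q k c - tanhMoment q k| ≤ q * tanhMoment q (k + 1) * (1 - c) := by
  have := abs_le_of_deriv_le (h := fun c => tanhCorr q k c - tanhMoment q k)
    (h' := fun c => q * tanhCorr q (k + 1) c) (C := q * tanhMoment q (k + 1)) 0
    (mul_nonneg hq (tanhMoment_nonneg q _))
    ((continuousOn_tanhCorr q k).sub continuousOn_const) (by rw [tanhCorr_one, sub_self])
    (fun c h1 h2 => (hasDerivAt_tanhCorr hq k h1 h2).sub_const _)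
    (fun c h1 h2 => by
      rw [abs_mul, abs_of_nonneg hq, pow_zero, mul_one]
      exact mul_le_mul_of_nonneg_left (abs_tanhCorr_le _ h1.le h2.le) hq) h1 h2
  simpa using this

/-- The derivative of a cubic polynomial in `1 - c`. -/
lemma hasDerivAt_cubic (α β γ δ c : ℝ) :
    HasDerivAt (fun c : ℝ => α - β * (1 - c) + γ * (1 - c) ^ 2 - δ * (1 - c) ^ 3)
      (β - 2 * γ * (1 - c) + 3 * δ * (1 - c) ^ 2) c := by
  have h := (hasDerivAt_id c).const_sub 1
  refine ((((h.const_mul β).const_sub α).add ((h.pow 2).const_mul γ)).sub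
    ((h.pow 3).const_mul δ)).congr_deriv ?_
  simp only [id_eq]
  push_cast
  ring

/-- Integration of a Taylor expansion of `tanhCorr q (k + 1)` at `1`. -/
lemma tanhCorr_expansion_step {q : ℝ} (hq : 0 ≤ q) (k n : ℕ) {β γ δ B : ℝ} (hB : 0 ≤ B)
    (h : ∀ c, -1 ≤ c → c ≤ 1 →
      |q * tanhCorr q (k + 1) c - (β - 2 * γ * (1 - c) + 3 * δ * (1 - c) ^ 2)| ≤
        B * (1 - c) ^ n) {c : ℝ} (h1 : -1 ≤ c) (h2 : c ≤ 1) :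
    |tanhCorr q k c - (tanhMoment q k - β * (1 - c) + γ * (1 - c) ^ 2 - δ * (1 - c) ^ 3)| ≤
      B * (1 - c) ^ (n + 1) := by
  refine abs_le_of_deriv_le
    (h := fun c => tanhCorr q k c -
      (tanhMoment q k - β * (1 - c) + γ * (1 - c) ^ 2 - δ * (1 - c) ^ 3))
    (h' := fun c => q * tanhCorr q (k + 1) c - (β - 2 * γ * (1 - c) + 3 * δ * (1 - c) ^ 2))
    n hB ((continuousOn_tanhCorr q k).sub (by fun_prop)) (by simp [tanhCorr_one])
    (fun c h1 h2 => (hasDerivAt_tanhCorr hq k h1 h2).sub (hasDerivAt_cubic _ _ _ _ c))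
    (fun c h1 h2 => h c h1.le h2.le) h1 h2

/-- The Taylor expansions at `c = 1` are built downwards, from a bound on the fourth-order
correlation, by integrating `(tanhCorr q k)' = q * tanhCorr q (k + 1)`. Only continuity is used at
the end point itself, and the remainders carry no factorials, since each integration is a mean value
bound. -/
lemma tanhCorr_expansion_two {q : ℝ} (hq : 0 ≤ q) {c : ℝ} (h1 : -1 ≤ c) (h2 : c ≤ 1) :
    |tanhCorr q 2 c - (tanhMoment q 2 - q * tanhMoment q 3 * (1 - c))| ≤
      q ^ 2 * tanhMoment q 4 * (1 - c) ^ 2 := by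
  have := tanhCorr_expansion_step hq 2 1 (β := q * tanhMoment q 3) (γ := 0) (δ := 0)
    (B := q ^ 2 * tanhMoment q 4) (mul_nonneg (sq_nonneg q) (tanhMoment_nonneg q 4))
    (fun c h1 h2 => by
      have := mul_le_mul_of_nonneg_left (abs_tanhCorr_sub_le hq 3 h1 h2) hq
      rw [← abs_of_nonneg hq, ← abs_mul, abs_of_nonneg hq] at this
      refine (le_of_eq ?_).trans (this.trans_eq ?_)
      · congr 1; ring
      · norm_num; ring) h1 h2
  convert this using 2
  ring

lemma tanhCorr_expansion_one {q : ℝ} (hq : 0 ≤ q) {c : ℝ} (h1 : -1 ≤ c) (h2 : c ≤ 1) :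
    |tanhCorr q 1 c - (tanhMoment q 1 - q * tanhMoment q 2 * (1 - c) +
      q ^ 2 * tanhMoment q 3 / 2 * (1 - c) ^ 2)| ≤ q ^ 3 * tanhMoment q 4 * (1 - c) ^ 3 := by
  have := tanhCorr_expansion_step hq 1 2 (β := q * tanhMoment q 2)
    (γ := q ^ 2 * tanhMoment q 3 / 2) (δ := 0)
    (B := q ^ 3 * tanhMoment q 4) (mul_nonneg (pow_nonneg hq 3) (tanhMoment_nonneg q 4))
    (fun c h1 h2 => by
      have := mul_le_mul_of_nonneg_left (tanhCorr_expansion_two hq h1 h2) hq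
      rw [← abs_of_nonneg hq, ← abs_mul, abs_of_nonneg hq] at this
      refine (le_of_eq ?_).trans (this.trans_eq ?_)
      · congr 1; ring
      · ring) h1 h2
  convert this using 2
  ring

lemma tanhCorr_expansion_zero {q : ℝ} (hq : 0 ≤ q) {c : ℝ} (h1 : -1 ≤ c) (h2 : c ≤ 1) :
    |tanhCorr q 0 c - (tanhMoment q 0 - q * tanhMoment q 1 * (1 - c) +
      q ^ 2 * tanhMoment q 2 / 2 * (1 - c) ^ 2 - q ^ 3 * tanhMoment q 3 / 6 * (1 - c) ^ 3)| ≤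
        q ^ 4 * tanhMoment q 4 * (1 - c) ^ 4 := by
  refine tanhCorr_expansion_step hq 0 3 (mul_nonneg (pow_nonneg hq 4) (tanhMoment_nonneg q 4))
    (fun c h1 h2 => ?_) h1 h2
  have := mul_le_mul_of_nonneg_left (tanhCorr_expansion_one hq h1 h2) hq
  rw [← abs_of_nonneg hq, ← abs_mul, abs_of_nonneg hq] at this
  refine (le_of_eq ?_).trans (this.trans_eq ?_)
  · congr 1; ring
  · ring

lemma tanhCorr_one_linear {q : ℝ} (hq : 0 ≤ q) : ∃ C ≥ 0, ∀ c, -1 ≤ c → c ≤ 1 →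
    |tanhCorr q 1 c - (tanhMoment q 1 - q * tanhMoment q 2 * (1 - c))| ≤ C * (1 - c) ^ 2 := by
  have hm3 := tanhMoment_nonneg q 3
  have hm4 := tanhMoment_nonneg q 4
  have h := fun c (h1 : -1 ≤ c) (h2 : c ≤ 1) => tanhCorr_expansion_one hq h1 h2
  generalize tanhMoment q 1 = m₁ at *
  generalize tanhMoment q 2 = m₂ at *
  generalize tanhMoment q 3 = m₃ at *
  generalize tanhMoment q 4 = m₄ at *
  refine ⟨q ^ 3 * m₄ * 2 + q ^ 2 * m₃ / 2, by positivity, fun c h1 h2 => ?_⟩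
  have h := h c h1 h2
  generalize tanhCorr q 1 c = f at *
  have hγ : 0 ≤ 1 - c := by linarith
  have hγ2 : 1 - c ≤ 2 := by linarith
  generalize 1 - c = x at *
  have e : f - (m₁ - q * m₂ * x) =
    (f - (m₁ - q * m₂ * x + q ^ 2 * m₃ / 2 * x ^ 2)) + q ^ 2 * m₃ / 2 * x ^ 2 := by ring
  rw [e]
  refine (abs_add_le _ _).trans ?_
  rw [abs_of_nonneg (by positivity : 0 ≤ q ^ 2 * m₃ / 2 * x ^ 2)]
  calc _ ≤ q ^ 3 * m₄ * x ^ 3 + q ^ 2 * m₃ / 2 * x ^ 2 := by gcongr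
    _ = q ^ 3 * m₄ * x ^ 2 * x + q ^ 2 * m₃ / 2 * x ^ 2 := by ring
    _ ≤ q ^ 3 * m₄ * x ^ 2 * 2 + q ^ 2 * m₃ / 2 * x ^ 2 := by gcongr
    _ = _ := by ring

/-! ### A moment inequality -/

open Polynomial in
-- As `z tanh(sz) ≥ 0`, the expectation of `z tanh(sz) P(tanh(sz))` is nonnegative; Stein's lemma
-- turns this into a linear inequality between moments.
lemma stein_nonneg (P : ℝ[X]) (hP : ∀ t ∈ Set.Icc (-1 : ℝ) 1, 0 ≤ P.eval t) {s : ℝ} (hs : 0 < s) :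
    0 ≤ tanhMean (tanhD (X * P)) s := by
  have h1 : 0 ≤ ∫ z, z * tanhPoly (X * P) (s * z) ∂stdG := by
    refine integral_nonneg fun z => ?_
    have h2 : 0 ≤ z * Real.tanh (s * z) := by
      rcases le_total 0 z with hz | hz
      · have : Real.tanh 0 ≤ Real.tanh (s * z) := tanh_strictMono.monotone (by positivity)
        rw [Real.tanh_zero] at this
        exact mul_nonneg hz this
      · have : Real.tanh (s * z) ≤ Real.tanh 0 := tanh_strictMono.monotone
          (mul_nonpos_of_nonneg_of_nonpos hs.le hz)
        rw [Real.tanh_zero] at this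
        exact mul_nonneg_of_nonpos_of_nonpos hz this
    have h3 := hP _ ⟨(Real.neg_one_lt_tanh (s * z)).le, (Real.tanh_lt_one (s * z)).le⟩
    have := mul_nonneg h2 h3
    simpa [tanhPoly, mul_assoc] using this
  rw [stein_tanhPoly] at h1
  exact nonneg_of_mul_nonneg_right h1 hs

open Polynomial in
lemma tanhMean_linear (P Q R : ℝ[X]) (α β γ s : ℝ) :
    tanhMean (C α * P + C β * Q + C γ * R) s =
      α * tanhMean P s + β * tanhMean Q s + γ * tanhMean R s := by
  rw [tanhMean_add, tanhMean_add, tanhMean_C_mul, tanhMean_C_mul, tanhMean_C_mul]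

open Polynomial in
-- This is what keeps the coefficient of `log L` from vanishing. In terms of `N k = E[(1 -
-- tanh²)^k]` the claim reads `2 N₂² + 6 N₃² < 9 N₂ N₄`. It follows from two Stein inequalities, `4
-- N₂ ≤ 5 N₃` and `6 N₃ ≤ 7 N₄`, together with the Cauchy-Schwarz bound `N₃² ≤ N₂ N₄`.
theorem tanhMoment_inequality {q : ℝ} (hq : 0 < q) :
    0 < tanhMoment q 2 ∧
      3 * tanhMoment q 2 ^ 2 < 2 * (tanhMoment q 1 * tanhMoment q 3) := by
  have hs : 0 < √q := Real.sqrt_pos.2 hq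
  set s := √q with hsd
  set S : ℝ[X] := 1 - X ^ 2 with hS
  have hSeval : ∀ t ∈ Set.Icc (-1 : ℝ) 1, 0 ≤ S.eval t := fun t ht => by
    simp only [hS, eval_sub, eval_one, eval_pow, eval_X]
    nlinarith [ht.1, ht.2]
  set N : ℕ → ℝ := fun k => tanhMean (S ^ k) s with hN
  have m1 : tanhMoment q 1 = N 2 := by
    simp only [tanhMoment, tanhT, tanhD_X]; rfl
  have t2 : tanhT 2 = C (-2) * X * S := by
    refine Polynomial.funext fun x => ?_
    simp [tanhT, tanhD, hS]
    norm_num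
  have m2 : tanhMoment q 2 = 4 * N 2 - 4 * N 3 := by
    have e : tanhT 2 ^ 2 = C 4 * S ^ 2 + C (-4) * S ^ 3 + C 0 * S := by
      refine Polynomial.funext fun x => ?_
      rw [t2]
      simp [hS]
      ring
    rw [tanhMoment, e, tanhMean_linear]
    ring
  have t3 : tanhT 3 = (C 4 - C 6 * S) * S := by
    have : tanhT 3 = tanhD (tanhT 2) := rfl
    rw [this, t2]
    refine Polynomial.funext fun x => ?_
    simp only [tanhD, hS, derivative_mul, derivative_C, derivative_X, derivative_sub,
      derivative_one, derivative_X_pow, eval_mul, eval_add, eval_sub, eval_C, eval_X, eval_one,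
      eval_pow, eval_zero]
    ring
  have m3 : tanhMoment q 3 = 16 * N 2 - 48 * N 3 + 36 * N 4 := by
    have e : tanhT 3 ^ 2 = C 16 * S ^ 2 + C (-48) * S ^ 3 + C 36 * S ^ 4 := by
      refine Polynomial.funext fun x => ?_
      rw [t3]
      simp
      ring
    rw [tanhMoment, e, tanhMean_linear]
    ring
  have s2 : 4 * N 2 ≤ 5 * N 3 := by
    have h := stein_nonneg (S ^ 2) (fun t ht => by rw [eval_pow]; exact sq_nonneg _) hs
    have e : tanhD (X * S ^ 2) = C 5 * S ^ 3 + C (-4) * S ^ 2 + C 0 * S := by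
      refine Polynomial.funext fun x => ?_
      simp [tanhD, hS, derivative_pow]
      ring
    rw [e, tanhMean_linear] at h
    simp only [hN]
    linarith
  have s3 : 6 * N 3 ≤ 7 * N 4 := by
    have h := stein_nonneg (S ^ 3)
      (fun t ht => by rw [eval_pow]; exact pow_nonneg (hSeval t ht) 3) hs
    have e : tanhD (X * S ^ 3) = C 7 * S ^ 4 + C (-6) * S ^ 3 + C 0 * S := by
      refine Polynomial.funext fun x => ?_
      simp [tanhD, hS, derivative_pow]
      ring
    rw [e, tanhMean_linear] at h
    simp only [hN]
    linarith
  have hN2 : 0 < N 2 := by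
    refine tanhMean_pos (x := 0) (fun t ht => by rw [eval_pow]; exact sq_nonneg _) ?_
    simp [tanhPoly, hS]
  have m2pos : 0 < tanhMoment q 2 := by
    refine tanhMean_pos (x := 1) (fun t ht => by rw [eval_pow]; exact sq_nonneg _) ?_
    have h1 := tanh_pos (x := s * 1) (by linarith)
    have h2 := Real.tanh_sq_lt_one (s * 1)
    simp only [tanhPoly, t2, hS, eval_pow, eval_mul, eval_C, eval_X, eval_sub, eval_one]
    have : 0 < 1 - Real.tanh (s * 1) ^ 2 := by linarith
    have h3 : -2 * Real.tanh (s * 1) * (1 - Real.tanh (s * 1) ^ 2) ≠ 0 := by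
      apply mul_ne_zero (mul_ne_zero (by norm_num) h1.ne') this.ne'
    positivity
  have cs : N 3 ^ 2 ≤ N 2 * N 4 := by
    have h : 0 ≤ tanhMean (C (N 2 ^ 2) * S ^ 4 + C (-2 * N 2 * N 3) * S ^ 3 +
        C (N 3 ^ 2) * S ^ 2) s := by
      refine tanhMean_nonneg (fun t ht => ?_) s
      have e : eval t (C (N 2 ^ 2) * S ^ 4 + C (-2 * N 2 * N 3) * S ^ 3 + C (N 3 ^ 2) * S ^ 2) =
          ((N 2 * eval t S - N 3) * eval t S) ^ 2 := by
        simp only [eval_add, eval_mul, eval_C, eval_pow]; ring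
      rw [e]; exact sq_nonneg _
    rw [tanhMean_linear] at h
    have e : N 2 ^ 2 * N 4 + -2 * N 2 * N 3 * N 3 + N 3 ^ 2 * N 2 =
      N 2 * (N 2 * N 4 - N 3 ^ 2) := by ring
    have h' : 0 ≤ N 2 * (N 2 * N 4 - N 3 ^ 2) := by rw [← e]; exact h
    linarith [nonneg_of_mul_nonneg_right h' hN2]
  refine ⟨m2pos, ?_⟩
  rw [m2] at m2pos
  rw [m1, m2, m3]
  generalize N 2 = x at *
  generalize N 3 = y at *
  generalize N 4 = w at *
  -- Cauchy-Schwarz alone suffices when `3 y² > 2 x²`, and `0.82` just exceeds `√(2/3)`. Below it,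
  -- `y` lies between `0.8 x` and `0.82 x`, where `7 w ≥ 6 y` is stronger.
  rcases le_or_gt (82 / 100 * x) y with hc | hc
  · nlinarith
  · have h5 : 6 * y * x ≤ 7 * (x * w) := by nlinarith
    nlinarith

/-! ### One layer of a Tanh network -/

lemma tanh_sq_le_of_abs_le {x y : ℝ} (h : |x| ≤ y) : Real.tanh x ^ 2 ≤ Real.tanh y ^ 2 := by
  rw [tanh_sq_abs x]
  have h0 : 0 ≤ Real.tanh |x| := by
    rw [← Real.tanh_zero]
    exact tanh_strictMono.monotone (abs_nonneg x)
  have := tanh_strictMono.monotone h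
  gcongr

open Polynomial in
lemma tanhPoly_tanhT_one (x : ℝ) : tanhPoly (tanhT 1) x = 1 - Real.tanh x ^ 2 := by
  simp [tanhT, tanhPoly, tanhD]

/-- The derivative factors are bounded below on bounded sets of variances. -/
lemma exists_corrMean_lower (ρ : ℝ) : ∃ κ > 0, ∀ s t c : ℝ, 0 ≤ s → s ≤ ρ → 0 ≤ t → t ≤ ρ →
    -1 ≤ c → c ≤ 1 → κ ≤ corrMean (tanhT 1) (tanhT 1) s t c := by
  set g : ℝ × ℝ → ℝ := fun z => (1 - Real.tanh (ρ * (|z.1| + |z.2|)) ^ 2) ^ 2 with hg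
  have hgc : Continuous g := by
    have := continuous_tanh
    fun_prop
  have hpos : ∀ x : ℝ, 0 < 1 - Real.tanh x ^ 2 := fun x => by
    linarith [Real.tanh_sq_lt_one x]
  have hle : ∀ x : ℝ, 1 - Real.tanh x ^ 2 ≤ 1 := fun x => by linarith [sq_nonneg (Real.tanh x)]
  have hgp : ∀ z, 0 < g z := fun z => pow_pos (hpos _) 2
  have hgi : Integrable g stdG2 := integrable_of_bounded (C := 1) hgc.aestronglyMeasurable
    fun z => by
      rw [abs_of_pos (hgp z)]
      exact pow_le_one₀ (hpos _).le (hle _)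
  refine ⟨∫ z, g z ∂stdG2, ?_, fun s t c hs hsρ ht htρ h1 h2 => ?_⟩
  · rw [gt_iff_lt, integral_pos_iff_support_of_nonneg (fun z => (hgp z).le) hgi]
    have : Function.support g = Set.univ := Set.eq_univ_of_forall fun z => (hgp z).ne'
    rw [this, measure_univ]
    exact one_pos
  · refine integral_mono hgi (integrable_pair _ _ _ _ _ _) fun z => ?_
    have hd : √(1 - c ^ 2) ≤ 1 := Real.sqrt_le_iff.2 ⟨by norm_num, by nlinarith [sq_nonneg c]⟩
    have hd0 : 0 ≤ √(1 - c ^ 2) := Real.sqrt_nonneg _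
    have hc : |c| ≤ 1 := abs_le.2 ⟨h1, h2⟩
    have hz1 := abs_nonneg z.1
    have hz2 := abs_nonneg z.2
    have b1 : |s * z.1| ≤ ρ * (|z.1| + |z.2|) := by
      rw [abs_mul, abs_of_nonneg hs]
      exact mul_le_mul hsρ (by linarith) hz1 (hs.trans hsρ)
    have b2 : |t * (c * z.1 + √(1 - c ^ 2) * z.2)| ≤ ρ * (|z.1| + |z.2|) := by
      rw [abs_mul, abs_of_nonneg ht]
      refine mul_le_mul htρ ?_ (abs_nonneg _) (ht.trans htρ)
      refine (abs_add_le _ _).trans ?_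
      rw [abs_mul, abs_mul, abs_of_nonneg hd0]
      exact add_le_add (mul_le_of_le_one_left hz1 hc) (mul_le_of_le_one_left hz2 hd)
    simp only [tanhPoly_tanhT_one, hg]
    rw [sq (1 - Real.tanh (ρ * (|z.1| + |z.2|)) ^ 2)]
    have c1 := tanh_sq_le_of_abs_le b1
    have c2 := tanh_sq_le_of_abs_le b2
    exact mul_le_mul (by linarith) (by linarith) (hpos _).le (hpos _).le

lemma abs_sqrt_mul_sub_le {A B q δ : ℝ} (hq : 0 ≤ q) (hA0 : 0 ≤ A) (hB0 : 0 ≤ B)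
    (hA : |A - q| ≤ δ) (hB : |B - q| ≤ δ) : |√(A * B) - q| ≤ δ := by
  have hδ : 0 ≤ δ := (abs_nonneg _).trans hA
  rw [abs_le] at *
  constructor
  · rcases le_total (q - δ) 0 with h | h
    · linarith [Real.sqrt_nonneg (A * B)]
    · have : q - δ ≤ √(A * B) := by
        apply Real.le_sqrt_of_sq_le
        rw [sq]
        exact mul_le_mul (by linarith) (by linarith) h hA0
      linarith
  · have : √(A * B) ≤ q + δ := by
      rw [Real.sqrt_le_iff]
      refine ⟨by linarith, ?_⟩
      rw [sq]
      exact mul_le_mul (by linarith) (by linarith) hB0 (by linarith)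
    linarith

/-- The variance of the next layer. -/
noncomputable def varNext (σb σw A : ℝ) : ℝ := σb ^ 2 + σw ^ 2 * tanhMean (tanhT 0 ^ 2) √A

/-- The covariance of the next layer, from the variances and the correlation. -/
noncomputable def covNext (σb σw A B c : ℝ) : ℝ :=
  σb ^ 2 + σw ^ 2 * corrMean (tanhT 0) (tanhT 0) √A √B c

/-- The limiting correlation map. -/
noncomputable def corrMap (σb σw q c : ℝ) : ℝ := (σb ^ 2 + σw ^ 2 * tanhCorr q 0 c) / q

lemma bias_le_varNext (σb σw A : ℝ) : σb ^ 2 ≤ varNext σb σw A := by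
  have h : 0 ≤ tanhMean (tanhT 0 ^ 2) √A :=
    tanhMean_nonneg (fun t _ => by rw [Polynomial.eval_pow]; exact sq_nonneg _) _
  have := mul_nonneg (sq_nonneg σw) h
  unfold varNext
  linarith

lemma abs_covNext_le {σb σw A B c : ℝ} (hσ : 0 < σb ^ 2) (h1 : -1 ≤ c) (h2 : c ≤ 1) :
    |covNext σb σw A B c| ≤ √(varNext σb σw A * varNext σb σw B) := by
  have hA : 0 < varNext σb σw A := hσ.trans_le (bias_le_varNext _ _ _)
  have hB : 0 < varNext σb σw B := hσ.trans_le (bias_le_varNext _ _ _)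
  have sA := Real.sqrt_pos.2 hA
  have sB := Real.sqrt_pos.2 hB
  -- With this weight the arithmetic-geometric bound becomes the geometric mean of the two next
  -- variances; the bias fits in because `τ + τ⁻¹ ≥ 2`.
  set τ := √(varNext σb σw B) / √(varNext σb σw A) with hτ
  have hτ0 : 0 < τ := by positivity
  have h := abs_corrMean_le_sq (tanhT 0) √A √B h1 h2 hτ0
  have e : (τ * varNext σb σw A + τ⁻¹ * varNext σb σw B) / 2 =
      √(varNext σb σw A * varNext σb σw B) := by
    rw [Real.sqrt_mul hA.le, hτ]
    have e1 := Real.sq_sqrt hA.le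
    have e2 := Real.sq_sqrt hB.le
    generalize √(varNext σb σw A) = u at *
    generalize √(varNext σb σw B) = v at *
    rw [← e1, ← e2]
    field_simp
    ring
  have hτ1 : 2 ≤ τ + τ⁻¹ := by
    have h3 : 0 ≤ τ⁻¹ * (τ - 1) ^ 2 := by positivity
    have h4 : τ⁻¹ * (τ - 1) ^ 2 = τ + τ⁻¹ - 2 := by field_simp; ring
    linarith
  rw [← e]
  refine (abs_add_le _ _).trans ?_
  rw [abs_mul, abs_of_pos hσ, abs_of_nonneg (sq_nonneg σw)]
  have h5 := mul_le_mul_of_nonneg_left h (sq_nonneg σw)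
  have h6 := mul_le_mul_of_nonneg_left hτ1 hσ.le
  unfold varNext
  linarith

namespace TanhEOC

variable {σb σw q : ℝ}

lemma varNext_sub_le (h : TanhEOC σb σw q) {A : ℝ} (hA : 0 ≤ A) :
    |varNext σb σw A - q| ≤ |A - q| := by
  have h1 := (h.variance_step hA).1
  have h2 := h.rate_mem
  have h3 : 0 ≤ σb ^ 2 / q := div_nonneg (sq_nonneg _) h.pos.le
  exact h1.trans (mul_le_of_le_one_left (abs_nonneg _) (by linarith))

lemma covNext_one_le (h : TanhEOC σb σw q) (A B : ℝ) :
    covNext σb σw A B 1 ≤ √(varNext σb σw A * varNext σb σw B) :=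
  (le_abs_self _).trans (abs_covNext_le h.bias (by norm_num) le_rfl)

lemma exists_corr_lipschitz (h : TanhEOC σb σw q) (k : ℕ) : ∃ C ≥ 0, ∀ A B c : ℝ, -1 ≤ c → c ≤ 1 →
    |σw ^ 2 * corrMean (tanhT k) (tanhT k) √A √B c - σw ^ 2 * tanhCorr q k c| ≤
      C * (|A - q| + |B - q|) := by
  obtain ⟨C, hC, hl⟩ := corrMean_lipschitz (tanhT k) (tanhT k)
  have hs := Real.sqrt_pos.2 h.pos
  have hw := h.weight_pos
  refine ⟨σw ^ 2 * (C / √q), by positivity, fun A B c h1 h2 => ?_⟩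
  rw [← mul_sub, abs_mul, abs_of_pos hw, mul_assoc]
  gcongr
  refine (hl _ _ _ _ c h1 h2).trans ?_
  rw [div_mul_eq_mul_div, mul_div_assoc, add_div]
  gcongr
  · exact h.abs_sqrt_sub_le A
  · exact h.abs_sqrt_sub_le B

/-- The correlation of the next layer is close to the limiting correlation map. -/
lemma exists_corr_step (h : TanhEOC σb σw q) : ∃ C ≥ 0, ∀ A B c : ℝ, 0 ≤ A → 0 ≤ B →
    -1 ≤ c → c ≤ 1 →
    |covNext σb σw A B c / √(varNext σb σw A * varNext σb σw B) - corrMap σb σw q c| ≤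
        C * (|A - q| + |B - q|) ∧
      |covNext σb σw A B c / q - corrMap σb σw q c| ≤ C * (|A - q| + |B - q|) := by
  obtain ⟨C, hC, hl⟩ := h.exists_corr_lipschitz 0
  have hq := h.pos
  refine ⟨(1 + C) / q, by positivity, fun A B c hA hB h1 h2 => ?_⟩
  have hN := hl A B c h1 h2
  have hA' := h.varNext_sub_le hA
  have hB' := h.varNext_sub_le hB
  have pA : 0 < varNext σb σw A := h.bias.trans_le (bias_le_varNext _ _ _)
  have pB : 0 < varNext σb σw B := h.bias.trans_le (bias_le_varNext _ _ _)
  have hS := abs_sqrt_mul_sub_le (δ := |A - q| + |B - q|) hq.le pA.le pB.le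
    (hA'.trans (by linarith [abs_nonneg (B - q)])) (hB'.trans (by linarith [abs_nonneg (A - q)]))
  have hNS := abs_covNext_le (A := A) (B := B) (σw := σw) h.bias h1 h2
  have hSp : 0 < √(varNext σb σw A * varNext σb σw B) := Real.sqrt_pos.2 (mul_pos pA pB)
  have hN' : |covNext σb σw A B c - (σb ^ 2 + σw ^ 2 * tanhCorr q 0 c)| ≤
      C * (|A - q| + |B - q|) := by
    unfold covNext
    rwa [add_sub_add_left_eq_sub]
  rw [corrMap]
  generalize √(varNext σb σw A * varNext σb σw B) = S at *
  generalize covNext σb σw A B c = N at *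
  generalize σb ^ 2 + σw ^ 2 * tanhCorr q 0 c = N' at *
  generalize hδ : |A - q| + |B - q| = δ at *
  have hδ0 : 0 ≤ δ := (abs_nonneg _).trans hS
  have hr : |N / S| ≤ 1 := by
    rw [abs_div, abs_of_pos hSp, div_le_one hSp]; exact hNS
  constructor
  · have e : N / S - N' / q = (-(N / S * (S - q)) + (N - N')) / q := by
      field_simp; ring
    rw [e, abs_div, abs_of_pos hq, div_mul_eq_mul_div (1 + C)]
    refine div_le_div_of_nonneg_right ?_ hq.le
    refine (abs_add_le _ _).trans ?_
    rw [abs_neg, abs_mul]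
    have := mul_le_mul hr hS (abs_nonneg _) zero_le_one
    linarith
  · rw [← sub_div, abs_div, abs_of_pos hq, div_mul_eq_mul_div]
    exact div_le_div_of_nonneg_right (by linarith) hq.le

/-- Lower bounds for the correlation defect of the next layer. -/
lemma exists_defect_lower (h : TanhEOC σb σw q) (R : ℝ) : ∃ κ > 0, ∃ C ≥ 0, ∀ A B c : ℝ,
    σb ^ 2 ≤ A → A ≤ R → σb ^ 2 ≤ B → B ≤ R → -1 ≤ c → c ≤ 1 →
    κ * (1 - c) ≤ 1 - covNext σb σw A B c / √(varNext σb σw A * varNext σb σw B) ∧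
      (1 - c) * (1 - C * (|A - q| + |B - q|) - C * (1 - c)) ≤
        1 - covNext σb σw A B c / √(varNext σb σw A * varNext σb σw B) := by
  obtain ⟨κ, hκ, hlow⟩ := exists_corrMean_lower √R
  obtain ⟨C, hC, hl⟩ := h.exists_corr_lipschitz 1
  have hq := h.pos
  have hw := h.weight_pos
  have hm := tanhMoment_nonneg q 2
  have hb := h.bias
  refine ⟨σw ^ 2 * κ * σb ^ 2 / (q + 2 * (|R| + q)), by positivity,
    2 / q + C + σw ^ 2 * (q * tanhMoment q 2), by positivity,
    fun A B c hA hAR hB hBR h1 h2 => ?_⟩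
  have hA0 : 0 < A := hb.trans_le hA
  have hB0 : 0 < B := hb.trans_le hB
  have hA' := h.varNext_sub_le hA0.le
  have hB' := h.varNext_sub_le hB0.le
  have pA : 0 < varNext σb σw A := hb.trans_le (bias_le_varNext _ _ _)
  have pB : 0 < varNext σb σw B := hb.trans_le (bias_le_varNext _ _ _)
  have hS := abs_sqrt_mul_sub_le (δ := |A - q| + |B - q|) hq.le pA.le pB.le
    (hA'.trans (by linarith [abs_nonneg (B - q)])) (hB'.trans (by linarith [abs_nonneg (A - q)]))
  have hT := abs_sqrt_mul_sub_le (δ := |A - q| + |B - q|) hq.le hA0.le hB0.le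
    (by linarith [abs_nonneg (B - q)]) (by linarith [abs_nonneg (A - q)])
  have hSp : 0 < √(varNext σb σw A * varNext σb σw B) := Real.sqrt_pos.2 (mul_pos pA pB)
  have hTp : σb ^ 2 ≤ √(A * B) := by
    apply Real.le_sqrt_of_sq_le
    rw [sq (σb ^ 2)]
    exact mul_le_mul hA hB hb.le hA0.le
  have hδR : |A - q| + |B - q| ≤ 2 * (|R| + q) := by
    have a1 : |A - q| ≤ |R| + q := (abs_sub _ _).trans (by
      rw [abs_of_pos hA0, abs_of_pos hq]; linarith [le_abs_self R])
    have a2 : |B - q| ≤ |R| + q := (abs_sub _ _).trans (by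
      rw [abs_of_pos hB0, abs_of_pos hq]; linarith [le_abs_self R])
    linarith
  have hone := h.covNext_one_le A B
  rcases h2.eq_or_lt with rfl | h2
  · have : 0 ≤ 1 - covNext σb σw A B 1 / √(varNext σb σw A * varNext σb σw B) := by
      rw [sub_nonneg, div_le_one hSp]; exact hone
    simpa using this
  obtain ⟨ξ, hξ, e⟩ := exists_corrMean_slope (tanhT 0) (tanhT 0) √A √B h1 h2
  have hξ1 : -1 ≤ ξ := h1.trans hξ.1.le
  have hy := hlow √A √B ξ (Real.sqrt_nonneg _) (Real.sqrt_le_sqrt hAR) (Real.sqrt_nonneg _)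
    (Real.sqrt_le_sqrt hBR) hξ1 hξ.2.le
  have hyl := hl A B ξ hξ1 hξ.2.le
  have hyq := abs_tanhCorr_sub_le hq.le 1 hξ1 hξ.2.le
  have hchi : σw ^ 2 * tanhMoment q 1 = 1 := h.chi
  have hN : covNext σb σw A B c = covNext σb σw A B 1 - σw ^ 2 * ((1 - c) *
      (√(A * B) * corrMean (tanhT 1) (tanhT 1) √A √B ξ)) := by
    have e' : corrMean (tanhT 0) (tanhT 0) √A √B 1 - corrMean (tanhT 0) (tanhT 0) √A √B c =
      (1 - c) * (√(A * B) * corrMean (tanhT 1) (tanhT 1) √A √B ξ) := by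
      rw [e, Real.sqrt_mul hA0.le]; rfl
    unfold covNext
    rw [← e']; ring
  have hx : 0 < 1 - c := by linarith
  have hw1 : 1 - C * (|A - q| + |B - q|) - σw ^ 2 * (q * tanhMoment q 2) * (1 - c) ≤
      σw ^ 2 * corrMean (tanhT 1) (tanhT 1) √A √B ξ := by
    have b1 := (abs_le.1 hyl).1
    have b2 := mul_le_mul_of_nonneg_left (abs_le.1 hyq).1 hw.le
    have b3 : σw ^ 2 * (q * tanhMoment q 2 * (1 - ξ)) ≤
        σw ^ 2 * (q * tanhMoment q 2 * (1 - c)) := by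
      gcongr
      exact hξ.1.le
    linarith
  generalize corrMean (tanhT 1) (tanhT 1) √A √B ξ = y at *
  rw [hN]
  generalize √(varNext σb σw A * varNext σb σw B) = S at *
  generalize √(A * B) = T at *
  generalize covNext σb σw A B 1 = N at *
  generalize |A - q| + |B - q| = δ at *
  have hδ0 : 0 ≤ δ := (abs_nonneg _).trans hS
  have hy0 : 0 < y := hκ.trans_le hy
  have hT0 : 0 < T := hb.trans_le hTp
  -- At `c = 1` unequal variances may already create a defect, but by Cauchy-Schwarz a nonnegative
  -- one, which is dropped. The remaining bound is proportional to `1 - c`; an additive error would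
  -- not prevent the defect from collapsing.
  have hred : σw ^ 2 * ((1 - c) * (T * y)) / S ≤ 1 - (N - σw ^ 2 * ((1 - c) * (T * y))) / S := by
    rw [sub_div]
    have : N / S ≤ 1 := (div_le_one hSp).2 hone
    linarith
  have hSle : S ≤ q + δ := by linarith [(abs_le.1 hS).2]
  constructor
  · refine le_trans ?_ hred
    rw [div_mul_eq_mul_div]
    apply div_le_div₀ (by positivity) _ hSp (by linarith)
    calc σw ^ 2 * κ * σb ^ 2 * (1 - c) = σw ^ 2 * ((1 - c) * (σb ^ 2 * κ)) := by ring
      _ ≤ _ := by gcongr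
  · refine le_trans ?_ hred
    -- Both geometric means are within `δ` of `q`, and `(1 - 2 δ / q)(q + δ) ≤ q - δ`.
    have hr : 1 - 2 / q * δ ≤ T / S := by
      have hT1 : q - δ ≤ T := by linarith [(abs_le.1 hT).1]
      rcases le_total (1 - 2 / q * δ) 0 with h0 | h0
      · exact h0.trans (by positivity)
      · rw [le_div_iff₀ hSp]
        refine le_trans ?_ hT1
        calc (1 - 2 / q * δ) * S ≤ (1 - 2 / q * δ) * (q + δ) := by gcongr
          _ = q - δ - 2 / q * δ ^ 2 := by field_simp; ring
          _ ≤ q - δ := by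
            have : 0 ≤ 2 / q * δ ^ 2 := by positivity
            linarith
    have e3 : σw ^ 2 * ((1 - c) * (T * y)) / S = (1 - c) * (T / S * (σw ^ 2 * y)) := by
      field_simp
    rw [e3]
    have hD0 : 0 ≤ σw ^ 2 * (q * tanhMoment q 2) := by positivity
    generalize σw ^ 2 * (q * tanhMoment q 2) = D at *
    refine mul_le_mul_of_nonneg_left ?_ hx.le
    have hD : 0 ≤ C * δ := by positivity
    have hD' : 0 ≤ D * δ := by positivity
    have hE : 0 ≤ D * (1 - c) := by positivity
    have g1 : 0 ≤ 2 / q * δ := by positivity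
    have g2 : 0 ≤ (2 / q + C) * (1 - c) := by positivity
    refine le_trans (b := 1 - C * δ - D * (1 - c) - 2 / q * δ) (by linarith) ?_
    set w := 1 - C * δ - D * (1 - c) with hwd
    rcases le_total w 0 with h0 | h0
    · have g0 : 0 ≤ T / S * (σw ^ 2 * y) := by positivity
      linarith
    · have g3 : T / S * w ≤ T / S * (σw ^ 2 * y) := by gcongr
      have g4 : (1 - 2 / q * δ) * w ≤ T / S * w := by gcongr
      have g5 : 2 / q * δ * w ≤ 2 / q * δ := mul_le_of_le_one_right g1 (by linarith)
      linarith

end TanhEOC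

/-! ### The limiting correlation map and the Tanh kernel off the diagonal. -/

namespace TanhEOC

variable {σb σw q : ℝ}

/-- The expansion of the limiting correlation map at `1`. -/
lemma corrMap_expansion (h : TanhEOC σb σw q) {c : ℝ} (h1 : -1 ≤ c) (h2 : c ≤ 1) :
    |(1 - corrMap σb σw q c) - ((1 - c) - σw ^ 2 * q * tanhMoment q 2 / 2 * (1 - c) ^ 2 +
      σw ^ 2 * q ^ 2 * tanhMoment q 3 / 6 * (1 - c) ^ 3)| ≤
        σw ^ 2 * q ^ 3 * tanhMoment q 4 * (1 - c) ^ 4 := by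
  have hq := h.pos
  have hfix : σb ^ 2 + σw ^ 2 * tanhMoment q 0 = q := h.fixed
  have hchi : σw ^ 2 * tanhMoment q 1 = 1 := h.chi
  have he := tanhCorr_expansion_zero hq.le h1 h2
  rw [corrMap]
  generalize tanhCorr q 0 c = f at *
  generalize tanhMoment q 0 = m₀ at *
  generalize tanhMoment q 1 = m₁ at *
  generalize tanhMoment q 2 = m₂ at *
  generalize tanhMoment q 3 = m₃ at *
  generalize tanhMoment q 4 = m₄ at *
  have e : (1 - (σb ^ 2 + σw ^ 2 * f) / q) - ((1 - c) - σw ^ 2 * q * m₂ / 2 * (1 - c) ^ 2 +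
      σw ^ 2 * q ^ 2 * m₃ / 6 * (1 - c) ^ 3) =
      -(σw ^ 2 / q * (f - (m₀ - q * m₁ * (1 - c) + q ^ 2 * m₂ / 2 * (1 - c) ^ 2 -
        q ^ 3 * m₃ / 6 * (1 - c) ^ 3))) := by
    field_simp
    linear_combination (-12) * hfix + 12 * q * (1 - c) * hchi
  rw [e, abs_neg, abs_mul, abs_of_nonneg (by positivity : 0 ≤ σw ^ 2 / q)]
  calc _ ≤ σw ^ 2 / q * (q ^ 4 * m₄ * (1 - c) ^ 4) := by gcongr
    _ = _ := by field_simp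

lemma abs_one_sub_corrMap_le (h : TanhEOC σb σw q) {c : ℝ} (h1 : -1 ≤ c) (h2 : c ≤ 1) :
    |1 - corrMap σb σw q c| ≤ 1 - c := by
  have hq := h.pos
  have hfix : σb ^ 2 + σw ^ 2 * tanhMoment q 0 = q := h.fixed
  have hchi : σw ^ 2 * tanhMoment q 1 = 1 := h.chi
  have he := abs_tanhCorr_sub_le hq.le 0 h1 h2
  have e : 1 - corrMap σb σw q c = -(σw ^ 2 / q * (tanhCorr q 0 c - tanhMoment q 0)) := by
    rw [corrMap]; field_simp; linear_combination -hfix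
  rw [e, abs_neg, abs_mul, abs_of_nonneg (by positivity : 0 ≤ σw ^ 2 / q)]
  calc _ ≤ σw ^ 2 / q * (q * tanhMoment q (0 + 1) * (1 - c)) := by gcongr
    _ = σw ^ 2 * tanhMoment q 1 * (1 - c) := by field_simp
    _ = _ := by rw [hchi, one_mul]

/-- The derivative of the correlation map is at most its value at 1, which is `χ(q) = 1` on the Edge
of Chaos. This carries the gain of correlation obtained near 1 over to all of `[-1, 1]`. -/
lemma corrMap_sub_antitone (h : TanhEOC σb σw q) :
    AntitoneOn (fun c => corrMap σb σw q c - c) (Set.Icc (-1) 1) := by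
  have hq := h.pos
  have hw := h.weight_pos
  have hchi : σw ^ 2 * tanhMoment q 1 = 1 := h.chi
  refine antitoneOn_of_hasDerivWithinAt_nonpos (convex_Icc _ _)
    (f' := fun c => σw ^ 2 * (q * tanhCorr q 1 c) / q - 1)
    ((((continuousOn_const.mul (continuousOn_tanhCorr q 0)).const_add _).div_const _).sub
      continuousOn_id) (fun c hc => ?_) fun c hc => ?_
  · rw [interior_Icc] at hc
    exact (((((hasDerivAt_tanhCorr hq.le 0 hc.1 hc.2).const_mul _).const_add _).div_const _).sub
      (hasDerivAt_id c)).hasDerivWithinAt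
  · rw [interior_Icc] at hc
    have h3 := (abs_le.1 (abs_tanhCorr_le (q := q) 1 hc.1.le hc.2.le)).2
    have h4 : σw ^ 2 * tanhCorr q 1 c ≤ 1 := by
      rw [← hchi]; gcongr
    have e : σw ^ 2 * (q * tanhCorr q 1 c) / q = σw ^ 2 * tanhCorr q 1 c := by field_simp
    rw [e]; linarith

/-- The limiting correlation map increases correlations quadratically. -/
lemma exists_corrMap_quadratic (h : TanhEOC σb σw q) : ∃ a > 0, ∀ c, -1 ≤ c → c ≤ 1 →
    1 - corrMap σb σw q c ≤ (1 - c) - a * (1 - c) ^ 2 := by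
  have hexp := fun c (h1 : -1 ≤ c) (h2 : c ≤ 1) => h.corrMap_expansion h1 h2
  have hq := h.pos
  have hw := h.weight_pos
  have ha : 0 < σw ^ 2 * q * tanhMoment q 2 / 2 := by
    have := (tanhMoment_inequality hq).1
    positivity
  have hC : 0 ≤ σw ^ 2 * q ^ 3 * tanhMoment q 4 := by
    have := tanhMoment_nonneg q 4
    positivity
  have hb : 0 ≤ σw ^ 2 * q ^ 2 * tanhMoment q 3 / 6 := by
    have := tanhMoment_nonneg q 3
    positivity
  generalize σw ^ 2 * q * tanhMoment q 2 / 2 = a at *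
  generalize σw ^ 2 * q ^ 2 * tanhMoment q 3 / 6 = b at *
  generalize σw ^ 2 * q ^ 3 * tanhMoment q 4 = C at *
  -- The range in which the terms of order three and four take at most half of the quadratic one.
  set γ := min 1 (a / (2 * (b + C + 1))) with hγ
  have hγ0 : 0 < γ := lt_min one_pos (by positivity)
  have hγ1 : γ ≤ 1 := min_le_left _ _
  have hγ2 : (b + C) * γ ≤ a / 2 := by
    have h1 : γ ≤ a / (2 * (b + C + 1)) := min_le_right _ _
    rw [le_div_iff₀ (by positivity)] at h1
    linarith
  have hlocal : ∀ c, 1 - γ ≤ c → c ≤ 1 →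
      1 - corrMap σb σw q c ≤ (1 - c) - a / 2 * (1 - c) ^ 2 := by
    intro c h1 h2
    have h3 := (abs_le.1 (hexp c (by linarith) h2)).2
    have hx0 : 0 ≤ 1 - c := by linarith
    have hx1 : 1 - c ≤ γ := by linarith
    generalize 1 - c = x at *
    have h4 : C * x ^ 4 ≤ C * x ^ 3 := by
      gcongr C * ?_
      exact pow_le_pow_of_le_one hx0 (hx1.trans hγ1) (by norm_num)
    have h5 : (b + C) * x ^ 3 ≤ a / 2 * x ^ 2 := by
      calc (b + C) * x ^ 3 = (b + C) * x * x ^ 2 := by ring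
        _ ≤ (b + C) * γ * x ^ 2 := by gcongr
        _ ≤ _ := by gcongr
    linarith
  -- Away from 1, monotonicity guarantees a gain of `a / 2 * γ ^ 2`, and `(1 - c) ^ 2 ≤ 4`.
  refine ⟨a / 8 * γ ^ 2, by positivity, fun c h1 h2 => ?_⟩
  have hx0 : 0 ≤ 1 - c := by linarith
  have hγs : γ ^ 2 ≤ 1 := pow_le_one₀ hγ0.le hγ1
  rcases le_total (1 - γ) c with h3 | h3
  · have h4 : a / 8 * γ ^ 2 * (1 - c) ^ 2 ≤ a / 2 * (1 - c) ^ 2 := by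
      refine mul_le_mul_of_nonneg_right ?_ (sq_nonneg _)
      calc a / 8 * γ ^ 2 ≤ a / 8 * 1 := by gcongr
        _ ≤ _ := by linarith
    linarith [hlocal c h3 h2]
  · have h4 := h.corrMap_sub_antitone ⟨h1, h2⟩ ⟨by linarith, by linarith⟩ h3
    have h5 := hlocal (1 - γ) le_rfl (by linarith)
    rw [sub_sub_cancel] at h5
    simp only at h4
    have h6 : (1 - c) ^ 2 ≤ 2 ^ 2 := by
      apply pow_le_pow_left₀ hx0; linarith
    have h7 : a / 8 * γ ^ 2 * (1 - c) ^ 2 ≤ a / 8 * γ ^ 2 * 2 ^ 2 := by gcongr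
    linarith

lemma varSeq_succ_eq_varNext {a : ℝ} (ha : 0 ≤ a) (l : ℕ) : varSeq Real.tanh σb σw a (l + 1) =
    varNext σb σw (varSeq Real.tanh σb σw a l) :=
  (varSeq_tanh_nonneg σb σw ha l).2

lemma covSeq_succ_eq_covNext (a b p : ℝ) (l : ℕ) : covSeq Real.tanh σb σw a b p (l + 1) =
    covNext σb σw (varSeq Real.tanh σb σw a l) (varSeq Real.tanh σb σw b l)
      (covSeq Real.tanh σb σw a b p l /
        √(varSeq Real.tanh σb σw a l * varSeq Real.tanh σb σw b l)) := by
  rw [covSeq, ← tanhPoly_X, gaussE_tanhPoly]; rfl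

lemma dotSeq_eq_corrMean (a b p : ℝ) (l : ℕ) : dotSeq Real.tanh σb σw a b p l =
    σw ^ 2 * corrMean (tanhT 1) (tanhT 1) √(varSeq Real.tanh σb σw a l)
      √(varSeq Real.tanh σb σw b l) (covSeq Real.tanh σb σw a b p l /
        √(varSeq Real.tanh σb σw a l * varSeq Real.tanh σb σw b l)) := by
  rw [dotSeq, deriv_tanh_eq_tanhPoly, gaussE_tanhPoly]; rfl

/-- The factor expands as `1 - σw² q m₂ (1 - c)`, where `mₖ` is `tanhMoment q k`, and the defect has
quadratic coefficient half of that: `D = 2A` whatever the parameters, hence the slope `1 / 3`. Using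
`σw² m₁ = 1` to rewrite `B`, the moment inequality becomes `A² < B`, so `κ` is not zero; it depends
neither on `R` nor on `ε`. -/
theorem ntkSeq_asymptotics (h : TanhEOC σb σw q) : ∃ κ : ℝ, κ ≠ 0 ∧ ∀ R ε : ℝ, 0 < ε →
    ∃ K ≥ 0, ∀ a b p : ℝ, σb ^ 2 ≤ a → a ≤ R → σb ^ 2 ≤ b → b ≤ R → |p| ≤ √(a * b) →
      p / √(a * b) ≤ 1 - ε → ∀ l : ℕ,
      |ntkSeq Real.tanh σb σw a b p l - q * (((l : ℝ) + 1) / 3 + κ * Real.log ((l : ℝ) + 1))| ≤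
        K := by
  have hq := h.pos
  have hw := h.weight_pos
  have hb := h.bias
  obtain ⟨hm2, hineq⟩ := tanhMoment_inequality hq
  have hchi : σw ^ 2 * tanhMoment q 1 = 1 := h.chi
  set A := σw ^ 2 * q * tanhMoment q 2 / 2 with hA
  set B := σw ^ 2 * q ^ 2 * tanhMoment q 3 / 6 with hB
  have hA0 : 0 < A := by positivity
  have hAB : A ^ 2 - B < 0 := by
    have e1 : A ^ 2 = σw ^ 4 * q ^ 2 / 12 * (3 * tanhMoment q 2 ^ 2) := by rw [hA]; ring
    have e2 : B = σw ^ 4 * q ^ 2 / 12 * (2 * (tanhMoment q 1 * tanhMoment q 3)) := by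
      rw [hB]
      linear_combination (-(σw ^ 2 * q ^ 2 * tanhMoment q 3 / 6)) * hchi
    have hw4 : 0 < σw ^ 4 := by
      have : σw ^ 4 = (σw ^ 2) ^ 2 := by ring
      rw [this]; positivity
    have : A ^ 2 < B := by
      rw [e1, e2]
      exact mul_lt_mul_of_pos_left hineq (by positivity)
    linarith
  refine ⟨(A ^ 2 - B) / A ^ 2 / 3, div_ne_zero (div_ne_zero hAB.ne (by positivity)) (by norm_num),
    fun R ε hε => ?_⟩
  obtain ⟨Cv, hCv, hrate⟩ := h.exists_varSeq_rate (|R| + q)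
  obtain ⟨a', ha', hquad⟩ := h.exists_corrMap_quadratic
  obtain ⟨C1, hC1, hstep⟩ := h.exists_corr_step
  obtain ⟨C2, hC2, hdot⟩ := h.exists_corr_lipschitz 1
  obtain ⟨C3, hC3, hlin⟩ := tanhCorr_one_linear hq.le
  obtain ⟨κ, hκ, C4, hC4, hlow⟩ := h.exists_defect_lower (|R| + q + (|R| + q))
  have hm4 := tanhMoment_nonneg q 4
  set C5 := σw ^ 2 * q ^ 3 * tanhMoment q 4 with hC5
  have hC50 : 0 ≤ C5 := by positivity
  set C := C1 * (2 * Cv) + C2 * (2 * Cv) + σw ^ 2 * C3 + C4 * (2 * Cv) + C4 + C5 + 1 with hC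
  have hCnn : 0 ≤ C := by positivity
  obtain ⟨K, hK, key⟩ := kernel_of_defect (b := B) (D := 2 * A) (M := 2) (K₀ := |R| / q) hκ hCnn
    hA0 ha' hε two_pos (by linarith)
  refine ⟨q * K, by positivity, fun a b p ha haR hb' hbR hp hpe l => ?_⟩
  have ha0 : 0 < a := hb.trans_le ha
  have hb0 : 0 < b := hb.trans_le hb'
  set α := varSeq Real.tanh σb σw a with hα
  set β := varSeq Real.tanh σb σw b with hβ
  set c : ℕ → ℝ := fun l => covSeq Real.tanh σb σw a b p l / √(α l * β l) with hc
  have hαs : ∀ l, α (l + 1) = varNext σb σw (α l) := varSeq_succ_eq_varNext ha0.le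
  have hβs : ∀ l, β (l + 1) = varNext σb σw (β l) := varSeq_succ_eq_varNext hb0.le
  have hαl : ∀ l, σb ^ 2 ≤ α l := bias_le_varSeq_tanh ha
  have hβl : ∀ l, σb ^ 2 ≤ β l := bias_le_varSeq_tanh hb'
  have hα0 : ∀ l, 0 ≤ α l := fun l => hb.le.trans (hαl l)
  have hβ0 : ∀ l, 0 ≤ β l := fun l => hb.le.trans (hβl l)
  have hcov : ∀ l, covSeq Real.tanh σb σw a b p (l + 1) = covNext σb σw (α l) (β l) (c l) :=
    covSeq_succ_eq_covNext a b p
  have hcs : ∀ l, c (l + 1) = covNext σb σw (α l) (β l) (c l) /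
      √(varNext σb σw (α l) * varNext σb σw (β l)) := fun l => by
    rw [← hcov, ← hαs, ← hβs]
  have hcm : ∀ l, -1 ≤ c l ∧ c l ≤ 1 := fun l => by
    induction l with
    | zero => exact corr_mem ha0 hb0 hp
    | succ l ih =>
      rw [hcs]
      exact corr_mem (hb.trans_le (bias_le_varNext _ _ _)) (hb.trans_le (bias_le_varNext _ _ _))
        (abs_covNext_le hb ih.1 ih.2)
  have hδα : ∀ l : ℕ, |α l - q| ≤ Cv / ((l : ℝ) + 1) ^ 4 :=
    hrate a ha0.le (by linarith [le_abs_self R])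
  have hδβ : ∀ l : ℕ, |β l - q| ≤ Cv / ((l : ℝ) + 1) ^ 4 :=
    hrate b hb0.le (by linarith [le_abs_self R])
  have hδ : ∀ l : ℕ, |α l - q| + |β l - q| ≤ 2 * Cv * (1 / ((l : ℝ) + 1) ^ 4) := fun l => by
    have e : 2 * Cv * (1 / ((l : ℝ) + 1) ^ 4) =
      Cv / ((l : ℝ) + 1) ^ 4 + Cv / ((l : ℝ) + 1) ^ 4 := by ring
    rw [e]; exact add_le_add (hδα l) (hδβ l)
  have hbd : ∀ x, 0 ≤ x → x ≤ R → ∀ l : ℕ,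
      varSeq Real.tanh σb σw x l ≤ |R| + q + (|R| + q) := fun x hx hxR l => by
    have h1 := h.abs_varSeq_sub_le hx l
    have h2 : (1 - σb ^ 2 / q) ^ l * |x - q| ≤ |x - q| :=
      mul_le_of_le_one_left (abs_nonneg _) (pow_le_one₀ h.rate_mem.1 h.rate_mem.2.le)
    have h3 : |x - q| ≤ |R| + q := (abs_sub _ _).trans (by
      rw [abs_of_nonneg hx, abs_of_pos hq]; linarith [le_abs_self R])
    linarith [(abs_le.1 h1).2, abs_nonneg R]
  have hαR := hbd a ha0.le haR
  have hβR := hbd b hb0.le hbR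
  have ht : ∀ l : ℕ, 0 ≤ 1 / ((l : ℝ) + 1) ^ 4 := fun l => by positivity
  have hCt : ∀ l : ℕ, C / ((l : ℝ) + 1) ^ 4 = C * (1 / ((l : ℝ) + 1) ^ 4) := fun l => by ring
  have p1 : 0 ≤ C1 * (2 * Cv) := by positivity
  have p2 : 0 ≤ C2 * (2 * Cv) := by positivity
  have p3 : 0 ≤ σw ^ 2 * C3 := by positivity
  have p4 : 0 ≤ C4 * (2 * Cv) := by positivity
  have s1 : ∀ l, |c (l + 1) - corrMap σb σw q (c l)| ≤
      C1 * (2 * Cv) * (1 / ((l : ℝ) + 1) ^ 4) := fun l => by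
    rw [hcs, mul_assoc C1]
    exact (hstep _ _ _ (hα0 l) (hβ0 l) (hcm l).1 (hcm l).2).1.trans
      (mul_le_mul_of_nonneg_left (hδ l) hC1)
  have s2 : ∀ l, |covSeq Real.tanh σb σw a b p (l + 1) / q - corrMap σb σw q (c l)| ≤
      C1 * (2 * Cv) * (1 / ((l : ℝ) + 1) ^ 4) := fun l => by
    rw [hcov, mul_assoc C1]
    exact (hstep _ _ _ (hα0 l) (hβ0 l) (hcm l).1 (hcm l).2).2.trans
      (mul_le_mul_of_nonneg_left (hδ l) hC1)
  have hlow' := fun l => hlow _ _ _ (hαl l) (hαR l) (hβl l) (hβR l) (hcm l).1 (hcm l).2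
  have := key (fun l => 1 - c l) (dotSeq Real.tanh σb σw a b p)
    (fun l => covSeq Real.tanh σb σw a b p (l + 1) / q)
    (fun l => ntkSeq Real.tanh σb σw a b p l / q)
    (by
      have : c 0 = p / √(a * b) := rfl
      rw [this]; linarith)
    (fun l => by linarith [(hcm l).1])
    (fun l => by rw [hcs]; exact (hlow' l).1)
    (fun l => by
      rw [hcs]
      refine le_trans ?_ (hlow' l).2
      refine mul_le_mul_of_nonneg_left ?_ (by linarith [(hcm l).2])
      rw [hCt]
      have h1 := mul_le_mul_of_nonneg_left (hδ l) hC4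
      have h2 : C4 * (2 * Cv) * (1 / ((l : ℝ) + 1) ^ 4) ≤ C * (1 / ((l : ℝ) + 1) ^ 4) :=
        mul_le_mul_of_nonneg_right (by linarith) (ht l)
      have h3 : C4 * (1 - c l) ≤ C * (1 - c l) :=
        mul_le_mul_of_nonneg_right (by linarith) (by linarith [(hcm l).2])
      linarith)
    (fun l => by
      have h1 := hquad (c l) (hcm l).1 (hcm l).2
      have h2 := (abs_le.1 (s1 l)).1
      have h3 : C1 * (2 * Cv) * (1 / ((l : ℝ) + 1) ^ 4) ≤ C * (1 / ((l : ℝ) + 1) ^ 4) :=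
        mul_le_mul_of_nonneg_right (by linarith) (ht l)
      rw [hCt]
      linarith)
    (fun l => by
      have h1 := h.corrMap_expansion (hcm l).1 (hcm l).2
      have h2 := s1 l
      have e : 1 - c (l + 1) - (1 - c l - A * (1 - c l) ^ 2 + B * (1 - c l) ^ 3) =
        ((1 - corrMap σb σw q (c l)) - (1 - c l - A * (1 - c l) ^ 2 + B * (1 - c l) ^ 3)) -
          (c (l + 1) - corrMap σb σw q (c l)) := by ring
      rw [e]
      refine (abs_sub _ _).trans ?_
      have h3 : C1 * (2 * Cv) * (1 / ((l : ℝ) + 1) ^ 4) ≤ C * (1 / ((l : ℝ) + 1) ^ 4) :=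
        mul_le_mul_of_nonneg_right (by linarith) (ht l)
      have h4 : C5 * (1 - c l) ^ 4 ≤ C * (1 - c l) ^ 4 :=
        mul_le_mul_of_nonneg_right (by linarith)
          (pow_nonneg (by linarith [(hcm l).2]) 4)
      linarith)
    (by
      rw [ntkSeq, abs_div, abs_of_pos hq]
      refine div_le_div_of_nonneg_right (hp.trans ?_) hq.le
      rw [Real.sqrt_le_iff]
      refine ⟨abs_nonneg _, ?_⟩
      rw [sq]
      exact mul_le_mul (haR.trans (le_abs_self _)) (hbR.trans (le_abs_self _)) hb0.le
        (abs_nonneg _))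
    (fun l => by rw [ntkSeq]; ring)
    (fun l => by
      have h1 := hdot (α l) (β l) (c l) (hcm l).1 (hcm l).2
      have h2 := hlin (c l) (hcm l).1 (hcm l).2
      rw [dotSeq_eq_corrMean]
      have e : σw ^ 2 * corrMean (tanhT 1) (tanhT 1) √(α l) √(β l) (c l) -
          (1 - 2 * A * (1 - c l)) =
        (σw ^ 2 * corrMean (tanhT 1) (tanhT 1) √(α l) √(β l) (c l) -
          σw ^ 2 * tanhCorr q 1 (c l)) +
        σw ^ 2 * (tanhCorr q 1 (c l) - (tanhMoment q 1 - q * tanhMoment q 2 * (1 - c l))) := by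
        rw [hA]
        linear_combination hchi
      refine (congrArg abs e).le.trans ((abs_add_le _ _).trans ?_)
      rw [abs_mul (σw ^ 2), abs_of_pos hw]
      have h3 := mul_le_mul_of_nonneg_left h2 hw.le
      have h4 := mul_le_mul_of_nonneg_left (hδ l) hC2
      have h5 : C2 * (2 * Cv) * (1 / ((l : ℝ) + 1) ^ 4) ≤ C * (1 / ((l : ℝ) + 1) ^ 4) :=
        mul_le_mul_of_nonneg_right (by linarith) (ht l)
      have h6 : σw ^ 2 * C3 * (1 - c l) ^ 2 ≤ C * (1 - c l) ^ 2 :=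
        mul_le_mul_of_nonneg_right (by linarith) (sq_nonneg _)
      linarith)
    (fun l => by
      have h1 := s2 l
      have h2 := h.abs_one_sub_corrMap_le (hcm l).1 (hcm l).2
      have e : covSeq Real.tanh σb σw a b p (l + 1) / q - 1 =
        (covSeq Real.tanh σb σw a b p (l + 1) / q - corrMap σb σw q (c l)) -
          (1 - corrMap σb σw q (c l)) := by ring
      rw [e]
      refine (abs_sub _ _).trans ?_
      have h3 : C1 * (2 * Cv) * (1 / ((l : ℝ) + 1) ^ 4) ≤ C * (1 / ((l : ℝ) + 1) ^ 4) :=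
        mul_le_mul_of_nonneg_right (by linarith) (ht l)
      have h4 : 1 * (1 - c l) ≤ C * (1 - c l) :=
        mul_le_mul_of_nonneg_right (by linarith) (by linarith [(hcm l).2])
      linarith) l
  have e1 : 2 * A / A + 1 = 3 := by field_simp; norm_num
  rw [e1] at this
  have e3 : ntkSeq Real.tanh σb σw a b p l -
        q * (((l : ℝ) + 1) / 3 + (A ^ 2 - B) / A ^ 2 / 3 * Real.log ((l : ℝ) + 1)) =
      q * (ntkSeq Real.tanh σb σw a b p l / q - ((l : ℝ) + 1) / 3 -
        (A ^ 2 - B) / A ^ 2 / 3 * Real.log ((l : ℝ) + 1)) := by field_simp; ring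
  rw [e3, abs_mul, abs_of_pos hq]
  exact mul_le_mul_of_nonneg_left this hq.le

end TanhEOC

/-! ### Suprema -/

section Suprema

variable {V : Type*} {S : Set V} {k : ℕ → V → ℝ} {lim : V → ℝ}

lemma supBigO_inv {K : ℝ} (hK : 0 ≤ K)
    (h : ∀ s ∈ S, ∀ l : ℕ, |k (l + 1) s - ((l : ℝ) + 1) * lim s| ≤ K) :
    SupBigO S (fun L s => |k L s / L - lim s|) (fun L => 1 / L) := by
  refine ⟨K + 1, by positivity, ?_⟩
  filter_upwards [eventually_ge_atTop 1] with L hL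
  obtain ⟨l, rfl⟩ := Nat.exists_eq_add_of_le' hL
  have hpos : (0 : ℝ) < (l + 1 : ℕ) := by positivity
  have hub : ∀ y ∈ (fun s => |k (l + 1) s / (l + 1 : ℕ) - lim s|) '' S,
      y ≤ (K + 1) * (1 / (l + 1 : ℕ)) := by
    rintro _ ⟨s, hs, rfl⟩
    have e : k (l + 1) s / (l + 1 : ℕ) - lim s =
        (k (l + 1) s - ((l : ℝ) + 1) * lim s) / (l + 1 : ℕ) := by
      field_simp; push_cast; ring
    simp only
    rw [e, abs_div, abs_of_pos hpos, mul_one_div]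
    exact div_le_div_of_nonneg_right ((h s hs l).trans (by linarith)) hpos.le
  exact ⟨⟨_, hub⟩, Real.sSup_le hub (by positivity)⟩

lemma supTheta_inv {K η : ℝ} (hK : 0 ≤ K) (hη : 0 < η)
    (h : ∀ s ∈ S, ∀ l : ℕ, |k (l + 1) s - ((l : ℝ) + 1) * lim s| ≤ K)
    {s₀ : V} (hs₀ : s₀ ∈ S)
    (hlow : ∀ l : ℕ, η ≤ |k (l + 1 + 1) s₀ - (((l + 1 : ℕ) : ℝ) + 1) * lim s₀|) :
    SupTheta S (fun L s => |k L s / L - lim s|) (fun L => 1 / L) := by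
  obtain ⟨B, hB, hb⟩ := supBigO_inv hK h
  refine ⟨η, hη, B, hB, ?_⟩
  filter_upwards [hb, eventually_ge_atTop 2] with L hL hL2
  refine ⟨hL.1, le_trans ?_ (le_csSup hL.1 ⟨s₀, hs₀, rfl⟩), hL.2⟩
  obtain ⟨l, rfl⟩ := Nat.exists_eq_add_of_le' hL2
  have hpos : (0 : ℝ) < (l + 1 + 1 : ℕ) := by positivity
  have e : k (l + 1 + 1) s₀ / (l + 1 + 1 : ℕ) - lim s₀ =
      (k (l + 1 + 1) s₀ - (((l + 1 : ℕ) : ℝ) + 1) * lim s₀) / (l + 1 + 1 : ℕ) := by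
    field_simp; push_cast; ring
  show η * (1 / ((l + 1 + 1 : ℕ) : ℝ)) ≤ |k (l + 1 + 1) s₀ / ((l + 1 + 1 : ℕ) : ℝ) - lim s₀|
  rw [e, abs_div, abs_of_pos hpos, mul_one_div]
  exact div_le_div_of_nonneg_right (hlow l) hpos.le

/-- The upper bound is uniform over `S`. For the lower bound a single `s₀` suffices: once `log L ≥ 2
K / (T s₀ |κ|)`, the bounded error takes at most half of the logarithmic term. -/
lemma supTheta_log {K R κ : ℝ} {T : V → ℝ} (hK : 0 ≤ K) (hκ : κ ≠ 0) (hS : S.Nonempty)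
    (hT : ∀ s ∈ S, 0 < T s ∧ T s ≤ R)
    (h : ∀ s ∈ S, ∀ l : ℕ,
      |k (l + 1) s - (((l : ℝ) + 1) * lim s + T s * κ * Real.log ((l : ℝ) + 1))| ≤ K) :
    SupTheta S (fun L s => |k L s / L - lim s|) (fun L => Real.log L / L) := by
  obtain ⟨s₀, hs₀⟩ := hS
  obtain ⟨hT0, hTR⟩ := hT s₀ hs₀
  have hR : 0 < R := hT0.trans_le hTR
  have hκ' : 0 < |κ| := abs_pos.2 hκ
  have hlog : Tendsto (fun L : ℕ => Real.log L) atTop atTop :=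
    Real.tendsto_log_atTop.comp tendsto_natCast_atTop_atTop
  refine ⟨T s₀ * |κ| / 2, by positivity, R * |κ| + K, by positivity, ?_⟩
  filter_upwards [eventually_ge_atTop 1, hlog.eventually_ge_atTop 1,
    hlog.eventually_ge_atTop (2 * K / (T s₀ * |κ|))] with L hL hL1 hL2
  obtain ⟨l, rfl⟩ := Nat.exists_eq_add_of_le' hL
  have hpos : (0 : ℝ) < (l + 1 : ℕ) := by positivity
  have e : ∀ s, k (l + 1) s / (l + 1 : ℕ) - lim s =
      ((k (l + 1) s - (((l : ℝ) + 1) * lim s + T s * κ * Real.log (l + 1 : ℕ))) +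
        T s * κ * Real.log (l + 1 : ℕ)) / (l + 1 : ℕ) := fun s => by
    field_simp; push_cast; ring
  have h' : ∀ s ∈ S,
      |k (l + 1) s - (((l : ℝ) + 1) * lim s + T s * κ * Real.log (l + 1 : ℕ))| ≤ K :=
    fun s hs => by simpa using h s hs l
  generalize Real.log (l + 1 : ℕ) = w at *
  have hw : 0 < w := by linarith
  have ew : ∀ s ∈ S, |T s * κ * w| = T s * |κ| * w := fun s hs => by
    rw [abs_mul, abs_mul, abs_of_pos (hT s hs).1, abs_of_pos hw]
  have hub : ∀ y ∈ (fun s => |k (l + 1) s / (l + 1 : ℕ) - lim s|) '' S,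
      y ≤ (R * |κ| + K) * (w / (l + 1 : ℕ)) := by
    rintro _ ⟨s, hs, rfl⟩
    simp only
    rw [e, abs_div, abs_of_pos hpos, ← mul_div_assoc]
    refine div_le_div_of_nonneg_right ?_ hpos.le
    refine (abs_add_le _ _).trans ?_
    rw [ew s hs]
    have h1 : T s * |κ| * w ≤ R * |κ| * w := by
      have := (hT s hs).2
      gcongr
    have h2 : K ≤ K * w := le_mul_of_one_le_right hK hL1
    linarith [h' s hs]
  refine ⟨⟨_, hub⟩, le_trans ?_ (le_csSup ⟨_, hub⟩ ⟨s₀, hs₀, rfl⟩), Real.sSup_le hub (by positivity)⟩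
  simp only
  rw [e, abs_div, abs_of_pos hpos, ← mul_div_assoc]
  refine div_le_div_of_nonneg_right ?_ hpos.le
  have h1 := abs_sub_abs_le_abs_add (T s₀ * κ * w)
    (k (l + 1) s₀ - (((l : ℝ) + 1) * lim s₀ + T s₀ * κ * w))
  rw [add_comm (T s₀ * κ * w), ew s₀ hs₀] at h1
  rw [div_le_iff₀ (by positivity)] at hL2
  linarith [h' s₀ hs₀]

end Suprema

/-! ### Abstract form of the rates -/

lemma offDiag_self {V : Type*} (lam : ℝ) (x : V) : offDiag lam x x = 1 := by simp [offDiag]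

lemma offDiag_of_ne {V : Type*} (lam : ℝ) {x x' : V} (h : x ≠ x') : offDiag lam x x' = lam := by
  simp [offDiag, h]

lemma sqrt_mul_le_of_le {a b R : ℝ} (ha : 0 ≤ a) (hb : 0 ≤ b) (haR : a ≤ R) (hbR : b ≤ R) :
    √(a * b) ≤ R := by
  rw [Real.sqrt_le_iff, sq]
  exact ⟨ha.trans haR, mul_le_mul haR hbR hb (ha.trans haR)⟩

section Rates

variable {V : Type*} {S : Set V} {k : ℕ → V → ℝ} {lim a b p : V → ℝ} {σb σw q ε R : ℝ}

lemma supTheta_relu (hσ : σw ^ 2 = 2) (hε : 0 < ε) (hS : S.Nonempty)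
    (ha : ∀ s ∈ S, 0 < a s ∧ a s ≤ R) (hb : ∀ s ∈ S, 0 < b s ∧ b s ≤ R)
    (hp : ∀ s ∈ S, |p s| ≤ √(a s * b s)) (hc : ∀ s ∈ S, p s / √(a s * b s) ≤ 1 - ε)
    (hk : ∀ s ∈ S, ∀ l, k (l + 1) s = ntkSeq relu 0 σw (a s) (b s) (p s) l)
    (hlim : ∀ s ∈ S, lim s = √(a s * b s) / 4) :
    SupTheta S (fun L s => |k L s / L - lim s|) (fun L => Real.log L / L) := by
  obtain ⟨K, hK, h⟩ := ntkSeq_relu_asymptotics (R := R) hσ hε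
  have hR : ∀ s ∈ S, √(a s * b s) ≤ R := fun s hs =>
    sqrt_mul_le_of_le (ha s hs).1.le (hb s hs).1.le (ha s hs).2 (hb s hs).2
  refine supTheta_log (T := fun s => √(a s * b s)) (κ := 3 / 8) hK (by norm_num) hS
    (fun s hs => ⟨Real.sqrt_pos.2 (mul_pos (ha s hs).1 (hb s hs).1), hR s hs⟩) fun s hs l => ?_
  rw [hk s hs, hlim s hs]
  refine le_trans (le_of_eq ?_)
    (h _ _ _ (ha s hs).1 (hb s hs).1 (hR s hs) (hp s hs) (hc s hs) l)
  congr 1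
  ring

namespace TanhEOC

lemma supTheta_tanh (h : TanhEOC σb σw q) (hε : 0 < ε) (hS : S.Nonempty)
    (ha : ∀ s ∈ S, σb ^ 2 ≤ a s ∧ a s ≤ R) (hb : ∀ s ∈ S, σb ^ 2 ≤ b s ∧ b s ≤ R)
    (hp : ∀ s ∈ S, |p s| ≤ √(a s * b s)) (hc : ∀ s ∈ S, p s / √(a s * b s) ≤ 1 - ε)
    (hk : ∀ s ∈ S, ∀ l, k (l + 1) s = ntkSeq Real.tanh σb σw (a s) (b s) (p s) l)
    (hlim : ∀ s ∈ S, lim s = q / 3) :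
    SupTheta S (fun L s => |k L s / L - lim s|) (fun L => Real.log L / L) := by
  obtain ⟨κ, hκ, h'⟩ := h.ntkSeq_asymptotics
  obtain ⟨K, hK, h'⟩ := h' R ε hε
  refine supTheta_log (T := fun _ => q) hK hκ hS (fun s hs => ⟨h.pos, le_rfl⟩) fun s hs l => ?_
  rw [hk s hs, hlim s hs]
  refine le_trans (le_of_eq ?_) (h' _ _ _ (ha s hs).1 (ha s hs).2 (hb s hs).1 (hb s hs).2
    (hp s hs) (hc s hs) l)
  congr 1
  ring

lemma supBigO_tanh (h : TanhEOC σb σw q) (ha : ∀ s ∈ S, 0 ≤ a s ∧ a s ≤ R)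
    (hk : ∀ s ∈ S, ∀ l, k (l + 1) s = ntkSeq Real.tanh σb σw (a s) (a s) (a s) l)
    (hlim : ∀ s ∈ S, lim s = q) :
    SupBigO S (fun L s => |k L s / L - lim s|) (fun L => 1 / L) := by
  obtain ⟨K, hK, h'⟩ := h.ntkSeq_self_bound R
  refine supBigO_inv hK fun s hs l => ?_
  rw [hk s hs, hlim s hs]
  exact h' _ (ha s hs).1 (ha s hs).2 l

lemma supTheta_diag_tanh (h : TanhEOC σb σw q) (ha : ∀ s ∈ S, 0 ≤ a s ∧ a s ≤ R)
    (hk : ∀ s ∈ S, ∀ l, k (l + 1) s = ntkSeq Real.tanh σb σw (a s) (a s) (a s) l)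
    (hlim : ∀ s ∈ S, lim s = q) (hne : ∃ s ∈ S, a s ≠ q) :
    SupTheta S (fun L s => |k L s / L - lim s|) (fun L => 1 / L) := by
  obtain ⟨K, hK, h'⟩ := h.ntkSeq_self_bound R
  obtain ⟨s₀, hs₀, hne⟩ := hne
  obtain ⟨η, hη, hlow⟩ := h.ntkSeq_self_lower (ha s₀ hs₀).1 hne
  refine supTheta_inv hK hη (fun s hs l => ?_) hs₀ fun l => ?_
  · rw [hk s hs, hlim s hs]
    exact h' _ (ha s hs).1 (ha s hs).2 l
  · rw [hk s₀ hs₀, hlim s₀ hs₀]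
    exact hlow l

end TanhEOC

end Rates

/-! ### The Edge of Chaos of ReLU networks -/

/-- Here `χ = σw² / 2` at every positive variance, so `σw² = 2`. The variance map is then the
translation by `σb²`, and a convergent orbit forces `σb = 0`. -/
theorem relu_EOC {σb σw : ℝ} (h : (σb, σw) ∈ EOC relu) : σb = 0 ∧ σw ^ 2 = 2 := by
  obtain ⟨-, -, q, ⟨hq, q₁, hq₁, hlim⟩, hchi⟩ := h
  simp only at hlim hchi
  have hσ : σw ^ 2 = 2 := by
    have e := gaussE_deriv_relu hq hq (p := q) (by rw [Real.sqrt_mul_self hq.le, abs_of_pos hq])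
    rw [gaussE_self _ hq.le, Real.sqrt_mul_self hq.le, div_self hq.ne', Real.arccos_one, sub_zero]
      at e
    rw [chi, e] at hchi
    have := Real.pi_pos
    field_simp at hchi
    linarith
  refine ⟨?_, hσ⟩
  have hstep : ∀ p, 0 ≤ p → varianceMap relu σb σw p = σb ^ 2 + p := fun p hp => by
    rw [varianceMap, ← gaussE_self _ hp, gaussE_relu_self hp, hσ]; ring
  have hpos : ∀ l, 0 ≤ (varianceMap relu σb σw)^[l] q₁ := fun l => by
    induction l with
    | zero => exact hq₁.le
    | succ l ih =>
      rw [Function.iterate_succ_apply', hstep _ ih]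
      positivity
  have hd := ((tendsto_add_atTop_iff_nat 1).2 hlim).sub hlim
  have hcongr : (fun l => (varianceMap relu σb σw)^[l + 1] q₁ - (varianceMap relu σb σw)^[l] q₁) =
      fun _ => σb ^ 2 := by
    funext l
    rw [Function.iterate_succ_apply', hstep _ (hpos l)]; ring
  rw [hcongr, sub_self] at hd
  have := tendsto_nhds_unique hd tendsto_const_nhds
  exact pow_eq_zero_iff two_ne_zero |>.1 this.symm

/-! ### First-layer covariances -/

/-- Cauchy-Schwarz for the vectors `√w f` and `√w g` with a common coordinate `√β` adjoined. It
makes first-layer correlations lie in `[-1, 1]`. -/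
lemma abs_affine_inner_le {ι : Type*} (s : Finset ι) (f g : ι → ℝ) {β w : ℝ} (hβ : 0 ≤ β)
    (hw : 0 ≤ w) : |β + w * ∑ i ∈ s, f i * g i| ≤
      √((β + w * ∑ i ∈ s, f i * f i) * (β + w * ∑ i ∈ s, g i * g i)) := by
  have hcs := Finset.sum_mul_sq_le_sq_mul_sq s f g
  simp only [sq (f _), sq (g _)] at hcs
  have hf : 0 ≤ ∑ i ∈ s, f i * f i := Finset.sum_nonneg fun i _ => mul_self_nonneg _
  have hg : 0 ≤ ∑ i ∈ s, g i * g i := Finset.sum_nonneg fun i _ => mul_self_nonneg _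
  generalize ∑ i ∈ s, f i * f i = A at *
  generalize ∑ i ∈ s, g i * g i = B at *
  generalize ∑ i ∈ s, f i * g i = t at *
  apply Real.le_sqrt_of_sq_le
  rw [sq_abs]
  have h1 : 2 * t ≤ A + B := by
    refine abs_le_of_sq_le_sq' ?_ (by linarith) |>.2
    linarith [sq_nonneg (A - B)]
  have h2 : β * w * (2 * t) ≤ β * w * (A + B) := by gcongr
  have h3 : w ^ 2 * t ^ 2 ≤ w ^ 2 * (A * B) := by gcongr
  linarith

section FFNN

variable {φ : ℝ → ℝ} {σb σw : ℝ} {d : ℕ}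

lemma ffnnCov_succ (x x' : Vec d) (l : ℕ) : ffnnCov φ σb σw (l + 1) x x' =
    covSeq φ σb σw (ffnnCov₁ σb σw x x) (ffnnCov₁ σb σw x' x') (ffnnCov₁ σb σw x x') l := by
  induction l generalizing x x' with
  | zero => rfl
  | succ l ih => rw [ffnnCov, covSeq, ih x x, ih x' x', ih x x', covSeq_self, covSeq_self]

lemma ffnnNTK_succ (x x' : Vec d) (l : ℕ) : ffnnNTK φ σb σw (l + 1) x x' =
    ntkSeq φ σb σw (ffnnCov₁ σb σw x x) (ffnnCov₁ σb σw x' x') (ffnnCov₁ σb σw x x') l := by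
  induction l with
  | zero => rfl
  | succ l ih =>
    rw [ffnnNTK, ntkSeq, ih, ffnnDot, dotSeq, ffnnCov_succ x x, ffnnCov_succ x' x',
      ffnnCov_succ x x' l, ffnnCov_succ x x' (l + 1), covSeq_self, covSeq_self]

lemma bias_le_ffnnCov₁ (x : Vec d) : σb ^ 2 ≤ ffnnCov₁ σb σw x x := by
  have : 0 ≤ σw ^ 2 / d * ∑ i, x i * x i :=
    mul_nonneg (by positivity) (Finset.sum_nonneg fun i _ => mul_self_nonneg _)
  unfold ffnnCov₁
  linarith

lemma abs_ffnnCov₁_le (x x' : Vec d) :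
    |ffnnCov₁ σb σw x x'| ≤ √(ffnnCov₁ σb σw x x * ffnnCov₁ σb σw x' x') :=
  abs_affine_inner_le _ _ _ (sq_nonneg _) (by positivity)

lemma ffnnCov₁_relu (x : Vec d) : ffnnCov₁ 0 σw x x = σw ^ 2 * ‖x‖ ^ 2 / d := by
  rw [ffnnCov₁, EuclideanSpace.real_norm_sq_eq]
  simp only [← sq]
  ring

lemma exists_ffnnCov₁_bound (σb σw : ℝ) {E : Set (Vec d)} (hE : IsCompact E) :
    ∃ R, ∀ x ∈ E, ffnnCov₁ σb σw x x ≤ R := by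
  obtain ⟨R, hR⟩ := hE.bddAbove_image (f := fun x : Vec d => ffnnCov₁ σb σw x x) (by
    unfold ffnnCov₁; fun_prop)
  exact ⟨R, fun x hx => hR ⟨x, hx, rfl⟩⟩

/-- An input of positive variance has correlation 1 with itself, which `c¹ ≤ 1 - ε` excludes; so the
limit kernel takes its off-diagonal value on `B_ε`. -/
lemma ne_of_mem_ffnnB {E : Set (Vec d)} {ε : ℝ} (hε : 0 < ε) {p : Vec d × Vec d}
    (hp : p ∈ ffnnB σb σw E ε) : p.1 ≠ p.2 := by
  obtain ⟨-, -, h1, -, h2⟩ := hp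
  intro e
  rw [ffnnCorr₁, ← e, Real.sqrt_mul_self h1.le, div_self h1.ne'] at h2
  linarith

end FFNN

section CNN

variable {φ : ℝ → ℝ} {σb σw : ℝ} {k n₀ M : ℕ}

lemma card_filter (k : ℕ) : ((Finset.Icc (-(k : ℤ)) k).card : ℝ) = 2 * (k : ℝ) + 1 := by
  rw [Int.card_Icc]
  have : ((k : ℤ) + 1 - -(k : ℤ)).toNat = 2 * k + 1 := by omega
  rw [this]; push_cast; ring

lemma filterAvg_const (k : ℕ) (c : ℝ) (α α' : ZMod M) : filterAvg k (fun _ _ => c) α α' = c := by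
  rw [filterAvg, Finset.sum_const, nsmul_eq_mul, card_filter]
  field_simp

/-- Independence of the positions propagates through the layers, since the filter then averages a
constant. The position `0` serves as representative, and index `l` of the scalar sequence is layer
`l + 1`. -/
lemma cnnCov_succ {X : Set (Sig n₀ M)} (hX : CNNAssumption σb σw k X) {x x' : Sig n₀ M}
    (hx : x ∈ X) (hx' : x' ∈ X) (l : ℕ) (α α' : ZMod M) : cnnCov φ σb σw k (l + 1) x x' α α' =
    covSeq φ σb σw (cnnCov₁ σb σw k x x 0 0) (cnnCov₁ σb σw k x' x' 0 0)
      (cnnCov₁ σb σw k x x' 0 0) l := by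
  induction l generalizing x x' α α' with
  | zero => exact hX x hx x' hx' _ _ _ _
  | succ l ih =>
    rw [cnnCov, covSeq]
    simp only [ih hx hx, ih hx' hx', ih hx hx', covSeq_self]
    exact filterAvg_const k _ α α'

lemma cnnNTK_succ {X : Set (Sig n₀ M)} (hX : CNNAssumption σb σw k X) {x x' : Sig n₀ M}
    (hx : x ∈ X) (hx' : x' ∈ X) (l : ℕ) (α α' : ZMod M) : cnnNTK φ σb σw k (l + 1) x x' α α' =
    ntkSeq φ σb σw (cnnCov₁ σb σw k x x 0 0) (cnnCov₁ σb σw k x' x' 0 0)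
      (cnnCov₁ σb σw k x x' 0 0) l := by
  induction l generalizing α α' with
  | zero => exact hX x hx x' hx' _ _ _ _
  | succ l ih =>
    rw [cnnNTK, ntkSeq, dotSeq, covSeq]
    simp only [cnnDot, cnnHat, cnnCov_succ hX hx hx, cnnCov_succ hX hx' hx', cnnCov_succ hX hx hx',
      ih, covSeq_self]
    exact filterAvg_const k _ α α'

lemma cnnCov₁_eq (σb σw : ℝ) (k : ℕ) (x x' : Sig n₀ M) (α α' : ZMod M) :
    cnnCov₁ σb σw k x x' α α' = σb ^ 2 + σw ^ 2 / (n₀ * (2 * (k : ℝ) + 1)) *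
      ∑ i ∈ Finset.univ ×ˢ Finset.Icc (-(k : ℤ)) k,
        x (i.1, α + (i.2 : ZMod M)) * x' (i.1, α' + (i.2 : ZMod M)) := by
  rw [cnnCov₁, Finset.sum_product]

lemma bias_le_cnnCov₁ (x : Sig n₀ M) (α : ZMod M) : σb ^ 2 ≤ cnnCov₁ σb σw k x x α α := by
  have : 0 ≤ σw ^ 2 / (n₀ * (2 * (k : ℝ) + 1)) *
      ∑ i ∈ Finset.univ ×ˢ Finset.Icc (-(k : ℤ)) k,
        x (i.1, α + (i.2 : ZMod M)) * x (i.1, α + (i.2 : ZMod M)) :=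
    mul_nonneg (by positivity) (Finset.sum_nonneg fun i _ => mul_self_nonneg _)
  rw [cnnCov₁_eq]
  linarith

lemma abs_cnnCov₁_le (x x' : Sig n₀ M) (α α' : ZMod M) : |cnnCov₁ σb σw k x x' α α'| ≤
    √(cnnCov₁ σb σw k x x α α * cnnCov₁ σb σw k x' x' α' α') := by
  simp only [cnnCov₁_eq]
  exact abs_affine_inner_le _ (fun i : Fin n₀ × ℤ => x (i.1, α + (i.2 : ZMod M)))
    (fun i => x' (i.1, α' + (i.2 : ZMod M))) (sq_nonneg _) (by positivity)

/-- Sum the variance over all positions: by periodicity each coordinate of `x` is counted `2k + 1`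
times, which produces `‖x‖²`. By Assumption 1 all the `M` summands are equal. -/
lemma cnnCov₁_relu [NeZero M] {X : Set (Sig n₀ M)} (hX : CNNAssumption 0 σw k X)
    {x : Sig n₀ M} (hx : x ∈ X) : cnnCov₁ 0 σw k x x 0 0 =
      σw ^ 2 * ‖x‖ ^ 2 / Fintype.card (Fin n₀ × ZMod M) := by
  have hM : (M : ℝ) ≠ 0 := Nat.cast_ne_zero.2 (NeZero.ne M)
  have h1 : ∑ α : ZMod M, cnnCov₁ 0 σw k x x α α = M * cnnCov₁ 0 σw k x x 0 0 := by
    rw [Finset.sum_congr rfl fun α _ => hX x hx x hx α α 0 0, Finset.sum_const, Finset.card_univ,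
      ZMod.card, nsmul_eq_mul]
  have h2 : ∑ α : ZMod M, ∑ j, ∑ β ∈ Finset.Icc (-(k : ℤ)) k,
      x (j, α + (β : ZMod M)) * x (j, α + (β : ZMod M)) = (2 * (k : ℝ) + 1) * ‖x‖ ^ 2 := by
    rw [EuclideanSpace.real_norm_sq_eq, Fintype.sum_prod_type, Finset.sum_comm, Finset.mul_sum]
    refine Finset.sum_congr rfl fun j _ => ?_
    rw [Finset.sum_comm, ← card_filter, ← nsmul_eq_mul, ← Finset.sum_const]
    refine Finset.sum_congr rfl fun β _ => ?_
    refine (Equiv.sum_comp (Equiv.addRight (β : ZMod M)) fun α => x (j, α) * x (j, α)).trans ?_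
    simp [sq]
  simp only [cnnCov₁] at h1
  have h3 : ∑ α : ZMod M, ((0 : ℝ) ^ 2 + σw ^ 2 / (n₀ * (2 * (k : ℝ) + 1)) *
      ∑ j, ∑ β ∈ Finset.Icc (-(k : ℤ)) k, x (j, α + (β : ZMod M)) * x (j, α + (β : ZMod M))) =
      σw ^ 2 / (n₀ * (2 * (k : ℝ) + 1)) * ((2 * (k : ℝ) + 1) * ‖x‖ ^ 2) := by
    rw [← h2, Finset.mul_sum]
    simp
  rw [h3] at h1
  rw [Fintype.card_prod, Fintype.card_fin, ZMod.card]
  simp only [cnnCov₁]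
  have hk : (2 * (k : ℝ) + 1) ≠ 0 := by positivity
  rw [eq_comm, mul_comm (M : ℝ), ← eq_div_iff hM] at h1
  rw [h1]
  push_cast
  field_simp

lemma exists_cnnCov₁_bound (σb σw : ℝ) (k : ℕ) [NeZero M] {E : Set (Sig n₀ M)}
    (hE : IsCompact E) : ∃ R, ∀ x ∈ E, cnnCov₁ σb σw k x x 0 0 ≤ R := by
  obtain ⟨R, hR⟩ := hE.bddAbove_image (f := fun x : Sig n₀ M => cnnCov₁ σb σw k x x 0 0) (by
    unfold cnnCov₁; fun_prop)
  exact ⟨R, fun x hx => hR ⟨x, hx, rfl⟩⟩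

lemma ne_of_mem_cnnB {S : Set (Sig n₀ M)} {ε : ℝ} (hε : 0 < ε) {p : Sig n₀ M × Sig n₀ M}
    (hp : p ∈ cnnB σb σw k S ε) : p.1 ≠ p.2 := by
  obtain ⟨-, -, h⟩ := hp
  obtain ⟨h1, -, h2⟩ := h 0 0
  intro e
  rw [cnnCorr₁, ← e, Real.sqrt_mul_self h1.le, div_self h1.ne'] at h2
  linarith

end CNN

lemma sqrt_mul_reluVariance (w x y n : ℝ) (hw : 0 ≤ w) (hx : 0 ≤ x) (hy : 0 ≤ y) (hn : 0 ≤ n) :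
    √(w * x ^ 2 / n * (w * y ^ 2 / n)) = w * x * y / n := by
  have e : w * x ^ 2 / n * (w * y ^ 2 / n) = (w * x * y / n) ^ 2 := by ring
  rw [e, Real.sqrt_sq (by positivity)]

end NTKEOC

/-! ### Assembly of the theorem. -/

open NTKEOC
theorem theorem1 :
    -- ReLU
    (∀ σb σw : ℝ, (σb, σw) ∈ EOC relu → ∃ lam ∈ Set.Ioo (0 : ℝ) 1,
      -- fully connected networks
      (∀ d : ℕ, 0 < d → ∀ E : Set (Vec d), IsCompact E →
        (∀ L : ℕ, 1 ≤ L → ∀ x ∈ E, ffnnANTK relu σb σw L x x = reluLimit σw lam x x) ∧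
        ∀ ε ∈ Set.Ioo (0 : ℝ) 1, (ffnnB σb σw E ε).Nonempty →
          SupTheta (ffnnB σb σw E ε)
            (fun L p => |ffnnANTK relu σb σw L p.1 p.2 - reluLimit σw lam p.1 p.2|)
            (fun L => Real.log L / L)) ∧
      -- convolutional networks
      (∀ (k n₀ M : ℕ) [NeZero M], 0 < n₀ → ∀ E X : Set (Sig n₀ M), IsCompact E →
        CNNAssumption σb σw k X → ∀ α α' : ZMod M,
        (∀ L : ℕ, 1 ≤ L → ∀ x ∈ E ∩ X,
          cnnANTK relu σb σw k L x x α α' = reluLimit σw lam x x) ∧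
        ∀ ε ∈ Set.Ioo (0 : ℝ) 1, (cnnB σb σw k (E ∩ X) ε).Nonempty →
          SupTheta (cnnB σb σw k (E ∩ X) ε)
            (fun L p => |cnnANTK relu σb σw k L p.1 p.2 α α' - reluLimit σw lam p.1 p.2|)
            (fun L => Real.log L / L))) ∧
    -- Tanh
    (∀ σb σw : ℝ, (σb, σw) ∈ EOC Real.tanh → ∃ lam ∈ Set.Ioo (0 : ℝ) 1, ∃ q : ℝ, 0 < q ∧
      -- fully connected networks
      (∀ d : ℕ, 0 < d → ∀ E : Set (Vec d), IsCompact E →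
        (∀ x : Vec d, Filter.Tendsto (fun l : ℕ => ffnnCov Real.tanh σb σw l x x) Filter.atTop
          (nhds q)) ∧
        SupBigO E (fun L x => |ffnnANTK Real.tanh σb σw L x x - tanhLimit q lam x x|)
          (fun L => 1 / L) ∧
        ((∃ x ∈ E, ffnnCov₁ σb σw x x ≠ q) →
          SupTheta E (fun L x => |ffnnANTK Real.tanh σb σw L x x - tanhLimit q lam x x|)
            (fun L => 1 / L)) ∧
        ∀ ε ∈ Set.Ioo (0 : ℝ) 1, (ffnnB σb σw E ε).Nonempty →
          SupTheta (ffnnB σb σw E ε)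
            (fun L p => |ffnnANTK Real.tanh σb σw L p.1 p.2 - tanhLimit q lam p.1 p.2|)
            (fun L => Real.log L / L)) ∧
      -- convolutional networks
      (∀ (k n₀ M : ℕ) [NeZero M], 0 < n₀ → ∀ E X : Set (Sig n₀ M), IsCompact E →
        CNNAssumption σb σw k X → ∀ α α' : ZMod M,
        SupBigO (E ∩ X) (fun L x => |cnnANTK Real.tanh σb σw k L x x α α' - tanhLimit q lam x x|)
          (fun L => 1 / L) ∧
        ((∃ x ∈ E ∩ X, cnnCov₁ σb σw k x x α α ≠ q) →
          SupTheta (E ∩ X)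
            (fun L x => |cnnANTK Real.tanh σb σw k L x x α α' - tanhLimit q lam x x|)
            (fun L => 1 / L)) ∧
        ∀ ε ∈ Set.Ioo (0 : ℝ) 1, (cnnB σb σw k (E ∩ X) ε).Nonempty →
          SupTheta (cnnB σb σw k (E ∩ X) ε)
            (fun L p => |cnnANTK Real.tanh σb σw k L p.1 p.2 α α' - tanhLimit q lam p.1 p.2|)
            (fun L => Real.log L / L))) := by
  -- `λ = 1 / (μ + 1)`, where `μ`, the ratio of the slope of the derivative factor to the quadratic
  -- coefficient of the defect, is 3 for ReLU and 2 for Tanh.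
  refine ⟨fun σb σw h => ⟨1 / 4, by norm_num, ?_, ?_⟩,
    fun σb σw h => ⟨1 / 3, by norm_num, ?_⟩⟩
  · obtain ⟨rfl, hσ⟩ := relu_EOC h
    intro d hd E hE
    obtain ⟨R, hR⟩ := exists_ffnnCov₁_bound 0 σw hE
    constructor
    · intro L hL x _
      obtain ⟨l, rfl⟩ := Nat.exists_eq_add_of_le' hL
      have hx : 0 ≤ ffnnCov₁ 0 σw x x := by simpa using bias_le_ffnnCov₁ (σb := 0) (σw := σw) x
      rw [ffnnANTK, ffnnNTK_succ, ntkSeq_relu_self hσ hx, reluLimit, offDiag_self, ffnnCov₁_relu,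
        Fintype.card_fin]
      field_simp
      push_cast
      ring
    · intro ε hε hB
      refine supTheta_relu (S := ffnnB 0 σw E ε) (a := fun p => ffnnCov₁ 0 σw p.1 p.1)
        (b := fun p => ffnnCov₁ 0 σw p.2 p.2) (p := fun p => ffnnCov₁ 0 σw p.1 p.2)
        (k := fun L p => ffnnNTK relu 0 σw L p.1 p.2) hσ hε.1 hB
        (fun p hp => ⟨hp.2.2.1, hR _ hp.1⟩) (fun p hp => ⟨hp.2.2.2.1, hR _ hp.2.1⟩)
        (fun p _ => abs_ffnnCov₁_le _ _) (fun p hp => hp.2.2.2.2)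
        (fun p _ l => ffnnNTK_succ _ _ l) fun p hp => ?_
      rw [ffnnCov₁_relu, ffnnCov₁_relu, sqrt_mul_reluVariance _ _ _ _ (sq_nonneg σw)
        (norm_nonneg _) (norm_nonneg _) (Nat.cast_nonneg d), reluLimit,
        offDiag_of_ne _ (ne_of_mem_ffnnB hε.1 hp), Fintype.card_fin]
      ring
  · obtain ⟨rfl, hσ⟩ := relu_EOC h
    intro k n₀ M _ hn₀ E X hE hX α α'
    obtain ⟨R, hR⟩ := exists_cnnCov₁_bound 0 σw k hE
    constructor
    · intro L hL x hx
      obtain ⟨l, rfl⟩ := Nat.exists_eq_add_of_le' hL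
      have hx0 : 0 ≤ cnnCov₁ 0 σw k x x 0 0 := by
        simpa using bias_le_cnnCov₁ (σb := 0) (σw := σw) (k := k) x 0
      rw [cnnANTK, cnnNTK_succ hX hx.2 hx.2, ntkSeq_relu_self hσ hx0, reluLimit, offDiag_self,
        cnnCov₁_relu hX hx.2]
      field_simp
      push_cast
      ring
    · intro ε hε hB
      refine supTheta_relu (S := cnnB 0 σw k (E ∩ X) ε) (a := fun p => cnnCov₁ 0 σw k p.1 p.1 0 0)
        (b := fun p => cnnCov₁ 0 σw k p.2 p.2 0 0) (p := fun p => cnnCov₁ 0 σw k p.1 p.2 0 0)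
        (k := fun L p => cnnNTK relu 0 σw k L p.1 p.2 α α') hσ hε.1 hB
        (fun p hp => ⟨(hp.2.2 0 0).1, hR _ hp.1.1⟩)
        (fun p hp => ⟨(hp.2.2 0 0).2.1, hR _ hp.2.1.1⟩)
        (fun p _ => abs_cnnCov₁_le _ _ _ _) (fun p hp => (hp.2.2 0 0).2.2)
        (fun p hp l => cnnNTK_succ hX hp.1.2 hp.2.1.2 l _ _) fun p hp => ?_
      rw [cnnCov₁_relu hX hp.1.2, cnnCov₁_relu hX hp.2.1.2, sqrt_mul_reluVariance _ _ _ _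
        (sq_nonneg σw) (norm_nonneg _) (norm_nonneg _) (Nat.cast_nonneg _), reluLimit,
        offDiag_of_ne _ (ne_of_mem_cnnB hε.1 hp)]
      ring
  · obtain ⟨q, hq⟩ := exists_tanhEOC h
    refine ⟨q, hq.pos, ?_, ?_⟩
    · intro d hd E hE
      obtain ⟨R, hR⟩ := exists_ffnnCov₁_bound σb σw hE
      have ha : ∀ x ∈ E, 0 ≤ ffnnCov₁ σb σw x x ∧ ffnnCov₁ σb σw x x ≤ R := fun x hx =>
        ⟨(sq_nonneg σb).trans (bias_le_ffnnCov₁ x), hR x hx⟩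
      refine ⟨fun x => ?_, ?_, fun hne => ?_, fun ε hε hB => ?_⟩
      -- The shift discards the artificial layer `l = 0`, whose covariance is 0.
      · rw [← tendsto_add_atTop_iff_nat 1]
        refine (hq.tendsto_varSeq ((sq_nonneg σb).trans (bias_le_ffnnCov₁ (σw := σw) x))).congr
          fun l => ?_
        rw [ffnnCov_succ, covSeq_self]
      · exact hq.supBigO_tanh (k := fun L x => ffnnNTK Real.tanh σb σw L x x) ha
          (fun x _ l => ffnnNTK_succ x x l) fun x _ => by rw [tanhLimit, offDiag_self, mul_one]
      · exact hq.supTheta_diag_tanh (k := fun L x => ffnnNTK Real.tanh σb σw L x x) ha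
          (fun x _ l => ffnnNTK_succ x x l) (fun x _ => by rw [tanhLimit, offDiag_self, mul_one])
          hne
      · refine hq.supTheta_tanh (S := ffnnB σb σw E ε) (a := fun p => ffnnCov₁ σb σw p.1 p.1)
          (b := fun p => ffnnCov₁ σb σw p.2 p.2) (p := fun p => ffnnCov₁ σb σw p.1 p.2)
          (k := fun L p => ffnnNTK Real.tanh σb σw L p.1 p.2) hε.1 hB
          (fun p hp => ⟨bias_le_ffnnCov₁ _, hR _ hp.1⟩)
          (fun p hp => ⟨bias_le_ffnnCov₁ _, hR _ hp.2.1⟩)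
          (fun p _ => abs_ffnnCov₁_le _ _) (fun p hp => hp.2.2.2.2)
          (fun p _ l => ffnnNTK_succ _ _ l) fun p hp => ?_
        rw [tanhLimit, offDiag_of_ne _ (ne_of_mem_ffnnB hε.1 hp)]
        ring
    · intro k n₀ M _ hn₀ E X hE hX α α'
      obtain ⟨R, hR⟩ := exists_cnnCov₁_bound σb σw k hE
      have ha : ∀ x ∈ E ∩ X, 0 ≤ cnnCov₁ σb σw k x x 0 0 ∧ cnnCov₁ σb σw k x x 0 0 ≤ R :=
        fun x hx => ⟨(sq_nonneg σb).trans (bias_le_cnnCov₁ x 0), hR x hx.1⟩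
      refine ⟨?_, fun hne => ?_, fun ε hε hB => ?_⟩
      · exact hq.supBigO_tanh (k := fun L x => cnnNTK Real.tanh σb σw k L x x α α') ha
          (fun x hx l => cnnNTK_succ hX hx.2 hx.2 l _ _)
          fun x _ => by rw [tanhLimit, offDiag_self, mul_one]
      · refine hq.supTheta_diag_tanh (k := fun L x => cnnNTK Real.tanh σb σw k L x x α α') ha
          (fun x hx l => cnnNTK_succ hX hx.2 hx.2 l _ _)
          (fun x _ => by rw [tanhLimit, offDiag_self, mul_one]) ?_
        obtain ⟨x, hx, hxq⟩ := hne
        exact ⟨x, hx, by rwa [hX x hx.2 x hx.2 0 0 α α]⟩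
      · refine hq.supTheta_tanh (S := cnnB σb σw k (E ∩ X) ε)
          (a := fun p => cnnCov₁ σb σw k p.1 p.1 0 0)
          (b := fun p => cnnCov₁ σb σw k p.2 p.2 0 0) (p := fun p => cnnCov₁ σb σw k p.1 p.2 0 0)
          (k := fun L p => cnnNTK Real.tanh σb σw k L p.1 p.2 α α') hε.1 hB
          (fun p hp => ⟨bias_le_cnnCov₁ _ _, hR _ hp.1.1⟩)
          (fun p hp => ⟨bias_le_cnnCov₁ _ _, hR _ hp.2.1.1⟩)
          (fun p _ => abs_cnnCov₁_le _ _ _ _) (fun p hp => (hp.2.2 0 0).2.2)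
          (fun p hp l => cnnNTK_succ hX hp.1.2 hp.2.1.2 l _ _) fun p hp => ?_
        rw [tanhLimit, offDiag_of_ne _ (ne_of_mem_cnnB hε.1 hp)]
        ring
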